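/- Let $K,p,m\ge 0$ be integers, let $\Gamma\subset\mathbb R^p$ and $\Xi\subset\mathbb R^m$ be compact sets on which derivatives are well defined up to the boundary (at every point of the set, the tangent directions to the set span a dense subspace, e.g. the set is convex with non-empty interior), and let $\Theta=\Gamma\times\Xi$. Derivatives in $\eta\in\Gamma$, $\varpi\in\Xi$, $\vartheta=(\eta,\varpi)\in\Theta$ are taken relative to these sets. Let $\mu_k(x,\eta)\ge 0$, $\varphi_{kl}(t,\eta)\ge 0$, $g(x,\varpi)\ge 0$ for $x\in[0,1]$, $t\ge 0$, $1\le k,l\le K$, and let $\Phi_k:\mathbb R\to\mathbb R$ be non-negative on $[0,\infty)$. For $T>0$ and a $K$-variate simple point process $N^T=(N^T_{1},\dots,N^T_{K})$ on $(0,T]$ with finitely many jumps, put $$\lambda^T_{k,t}(\vartheta)=\Phi_k\Bigl[\mu_k\bigl(\tfrac tT,\eta\bigr)+\sum_{l=1}^K\int_{[0,t)}g\bigl(\tfrac tT,\varpi\bigr)\varphi_{kl}(t-s,\eta)\,dN^T_{l,s}\Bigr],\qquad t\in[0,T].$$ Fix a true parameter $\vartheta^*=(\eta^*,\varpi^*)\in\Theta$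 and assume the following. 1. (Lipschitz) $|\Phi_k(x)-\Phi_k(y)|\le|x-y|$ for all $x,y\in\mathbb R$ and all $k$. 2. (Stability) $\sup_{x\in[0,1]}g(x,\varpi^*)\,\rho\bigl(\bigl(\int_0^\infty\varphi_{kl}(s,\eta^*)\,ds\bigr)_{kl}\bigr)<1$, where $\rho$ is the spectral radius. 3. (Differentiability) For all $x\in[0,1]$, $t\ge 0$, the functions $\mu_k(x,\cdot)$ and $\varphi_{kl}(t,\cdot)$ are of class $C^3$ on $\Gamma$, and for $i=0,\dots,3$ the derivatives $\partial^i_\eta\mu_k$ are bounded on $[0,1]\times\Gamma$. 4. (Continuity in time) For all $\eta\in\Gamma$ and $i=0,\dots,3$, the function $t\mapsto\partial^i_\eta\varphi_{kl}(t,\eta)$ is continuous on $[0,\infty)$ except at finitely many points. 5. (Integrability) For $i=0,\dots,3$ and every integer $q\ge 1$, the function $t\mapsto\sup_{\eta\in\Gamma}\|\partial_\eta^i\varphi_{kl}(t,\eta)\|$ is in $L^q[0,\infty)$. 6. (Reproduction rate) $g(x,\cdot)$ is of class $C^3$ on $\Xi$ for each $x\in[0,1]$, and for $i=0,\dots,3$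 the function $\partial^i_\varpi g$ is continuous in $x\in[0,1]$ and equicontinuous in $\varpi\in\Xi$, uniformly in $x$. Let $i\in\{0,1,2,3\}$ and $q\in\mathbb N$. If $i\ge 1$, assume moreover that each $\Phi_k$ is of class $C^i$ on $[0,\infty)$, with bounded derivatives of the orders $2,\dots,i$ there. Then there is a finite constant $C$, depending only on $i$, $q$, $\vartheta^*$ and the data $(\Phi,\mu,\varphi,g,\Gamma,\Xi)$, such that for every $T>0$, every filtered probability space, and every adapted $K$-variate point process $N^T$ on it (simple, finite, without common jumps) whose components $N^T_k$ have the predictable intensities $\lambda^T_{k,t}(\vartheta^*)$, the functions $\lambda^T_{k,t}$ are $C^i$ on $\Theta$ for every $t\in[0,T]$, the supremum below is a random variable, and $$\mathbb E\Bigl[\sup_{\vartheta\in\Theta}\bigl\|\partial^i_\vartheta\lambda^T_t(\vartheta)\bigr\|_q^q\Bigr]\le C .$$ Here $\|\partial^i_\vartheta\lambda^T_t(\vartheta)\|_q^q$ is the sum of the $q$-th powers of the absolute values of all the partial derivatives of order $i$ (indexed by $i$-tuples of coordinates of $\vartheta$) of all the components $\lambda^T_{k,t}(\vartheta)$, with $0^0=1$.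 In particular, for any choice of such a process for each $T$, $\sup_{T>0}\sup_{t\in[0,T]}\mathbb E\bigl[\sup_{\vartheta\in\Theta}\|\partial^i_\vartheta\lambda^T_t(\vartheta)\|_q^q\bigr]<\infty$. -/

import Mathlib

open Set MeasureTheory
open scoped NNReal ENNReal

/-- The data of a parametric, nonlinear, locally stationary Hawkes model with `K` components,
`p` shape parameters `η` and `m` reproduction-rate parameters `ϖ`: the activation functions
`Φ k`, the baselines `μ k x η` (`x` the rescaled time in `[0, 1]`), the kernels `φ k l t η`
(`t ≥ 0`), the reproduction rate `g x ϖ`, and the parameter sets `Γ` and `Ξ`. -/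
structure HawkesModel (K p m : ℕ) where
  Φ : Fin K → ℝ → ℝ
  μ : Fin K → ℝ → (Fin p → ℝ) → ℝ
  φ : Fin K → Fin K → ℝ → (Fin p → ℝ) → ℝ
  g : ℝ → (Fin m → ℝ) → ℝ
  Γ : Set (Fin p → ℝ)
  Ξ : Set (Fin m → ℝ)

namespace HawkesModel

variable {K p m : ℕ}

/-- The parameter space `Θ = Γ × Ξ`. -/
def Θ (M : HawkesModel K p m) : Set ((Fin p → ℝ) × (Fin m → ℝ)) := M.Γ ×ˢ M.Ξ

/-- The parameter sets are compact, and derivatives relative to them are unambiguous, at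
boundary points too (e.g. the sets are convex with non-empty interior). -/
structure ParameterSets (M : HawkesModel K p m) : Prop where
  compact_Γ : IsCompact M.Γ
  compact_Ξ : IsCompact M.Ξ
  uniqueDiff_Γ : UniqueDiffOn ℝ M.Γ
  uniqueDiff_Ξ : UniqueDiffOn ℝ M.Ξ

/-- Baselines, kernels, reproduction rates and activation functions take non-negative values
(no inhibition). -/
structure Nonneg (M : HawkesModel K p m) : Prop where
  Φ_nonneg : ∀ k, ∀ y, 0 ≤ y → 0 ≤ M.Φ k y
  μ_nonneg : ∀ k, ∀ x ∈ Icc (0 : ℝ) 1, ∀ η ∈ M.Γ, 0 ≤ M.μ k x η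
  φ_nonneg : ∀ k l, ∀ t, 0 ≤ t → ∀ η ∈ M.Γ, 0 ≤ M.φ k l t η
  g_nonneg : ∀ x ∈ Icc (0 : ℝ) 1, ∀ ϖ ∈ M.Ξ, 0 ≤ M.g x ϖ

/-- Every activation function is `1`-Lipschitz. -/
def LipschitzActivation (M : HawkesModel K p m) : Prop :=
  ∀ k, ∀ x y : ℝ, |M.Φ k x - M.Φ k y| ≤ |x - y|

/-- Every activation function is of class `C^i` on `[0, ∞)`, with bounded derivatives of the
orders `2, …, i` there. For a Lipschitz `Φ` this says nothing if `i = 0`. -/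
def SmoothActivation (M : HawkesModel K p m) (i : ℕ) : Prop :=
  ∀ k, ContDiffOn ℝ i (M.Φ k) (Ici 0) ∧
    ∀ j, 2 ≤ j → j ≤ i → ∃ B : ℝ, ∀ y, 0 ≤ y →
      |iteratedDerivWithin j (M.Φ k) (Ici 0) y| ≤ B

/-- The matrix `(∫₀^∞ φ_{kl}(s, η) ds)_{kl}`, with entries regarded as complex numbers. -/
noncomputable def kernelMatrix (M : HawkesModel K p m) (η : Fin p → ℝ) :
    Matrix (Fin K) (Fin K) ℂ :=
  Matrix.of fun k l => ((∫ s in Ioi (0 : ℝ), M.φ k l s η : ℝ) : ℂ)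

/-- Stability at the parameter `(η, ϖ)`:
`sup_{x ∈ [0, 1]} g(x, ϖ) ρ(∫₀^∞ φ(s, η) ds) < 1`, where `ρ` is the spectral radius. -/
def Stable (M : HawkesModel K p m) (ϑ : (Fin p → ℝ) × (Fin m → ℝ)) : Prop :=
  (⨆ x ∈ Icc (0 : ℝ) 1,
    ENNReal.ofReal (M.g x ϑ.2) * spectralRadius ℂ (M.kernelMatrix ϑ.1)) < 1

/-- Baselines and kernels are three times continuously differentiable in `η` over `Γ`. -/
structure Differentiable (M : HawkesModel K p m) : Prop where
  μ_contDiffOn : ∀ k, ∀ x ∈ Icc (0 : ℝ) 1, ContDiffOn ℝ 3 (M.μ k x) M.Γ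
  φ_contDiffOn : ∀ k l, ∀ t, 0 ≤ t → ContDiffOn ℝ 3 (M.φ k l t) M.Γ

/-- The kernels and their derivatives in `η` of orders up to `3` are continuous in time, but for
finitely many times. -/
def ContinuousInTime (M : HawkesModel K p m) : Prop :=
  ∀ i ≤ 3, ∀ k l, ∀ η ∈ M.Γ, ∃ D : Set ℝ, D.Finite ∧
    ContinuousOn (fun t => iteratedFDerivWithin ℝ i (M.φ k l t) M.Γ η) (Ici 0 \ D)

/-- The function `t ↦ sup_{η ∈ Γ} ‖∂_η^i φ(t, η)‖` is in `L^q[0, ∞)` for `i = 0, …, 3` and every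
`q ≥ 1`. -/
def IntegrableKernels (M : HawkesModel K p m) : Prop :=
  ∀ i ≤ 3, ∀ k l, ∀ q : ℕ, 1 ≤ q →
    ∫⁻ t in Ioi (0 : ℝ), (⨆ η ∈ M.Γ, ‖iteratedFDerivWithin ℝ i (M.φ k l t) M.Γ η‖ₑ) ^ q < ∞

/-- The baselines and their derivatives in `η` of orders up to `3` are bounded. -/
def BoundedBaselines (M : HawkesModel K p m) : Prop :=
  ∃ B : ℝ, ∀ i ≤ 3, ∀ k, ∀ x ∈ Icc (0 : ℝ) 1, ∀ η ∈ M.Γ,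
    ‖iteratedFDerivWithin ℝ i (M.μ k x) M.Γ η‖ ≤ B

/-- The reproduction rates are three times differentiable in `ϖ` over `Ξ`, and their derivatives
of orders `0, …, 3` are continuous in `x` and equicontinuous in `ϖ`, uniformly in `x`. -/
structure RegularReproduction (M : HawkesModel K p m) : Prop where
  contDiffOn : ∀ x ∈ Icc (0 : ℝ) 1, ContDiffOn ℝ 3 (M.g x) M.Ξ
  continuousOn : ∀ i ≤ 3, ∀ ϖ ∈ M.Ξ,
    ContinuousOn (fun x => iteratedFDerivWithin ℝ i (M.g x) M.Ξ ϖ) (Icc (0 : ℝ) 1)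
  equicontinuousOn : ∀ i ≤ 3,
    UniformEquicontinuousOn
      (fun (x : Icc (0 : ℝ) 1) ϖ => iteratedFDerivWithin ℝ i (M.g x) M.Ξ ϖ) M.Ξ

/-- The intensity
`λ^T_{k,t}(ϑ) = Φ_k[μ_k(t/T, η) + ∑_l ∫_{[0,t)} g(t/T, ϖ) φ_{kl}(t - s, η) dN_{l,s}]`
computed from a realisation `S` of the point process on `(0, T]`: `S l` is the set of the jump
times of the `l`-th component, so that the integral is a sum over the points of `S l` before
`t`. -/
noncomputable def intensity (M : HawkesModel K p m) (T : ℝ≥0) (S : Fin K → Finset ℝ≥0)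
    (k : Fin K) (t : ℝ≥0) (ϑ : (Fin p → ℝ) × (Fin m → ℝ)) : ℝ :=
  M.Φ k (M.μ k (t / T) ϑ.1 +
    ∑ l, ∑ s ∈ (S l).filter (· < t), M.g (t / T) ϑ.2 * M.φ k l (t - s) ϑ.1)

/-- The coordinate directions of the parameter space. -/
def direction : Fin p ⊕ Fin m → (Fin p → ℝ) × (Fin m → ℝ)
  | Sum.inl a => (Pi.single a 1, 0)
  | Sum.inr b => (0, Pi.single b 1)

/-- The `q`-th power `‖∂_ϑ^i λ^T_t(ϑ)‖_q^q` of the `ℓ^q` norm of the family of all the partial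
derivatives of order `i` in `ϑ` of the components of the intensity. -/
noncomputable def derivNormPow (M : HawkesModel K p m) (i q : ℕ) (T : ℝ≥0)
    (S : Fin K → Finset ℝ≥0) (t : ℝ≥0) (ϑ : (Fin p → ℝ) × (Fin m → ℝ)) : ℝ≥0∞ :=
  ∑ k, ∑ J : Fin i → Fin p ⊕ Fin m,
    ‖iteratedFDerivWithin ℝ i (M.intensity T S k t) M.Θ ϑ (fun a => direction (J a))‖ₑ ^ q

end HawkesModel

/-- `S` is a `K`-variate simple point process on `(0, T]` adapted to `ℱ`: `S k ω` is the set of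
the jump times of the `k`-th component, and the components have almost surely no common jumps. -/
structure IsPointProcess {Ω : Type*} [MeasurableSpace Ω] {K : ℕ} (P : Measure Ω)
    (ℱ : Filtration ℝ≥0 (inferInstance : MeasurableSpace Ω)) (T : ℝ≥0)
    (S : Fin K → Ω → Finset ℝ≥0) : Prop where
  mem_Ioc : ∀ k ω, ∀ s ∈ S k ω, s ∈ Ioc 0 T
  adapted : ∀ k t, Measurable[ℱ t] fun ω => ((S k ω).filter (· ≤ t)).card
  disjoint : ∀ k l, k ≠ l → ∀ᵐ ω ∂P, Disjoint (S k ω) (S l ω)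

/-- The point process on `(0, T]` with set of jump times `S` has the predictable `ℱ`-intensity
`lam`: the process `lam` is predictable, and
`E[∫_{(0,T]} H_s dN_s] = E[∫_0^T H_s lam_s ds]` for every non-negative predictable `H`. -/
structure HasIntensity {Ω : Type*} [MeasurableSpace Ω] (P : Measure Ω)
    (ℱ : Filtration ℝ≥0 (inferInstance : MeasurableSpace Ω)) (T : ℝ≥0)
    (S : Ω → Finset ℝ≥0) (lam : ℝ≥0 → Ω → ℝ) : Prop where
  predictable : IsStronglyPredictable ℱ fun t ω => if t ≤ T then lam t ω else 0
  lintegral_eq : ∀ H : ℝ≥0 × Ω → ℝ≥0∞, Measurable[ℱ.predictable] H →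
    ∫⁻ ω, ∑ s ∈ S ω, H (s, ω) ∂P =
      ∫⁻ ω, (∫⁻ s in Ioc (0 : ℝ) T,
        H (s.toNNReal, ω) * ENNReal.ofReal (lam s.toNNReal ω)) ∂P

/-- `S` is, under `P`, the Hawkes process on `(0, T]` of the model `M` with parameter `ϑ`: its
`k`-th component has the predictable intensity `λ^T_{k,t}(ϑ)`. -/
structure IsHawkesProcess {Ω : Type*} [MeasurableSpace Ω] {K p m : ℕ} (M : HawkesModel K p m)
    (ϑ : (Fin p → ℝ) × (Fin m → ℝ)) (P : Measure Ω)
    (ℱ : Filtration ℝ≥0 (inferInstance : MeasurableSpace Ω)) (T : ℝ≥0)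
    (S : Fin K → Ω → Finset ℝ≥0) : Prop where
  isPointProcess : IsPointProcess P ℱ T S
  hasIntensity : ∀ k, HasIntensity P ℱ T (S k) fun t ω => M.intensity T (fun l => S l ω) k t ϑ

/-! The proof reduces the claim to a moment bound for a shot noise, and proves that bound by a
Lyapunov-type argument.

*Reduction.* The intensity is `Φ_k` applied to a potential which is linear in the kernels. By the
chain rule, a derivative of order `i ≤ 3` in the parameter is bounded, uniformly over `Θ`, by
`C (1 + Z) ^ 4`, where `Z = ∑_l ∑_{s < t} H_l(t - s)` is the shot noise of an envelope `H` of the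
kernels and their derivatives (`HawkesModel.exists_enorm_deriv_intensity_le`). The envelope lies in
every `L^q`. So it is enough to bound all the moments of `Z`, uniformly in `t ≤ T` and `T`.

*Domination.* As `Φ_k` is Lipschitz, the intensity at the true parameter is at most that of a
linear Hawkes process with a constant baseline and the kernels `a_{kl} = (max g) φ_{kl}`
(`HawkesModel.isDominated`). By stability, `(max g) ∫ φ` has spectral radius less than one, so it
has a strictly subinvariant positive weight (`exists_weight_of_spectralRadius_lt_one`). For the
norms weighted by it, convolution with `a` is a contraction of every `L^q`; thus for every `h` in
all the `L^q` there is a `G` in all the `L^q` with `h_l + ∑_k a_{kl} * G_k ≤ G_l`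
(`exists_supersolution`). The number `G_l(t - s)` bounds the total expected effect, at time `t`, of
a point of the component `l` at time `s`, through all its descendants.

*Moments* (`exists_momentBound`). Fix `t`, and let `Y_v` be the shot noise at `t` of the points
before `v`, plus a prediction of the effect of the points to come, each of which is charged `G`.
Between points `Y` decreases at the rate `∑_k G_k(t - v) λ_k(v)`, with `λ` the dominating
intensity, and at a point of the component `l` it jumps by at most `G_l(t - v)`. In the expansion
of the jumps of `Y ^ (q + 1)` the terms `(q + 1) Y ^ q G_l` have an expectation which the decrease
between points cancels (`HawkesKernel.localized_moment_le`). What remains is `E ∫ Y ^ j λ_l(v)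
G_l(t - v) ^ (q + 1 - j) dv` with `j < q`, where `Y ^ j λ_l` is controlled by the moments of orders
up to `q` of shot noises, and the powers of `G` are integrable in `v`. Induction on `q` concludes.
All this is done after localisation by the accumulated jumps, since the moments have to be finite
before a term can be subtracted.

*Measurability.* On a set of unique differentiability the derivatives are limits of linear
combinations of difference quotients taken inside the set, hence measurable in the randomness
(`measurable_iteratedFDerivWithin_apply`), and by continuity the supremum over `Θ` is one over a
countable dense subset. -/

/-! ### A pathwise inequality for powers -/

/-- The fundamental theorem of calculus for `v ↦ (y + ∫ u in v..b, f u) ^ (q + 1)`, an absolutely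
continuous function with derivative `-(q + 1) (y + ∫ u in v..b, f u) ^ q f v`. Stated in `ℝ≥0∞`, it
holds for every measurable `f` of finite integral. -/
theorem pow_add_lintegral_pow_mul_eq (f : ℝ → ℝ≥0∞) (hf : Measurable f) (y : ℝ≥0∞) (b : ℝ) (q : ℕ) :
    ∀ a ≤ b, y + ∫⁻ v in Ioc a b, f v ≠ ∞ →
      y ^ (q + 1) + (q + 1) * ∫⁻ v in Ioc a b, (y + ∫⁻ u in Ioc v b, f u) ^ q * f v =
        (y + ∫⁻ v in Ioc a b, f v) ^ (q + 1) := by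
  have hI : Measurable fun v => ∫⁻ u in Ioc v b, f u := by
    apply Antitone.measurable
    intro v w hvw
    exact lintegral_mono_set (Ioc_subset_Ioc_left hvw)
  have hsplit : ∀ a v, a ≤ v → v ≤ b →
      ∫⁻ u in Ioc a b, f u = (∫⁻ u in Ioc a v, f u) + ∫⁻ u in Ioc v b, f u := by
    intro a v hav hvb
    rw [← lintegral_union measurableSet_Ioc, Ioc_union_Ioc_eq_Ioc hav hvb]
    exact Set.Ioc_disjoint_Ioc_of_le le_rfl
  induction q with
  | zero => intro a hab hfin; simp
  | succ q ih =>
    intro a hab hfin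
    set I := ∫⁻ v in Ioc a b, f v with hIdef
    set Y : ℝ → ℝ≥0∞ := fun v => y + ∫⁻ u in Ioc v b, f u with hYdef
    have hYm : Measurable Y := hI.const_add _
    have hYf : ∀ n, Measurable fun v => Y v ^ n * f v := fun n => (hYm.pow_const n).mul hf
    have hfinv : ∀ v ∈ Ioc a b, Y v ≠ ∞ := fun v hv => ne_top_of_le_ne_top hfin
      (add_le_add le_rfl (lintegral_mono_set (Ioc_subset_Ioc_left hv.1.le)))
    have hIfin : I ≠ ∞ := fun h => hfin (by simp [h])
    have hyfin : y ≠ ∞ := fun h => hfin (by simp [h])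
    -- expand `Y v ^ (q + 1)` by the induction hypothesis and exchange the integrals
    have key : ∫⁻ v in Ioc a b, Y v ^ (q + 1) * f v =
        y ^ (q + 1) * I + (q + 1) * ∫⁻ w in Ioc a b, (Y w ^ q * f w) * ∫⁻ v in Ioc a w, f v := by
      have h1 : ∫⁻ v in Ioc a b, Y v ^ (q + 1) * f v = ∫⁻ v in Ioc a b, (y ^ (q + 1) * f v +
          (q + 1) * ((∫⁻ w in Ioc v b, Y w ^ q * f w) * f v)) := by
        refine setLIntegral_congr_fun measurableSet_Ioc fun v hv => ?_
        rw [← ih v hv.2 (hfinv v hv)]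
        ring
      have hm2 : Measurable fun v => ∫⁻ w in Ioc v b, Y w ^ q * f w := by
        apply Antitone.measurable
        intro v w hvw
        exact lintegral_mono_set (Ioc_subset_Ioc_left hvw)
      have hm3 : Measurable fun v => (∫⁻ w in Ioc v b, Y w ^ q * f w) * f v := hm2.mul hf
      rw [h1, lintegral_add_left (hf.const_mul _), lintegral_const_mul _ hf,
        lintegral_const_mul _ hm3]
      congr 2
      have h2 : ∀ v ∈ Ioc a b, (∫⁻ w in Ioc v b, Y w ^ q * f w) * f v =
          ∫⁻ w in Ioc a b, (Ioi v).indicator (fun w => Y w ^ q * f w) w * f v := by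
        intro v hv
        rw [lintegral_mul_const _ ((hYf q).indicator measurableSet_Ioi),
          setLIntegral_indicator measurableSet_Ioi]
        congr 3
        ext w
        simp only [mem_Ioc, mem_inter_iff, mem_Ioi]
        exact ⟨fun h => ⟨h.1, hv.1.trans h.1, h.2⟩, fun h => ⟨h.1, h.2.2⟩⟩
      rw [setLIntegral_congr_fun measurableSet_Ioc h2, lintegral_lintegral_swap]
      · refine setLIntegral_congr_fun measurableSet_Ioc fun w hw => ?_
        rw [← lintegral_const_mul _ hf]
        have : ∀ v, (Ioi v).indicator (fun w => Y w ^ q * f w) w * f v =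
            (Iio w).indicator (fun v => Y w ^ q * f w * f v) v := by
          intro v
          by_cases h : v < w <;> simp [h]
        simp_rw [this]
        rw [setLIntegral_indicator measurableSet_Iio]
        have hset : Iio w ∩ Ioc a b = Ioo a w := by
          ext v
          simp only [mem_Ioc, mem_inter_iff, mem_Iio, mem_Ioo]
          exact ⟨fun h => ⟨h.2.1, h.1⟩, fun h => ⟨h.2, h.1, h.2.le.trans hw.2⟩⟩
        rw [hset]
        exact setLIntegral_congr Ioo_ae_eq_Ioc
      · apply Measurable.aemeasurable
        have : (Function.uncurry fun v w => (Ioi v).indicator (fun w => Y w ^ q * f w) w * f v) =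
          fun z : ℝ × ℝ => {z : ℝ × ℝ | z.1 < z.2}.indicator
            (fun z => Y z.2 ^ q * f z.2) z * f z.1 := by
          ext ⟨v, w⟩
          by_cases h : v < w <;> simp [h]
        rw [this]
        refine Measurable.mul (Measurable.indicator ?_
          (measurableSet_lt measurable_fst measurable_snd)) (hf.comp measurable_fst)
        exact (hYf q).comp measurable_snd
    set A := ∫⁻ v in Ioc a b, Y v ^ (q + 1) * f v with hA
    have h3 : A + ∫⁻ w in Ioc a b, (Y w ^ q * f w) * (∫⁻ v in Ioc a w, f v) =
        (y + I) * ∫⁻ w in Ioc a b, Y w ^ q * f w := by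
      rw [hA, ← lintegral_add_left (hYf _), ← lintegral_const_mul _ (hYf _)]
      refine setLIntegral_congr_fun measurableSet_Ioc fun w hw => ?_
      rw [hIdef, hsplit a w hw.1.le hw.2, hYdef]
      simp only
      ring
    have h4 := ih a hab hfin
    set E := ∫⁻ w in Ioc a b, (Y w ^ q * f w) * (∫⁻ v in Ioc a w, f v)
    set F := ∫⁻ w in Ioc a b, Y w ^ q * f w
    change y ^ (q + 1) + (q + 1) * F = (y + I) ^ (q + 1) at h4
    change y ^ (q + 1 + 1) + ((q + 1 : ℕ) + 1) * A = (y + I) ^ (q + 1 + 1)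
    have h5 : (y ^ (q + 1 + 1) + ((q + 1 : ℕ) + 1) * A) + y ^ (q + 1) * I =
        (y + I) ^ (q + 1 + 1) + y ^ (q + 1) * I := by
      calc (y ^ (q + 1 + 1) + ((q + 1 : ℕ) + 1) * A) + y ^ (q + 1) * I
          = y ^ (q + 1) * (y + I) + A + (q + 1) * A := by push_cast; ring
        _ = y ^ (q + 1) * (y + I) + (y ^ (q + 1) * I + (q + 1) * E) + (q + 1) * A := by
            rw [← key]
        _ = y ^ (q + 1) * (y + I) + y ^ (q + 1) * I + (q + 1) * (A + E) := by ring
        _ = (y + I) * (y ^ (q + 1) + (q + 1) * F) + y ^ (q + 1) * I := by rw [h3]; ring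
        _ = _ := by rw [h4]; ring
    exact (ENNReal.add_left_inj (ENNReal.mul_ne_top (ENNReal.pow_ne_top hyfin) hIfin)).1 h5

/-- Deterministic data behind a jump process observed at the horizon `t`. A point `p` sits at the
time `τ p`; it contributes `h p` to the value at time `t`, and `b p v` to the expected increase
of that value per unit of time at `v ∈ (τ p, t]`; `d v` is the part of the expected increase which
no point causes. The number `J p` bounds the whole effect of the point `p`. -/
structure ShotNoise (ι : Type*) where
  τ : ι → ℝ
  h : ι → ℝ≥0∞
  b : ι → ℝ → ℝ≥0∞
  J : ι → ℝ≥0∞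
  d : ℝ → ℝ≥0∞
  t : ℝ
  b_meas : ∀ p, Measurable (b p)
  d_meas : Measurable d
  le_J : ∀ p, h p + ∫⁻ v in Ioc (τ p) t, b p v ≤ J p

namespace ShotNoise
variable {ι : Type*} (N : ShotNoise ι)

/-- The expected increase at time `v` caused by the points of `R` before time `r`. On the diagonal
`r = v` it is the drift of the process at time `v`. -/
noncomputable def drift (R : Finset ι) (r v : ℝ) : ℝ≥0∞ :=
  N.d v + ∑ p ∈ R with N.τ p < r, N.b p v

/-- The prediction at time `r` of the value at the horizon `N.t`: the contributions of the points
before `r`, plus the drift that these points cause on `(r, N.t]`. It decreases between the points of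
`R`, at the rate `drift R r r`, and jumps by at most `J p` at the point `p`. -/
noncomputable def Y (R : Finset ι) (r : ℝ) : ℝ≥0∞ :=
  ∑ p ∈ R with N.τ p < r, N.h p + ∫⁻ v in Ioc r N.t, N.drift R r v

/-- Between two consecutive points the set `R₁` of past points is frozen and `Y` is absolutely
continuous. The number `y` bounds the value of `Y` just after `r₁`; no point of `R` lies in
`(r₁, r₂)`, but there may be one at `r₁`, which is counted in `R₁`. -/
theorem Y_pow_of_no_points (R : Finset ι) {r₁ r₂ : ℝ} (h12 : r₁ ≤ r₂) (h2 : r₂ ≤ N.t) (q : ℕ)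
    (y : ℝ≥0∞) (R₁ : Finset ι) (hR : ∀ p ∈ R, N.τ p < r₂ → p ∈ R₁)
    (hR₁ : ∀ p ∈ R₁, p ∈ R ∧ N.τ p ≤ r₁)
    (hy : ∑ p ∈ R₁, N.h p + ∫⁻ v in Ioc r₁ N.t, (N.d v + ∑ p ∈ R₁, N.b p v) ≤ y) :
    N.Y R r₂ ^ (q + 1) + (q + 1) * ∫⁻ v in Ioc r₁ r₂, N.Y R v ^ q * N.drift R v v ≤
      y ^ (q + 1) := by
  classical
  have hfilt : ∀ v ∈ Ioc r₁ r₂, R.filter (fun p => N.τ p < v) = R₁ := by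
    intro v hv
    ext p
    simp only [Finset.mem_filter]
    exact ⟨fun h => hR p h.1 (h.2.trans_le hv.2),
      fun h => ⟨(hR₁ p h).1, (hR₁ p h).2.trans_lt hv.1⟩⟩
  set f : ℝ → ℝ≥0∞ := fun v => N.d v + ∑ p ∈ R₁, N.b p v with hf
  have hfm : Measurable f := N.d_meas.add (Finset.measurable_fun_sum _ fun p _ => N.b_meas p)
  set x := ∑ p ∈ R₁, N.h p + ∫⁻ v in Ioc r₂ N.t, f v with hx
  have hsplit : ∀ v, v ≤ r₂ → ∫⁻ u in Ioc v N.t, f u =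
      (∫⁻ u in Ioc v r₂, f u) + ∫⁻ u in Ioc r₂ N.t, f u := by
    intro v hv
    rw [← lintegral_union measurableSet_Ioc, Ioc_union_Ioc_eq_Ioc hv h2]
    exact Set.Ioc_disjoint_Ioc_of_le le_rfl
  have hxv : ∀ v, v ≤ r₂ → ∑ p ∈ R₁, N.h p + ∫⁻ u in Ioc v N.t, f u =
      x + ∫⁻ u in Ioc v r₂, f u := by
    intro v hv
    rw [hsplit v hv, hx]; ring
  rw [hxv r₁ h12] at hy
  rcases h12.eq_or_lt with rfl | h12'
  · simp only [Ioc_self, Measure.restrict_empty, lintegral_zero_measure, mul_zero, add_zero]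
      at hy ⊢
    refine pow_le_pow_left₀ (zero_le) (le_trans ?_ hy) _
    have hsub : R.filter (fun p => N.τ p < r₁) ⊆ R₁ := fun p hp => by
      rw [Finset.mem_filter] at hp
      exact hR p hp.1 hp.2
    refine add_le_add (Finset.sum_le_sum_of_subset hsub) (lintegral_mono fun v => ?_)
    exact add_le_add le_rfl (Finset.sum_le_sum_of_subset hsub)
  have hYv : ∀ v ∈ Ioc r₁ r₂, N.Y R v = x + ∫⁻ u in Ioc v r₂, f u := by
    intro v hv
    rw [← hxv v hv.2, Y, hfilt v hv]
    simp only [drift, hfilt v hv, hf]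
  have hD : ∀ v ∈ Ioc r₁ r₂, N.drift R v v = f v := by
    intro v hv
    simp only [drift, hfilt v hv, hf]
  have h1 : N.Y R r₂ = x := by
    rw [hYv r₂ ⟨h12', le_rfl⟩]; simp
  rw [h1]
  have h3 : ∫⁻ v in Ioc r₁ r₂, N.Y R v ^ q * N.drift R v v =
      ∫⁻ v in Ioc r₁ r₂, (x + ∫⁻ u in Ioc v r₂, f u) ^ q * f v :=
    setLIntegral_congr_fun measurableSet_Ioc fun v hv => by simp only [hYv v hv, hD v hv]
  rw [h3]
  by_cases hfin : x + ∫⁻ v in Ioc r₁ r₂, f v = ∞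
  · rw [hfin, top_le_iff] at hy
    simp [hy]
  · rw [pow_add_lintegral_pow_mul_eq f hfm x r₂ q r₁ h12 hfin]
    exact pow_le_pow_left₀ (zero_le) hy _

/-- The change of variables formula for the power `q + 1` of the jump process `Y`: the drift is
moved to the left, and the jump at `p` is expanded by the binomial theorem. The term `j = q` of the
expansion, `(q + 1) Y ^ q J p`, is the one that the drift compensates. -/
theorem Y_pow_le (R : Finset ι) (hinj : Set.InjOn N.τ R) (q : ℕ) {a : ℝ}
    (hpos : ∀ p ∈ R, a ≤ N.τ p) :
    ∀ r, a ≤ r → r ≤ N.t →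
    N.Y R r ^ (q + 1) + (q + 1) * ∫⁻ v in Ioc a r, N.Y R v ^ q * N.drift R v v ≤
      (∫⁻ v in Ioc a N.t, N.d v) ^ (q + 1) + ∑ p ∈ R with N.τ p < r, ∑ j ∈ Finset.range (q + 1),
        (q + 1).choose j * (N.Y R (N.τ p) ^ j * N.J p ^ (q + 1 - j)) := by
  classical
  intro r
  induction hn : (R.filter (fun p => N.τ p < r)).card using Nat.strong_induction_on generalizing r
    with
  | _ n ih =>
  intro har hrt
  rcases (R.filter (fun p => N.τ p < r)).eq_empty_or_nonempty with he | hne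
  · rw [he, Finset.sum_empty, add_zero]
    refine N.Y_pow_of_no_points R har hrt q _ ∅ ?_ (by simp) (by simp)
    intro p hp hpr
    rw [← he, Finset.mem_filter]
    exact ⟨hp, hpr⟩
  · obtain ⟨p, hp, hmax⟩ := Finset.exists_max_image _ N.τ hne
    rw [Finset.mem_filter] at hp
    set s := N.τ p with hs
    have hins : R.filter (fun p => N.τ p < r) = insert p (R.filter (fun p => N.τ p < s)) := by
      ext u
      simp only [Finset.mem_insert, Finset.mem_filter]
      constructor
      · intro hu
        rcases (hmax u (Finset.mem_filter.2 hu)).eq_or_lt with h | h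
        · exact Or.inl (hinj hu.1 hp.1 h)
        · exact Or.inr ⟨hu.1, h⟩
      · rintro (rfl | h)
        · exact hp
        · exact ⟨h.1, h.2.trans hp.2⟩
    have hnot : p ∉ R.filter (fun p => N.τ p < s) := by simp [hs]
    have hcard : (R.filter (fun p => N.τ p < s)).card < n := by
      rw [← hn, hins, Finset.card_insert_of_notMem hnot]; omega
    have has : a ≤ s := hpos p hp.1
    have hIH := ih _ hcard s rfl has (hp.2.le.trans hrt)
    -- the jump at `s`
    have hjump := N.Y_pow_of_no_points R hp.2.le hrt q (N.Y R s + N.J p)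
      (insert p (R.filter (fun p => N.τ p < s)))
      (fun u hu hur => by rw [← hins]; exact Finset.mem_filter.2 ⟨hu, hur⟩)
      (fun u hu => by
        rw [Finset.mem_insert, Finset.mem_filter] at hu
        rcases hu with rfl | hu
        · exact ⟨hp.1, le_rfl⟩
        · exact ⟨hu.1, hu.2.le⟩)
      (by
        simp only [Finset.sum_insert hnot]
        have : ∀ v, N.d v + (N.b p v + ∑ u ∈ R with N.τ u < s, N.b u v) =
            N.drift R s v + N.b p v := fun v => by rw [drift]; ring
        simp_rw [this]
        rw [lintegral_add_right _ (N.b_meas p), Y]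
        calc _ = (∑ p ∈ R with N.τ p < s, N.h p + ∫⁻ v in Ioc s N.t, N.drift R s v)
              + (N.h p + ∫⁻ v in Ioc s N.t, N.b p v) := by ring
          _ ≤ _ := by gcongr; exact N.le_J p)
    have hsplit : ∫⁻ v in Ioc a r, N.Y R v ^ q * N.drift R v v =
        (∫⁻ v in Ioc a s, N.Y R v ^ q * N.drift R v v) +
          ∫⁻ v in Ioc s r, N.Y R v ^ q * N.drift R v v := by
      rw [← lintegral_union measurableSet_Ioc, Ioc_union_Ioc_eq_Ioc has hp.2.le]
      exact Set.Ioc_disjoint_Ioc_of_le le_rfl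
    have hbin : (N.Y R s + N.J p) ^ (q + 1) = N.Y R s ^ (q + 1) +
        ∑ j ∈ Finset.range (q + 1), (q + 1).choose j * (N.Y R s ^ j * N.J p ^ (q + 1 - j)) := by
      rw [add_pow, Finset.sum_range_succ, add_comm]
      simp [mul_comm]
    rw [hins, Finset.sum_insert hnot, ← hs, hsplit]
    calc _ = (N.Y R r ^ (q + 1) + (q + 1) * ∫⁻ v in Ioc s r, N.Y R v ^ q * N.drift R v v) +
          (q + 1) * ∫⁻ v in Ioc a s, N.Y R v ^ q * N.drift R v v := by ring
      _ ≤ (N.Y R s + N.J p) ^ (q + 1) +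
          (q + 1) * ∫⁻ v in Ioc a s, N.Y R v ^ q * N.drift R v v := by gcongr
      _ = (N.Y R s ^ (q + 1) + (q + 1) * ∫⁻ v in Ioc a s, N.Y R v ^ q * N.drift R v v) +
          ∑ j ∈ Finset.range (q + 1),
            (q + 1).choose j * (N.Y R s ^ j * N.J p ^ (q + 1 - j)) := by rw [hbin]; ring
      _ ≤ _ := add_le_add hIH le_rfl
      _ = _ := by ring

theorem Y_add_lintegral_le (R : Finset ι) (hinj : Set.InjOn N.τ R) {a : ℝ}
    (hpos : ∀ p ∈ R, a ≤ N.τ p) {r : ℝ} (har : a ≤ r) (hrt : r ≤ N.t) :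
    N.Y R r + ∫⁻ v in Ioc a r, N.drift R v v ≤
      (∫⁻ v in Ioc a N.t, N.d v) + ∑ p ∈ R with N.τ p < r, N.J p := by
  simpa using N.Y_pow_le R hinj 0 hpos r har hrt

end ShotNoise

/-! ### Convolution inequalities and the supersolution -/

/-- A form of Hölder's inequality. -/
theorem sum_pow_le_of_pow_le {ι : Type*} (s : Finset ι) (x α z : ι → ℝ≥0∞) (n : ℕ)
    (h : ∀ i ∈ s, x i ^ (n + 1) ≤ α i ^ n * z i) :
    (∑ i ∈ s, x i) ^ (n + 1) ≤ (∑ i ∈ s, α i) ^ n * ∑ i ∈ s, z i := by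
  rcases n.eq_zero_or_pos with rfl | hn
  · simp only [zero_add, pow_one, pow_zero, one_mul] at h ⊢
    exact Finset.sum_le_sum h
  have hn' : (0 : ℝ) < n := by exact_mod_cast hn
  set p : ℝ := (n + 1) / n
  have hp : 0 < p := by positivity
  set q : ℝ := n + 1
  have hq : 0 < q := by positivity
  have hpq : p.HolderConjugate q := by
    rw [Real.holderConjugate_iff]
    refine ⟨?_, ?_⟩
    · rw [lt_div_iff₀ hn']; linarith
    · simp only [p, q]; field_simp
  have h1 : ∀ i ∈ s, x i ≤ α i ^ (1 / p) * z i ^ (1 / q) := by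
    intro i hi
    have h2 : α i ^ (1 / p) = (α i ^ n) ^ (1 / q) := by
      rw [← ENNReal.rpow_natCast, ← ENNReal.rpow_mul]
      congr 1
      simp only [p, q]; field_simp
    rw [h2, ← ENNReal.mul_rpow_of_nonneg _ _ (by positivity)]
    rw [one_div, ENNReal.le_rpow_inv_iff hq]
    have := h i hi
    rw [← ENNReal.rpow_natCast] at this
    simpa [q] using this
  have h3 := (Finset.sum_le_sum h1).trans (ENNReal.inner_le_Lp_mul_Lq s _ _ hpq)
  have h4 : ∀ i, (α i ^ (1 / p)) ^ p = α i := fun i => by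
    rw [← ENNReal.rpow_mul, one_div_mul_cancel hp.ne', ENNReal.rpow_one]
  have h5 : ∀ i, (z i ^ (1 / q)) ^ q = z i := fun i => by
    rw [← ENNReal.rpow_mul, one_div_mul_cancel hq.ne', ENNReal.rpow_one]
  simp_rw [h4, h5] at h3
  refine (pow_le_pow_left₀ zero_le h3 (n + 1)).trans_eq ?_
  rw [mul_pow]
  congr 1
  · rw [← ENNReal.rpow_natCast, ← ENNReal.rpow_natCast, ← ENNReal.rpow_mul]
    congr 1
    simp only [p]; push_cast; field_simp
  · rw [← ENNReal.rpow_natCast, ← ENNReal.rpow_mul]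
    have : 1 / q * ((n + 1 : ℕ) : ℝ) = 1 := by simp only [q]; push_cast; field_simp
    rw [this, ENNReal.rpow_one]

theorem lintegral_mul_pow_le {α : Type*} [MeasurableSpace α] (μ : Measure α) {a f : α → ℝ≥0∞}
    (ha : Measurable a) (hf : Measurable f) (n : ℕ) :
    (∫⁻ x, a x * f x ∂μ) ^ (n + 1) ≤ (∫⁻ x, a x ∂μ) ^ n * ∫⁻ x, a x * f x ^ (n + 1) ∂μ := by
  rcases n.eq_zero_or_pos with rfl | hn
  · simp
  have hn' : (0 : ℝ) < n := by exact_mod_cast hn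
  set p : ℝ := (n + 1) / n
  have hp : 0 < p := by positivity
  set q : ℝ := n + 1
  have hq : 0 < q := by positivity
  have hpq : p.HolderConjugate q := by
    rw [Real.holderConjugate_iff]
    refine ⟨?_, ?_⟩
    · rw [lt_div_iff₀ hn']; linarith
    · simp only [p, q]; field_simp
  have h1 : ∀ x, a x * f x = a x ^ (1 / p) * (a x * f x ^ (n + 1)) ^ (1 / q) := by
    intro x
    rw [ENNReal.mul_rpow_of_nonneg _ _ (by positivity), ← mul_assoc,
      ← ENNReal.rpow_add_of_nonneg _ _ (by positivity) (by positivity),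
      ← ENNReal.rpow_natCast, ← ENNReal.rpow_mul]
    have e1 : 1 / p + 1 / q = 1 := by simp only [p, q]; field_simp
    have e2 : ((n + 1 : ℕ) : ℝ) * (1 / q) = 1 := by simp only [q]; push_cast; field_simp
    rw [e1, e2, ENNReal.rpow_one, ENNReal.rpow_one]
  have h3 := ENNReal.lintegral_mul_le_Lp_mul_Lq μ hpq (f := fun x => a x ^ (1 / p))
    (g := fun x => (a x * f x ^ (n + 1)) ^ (1 / q)) (ha.pow_const _).aemeasurable
    ((ha.mul (hf.pow_const _)).pow_const _).aemeasurable
  have h4 : ∀ i, (a i ^ (1 / p)) ^ p = a i := fun i => by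
    rw [← ENNReal.rpow_mul, one_div_mul_cancel hp.ne', ENNReal.rpow_one]
  have h5 : ∀ y : ℝ≥0∞, (y ^ (1 / q)) ^ q = y := fun i => by
    rw [← ENNReal.rpow_mul, one_div_mul_cancel hq.ne', ENNReal.rpow_one]
  simp only [Pi.mul_apply, h4, h5, ← h1] at h3
  refine (pow_le_pow_left₀ zero_le h3 (n + 1)).trans_eq ?_
  rw [mul_pow]
  congr 1
  · rw [← ENNReal.rpow_natCast, ← ENNReal.rpow_natCast, ← ENNReal.rpow_mul]
    congr 1
    simp only [p]; push_cast; field_simp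
  · rw [← ENNReal.rpow_natCast, ← ENNReal.rpow_mul]
    have : 1 / q * ((n + 1 : ℕ) : ℝ) = 1 := by simp only [q]; push_cast; field_simp
    rw [this, ENNReal.rpow_one]

theorem lintegral_lintegral_mul_sub {a f : ℝ → ℝ≥0∞} (ha : Measurable a) (hf : Measurable f) :
    ∫⁻ y, ∫⁻ x, a x * f (y - x) = (∫⁻ x, a x) * ∫⁻ y, f y := by
  rw [lintegral_lintegral_swap]
  · have : ∀ x, ∫⁻ y, a x * f (y - x) = a x * ∫⁻ y, f y := fun x => by
      rw [lintegral_const_mul _ (by fun_prop), lintegral_sub_right_eq_self f x]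
    simp_rw [this]
    rw [lintegral_mul_const _ ha]
  · exact Measurable.aemeasurable (by fun_prop)

/-- The family `h` of kernels on the line belongs to every `L^q`, `q ≥ 1` an integer. -/
structure MemAllLp {κ : Type*} (h : κ → ℝ → ℝ≥0∞) : Prop where
  meas : ∀ l, Measurable (h l)
  lintegral_pow_lt_top : ∀ l, ∀ n : ℕ, ∫⁻ x, h l x ^ (n + 1) < ∞

theorem MemAllLp.lintegral_lt_top {κ : Type*} {h : κ → ℝ → ℝ≥0∞} (hh : MemAllLp h) (l : κ) :
    ∫⁻ x, h l x < ∞ := by simpa using hh.lintegral_pow_lt_top l 0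

section resolvent
variable {κ : Type*} [Fintype κ]

/-- The Picard iterates, from `0`, of the renewal equation `G_l = h_l + ∑_k a_{kl} * G_k`, with `*`
the convolution. -/
noncomputable def resolventIter (a : κ → κ → ℝ → ℝ≥0∞) (h : κ → ℝ → ℝ≥0∞) : ℕ → κ → ℝ → ℝ≥0∞
  | 0 => fun _ _ => 0
  | n + 1 => fun l y => h l y + ∑ k, ∫⁻ x, a k l x * resolventIter a h n k (y - x)

variable {a : κ → κ → ℝ → ℝ≥0∞} {h : κ → ℝ → ℝ≥0∞}

theorem resolventIter_meas (ha : ∀ k l, Measurable (a k l)) (hh : ∀ l, Measurable (h l)) (n : ℕ) :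
    ∀ l, Measurable (resolventIter a h n l) := by
  induction n with
  | zero => intro l; exact measurable_const
  | succ n ih =>
    intro l
    refine (hh l).add (Finset.measurable_fun_sum _ fun k _ => ?_)
    have := ih k
    have := ha k l
    exact Measurable.lintegral_prod_right' (f := fun z : ℝ × ℝ =>
      a k l z.2 * resolventIter a h n k (z.1 - z.2)) (by fun_prop)

theorem resolventIter_mono (l : κ) (y : ℝ) : Monotone fun n => resolventIter a h n l y := by
  refine monotone_nat_of_le_succ fun n => ?_
  induction n generalizing l y with
  | zero => exact zero_le
  | succ n ih =>
    refine add_le_add le_rfl (Finset.sum_le_sum fun k _ => lintegral_mono fun x => ?_)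
    exact mul_le_mul_right (ih k (y - x)) _

/-- The Picard iterates are bounded in every `L^(n + 1)`, in the norm weighted by `w`: the operator
`G ↦ ∑_k a_{kl} * G_k` contracts that norm by the factor `r < 1`, and `d = 1 - r`. -/
theorem resolventIter_lintegral_pow_le (ha : ∀ k l, Measurable (a k l))
    (hh : ∀ l, Measurable (h l)) {w : κ → ℝ≥0} (hw : ∀ l, 1 ≤ w l) {r d : ℝ≥0} (hd : d ≠ 0)
    (hrd : d + r = 1) (hA : ∀ l, ∑ k, (∫⁻ x, a k l x) * w k ≤ r * w l) (n N : ℕ) (l : κ) :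
    ∫⁻ y, resolventIter a h N l y ^ (n + 1) ≤
      (d : ℝ≥0∞)⁻¹ ^ (n + 1) * (∑ l, ∫⁻ y, h l y ^ (n + 1)) * w l ^ (n + 1) := by
  set M := (d : ℝ≥0∞)⁻¹ ^ (n + 1) * (∑ l, ∫⁻ y, h l y ^ (n + 1)) with hM
  have hd0 : (d : ℝ≥0∞) ≠ 0 := by simpa using hd
  have hw0 : ∀ l, (w l : ℝ≥0∞) ≠ 0 := fun l => by
    have := zero_lt_one.trans_le (hw l)
    simpa using this.ne'
  induction N generalizing l with
  | zero => simp [resolventIter]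
  | succ N ih =>
    have hGm := resolventIter_meas ha hh N
    set G := resolventIter a h N with hG
    -- Hölder's inequality with the weights `α`: `none` stands for `h`, `some k` for `a_{kl} * G_k`
    set z : Option κ → ℝ → ℝ≥0∞ := fun o y => o.elim
      (((d : ℝ≥0∞) * w l)⁻¹ ^ n * h l y ^ (n + 1))
      (fun k => (w k : ℝ≥0∞)⁻¹ ^ n * ∫⁻ x, a k l x * G k (y - x) ^ (n + 1)) with hz
    set x : Option κ → ℝ → ℝ≥0∞ := fun o y => o.elim (h l y) (fun k => ∫⁻ x, a k l x * G k (y - x))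
      with hx
    set α : Option κ → ℝ≥0∞ := fun o => o.elim ((d : ℝ≥0∞) * w l) (fun k => (∫⁻ x, a k l x) * w k)
      with hα
    have hαsum : ∑ o, α o ≤ w l := by
      rw [Fintype.sum_option]
      calc _ ≤ (d : ℝ≥0∞) * w l + r * w l := add_le_add le_rfl (hA l)
        _ = (d + r : ℝ≥0) * w l := by push_cast; ring
        _ = _ := by rw [hrd]; simp
    have hpt : ∀ y, resolventIter a h (N + 1) l y ^ (n + 1) ≤ (w l : ℝ≥0∞) ^ n * ∑ o, z o y := by
      intro y
      have h1 : resolventIter a h (N + 1) l y = ∑ o, x o y := by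
        rw [Fintype.sum_option]; rfl
      rw [h1]
      refine (sum_pow_le_of_pow_le _ _ α (fun o => z o y) n ?_).trans
        (mul_le_mul_left (pow_le_pow_left₀ zero_le hαsum n) _)
      rintro (_ | k) -
      · simp only [hx, hα, hz, Option.elim]
        rw [← mul_assoc, ← mul_pow, ENNReal.mul_inv_cancel (mul_ne_zero hd0 (hw0 l))
          (by finiteness), one_pow, one_mul]
      · simp only [hx, hα, hz, Option.elim]
        refine (lintegral_mul_pow_le volume (ha k l) (f := fun x => G k (y - x))
          ((hGm k).comp (by fun_prop)) n).trans_eq ?_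
        rw [← mul_assoc, ← mul_pow, mul_assoc, ENNReal.mul_inv_cancel (hw0 k) (by finiteness),
          mul_one]
    have hzm : ∀ k, Measurable fun y => ∫⁻ x, a k l x * G k (y - x) ^ (n + 1) := fun k => by
      have := hGm k
      have := ha k l
      exact Measurable.lintegral_prod_right' (f := fun z : ℝ × ℝ =>
        a k l z.2 * G k (z.1 - z.2) ^ (n + 1)) (by fun_prop)
    have hzint : ∀ k, ∫⁻ y, z (some k) y ≤ M * ((∫⁻ x, a k l x) * w k) := by
      intro k
      simp only [hz, Option.elim]
      rw [lintegral_const_mul _ (hzm k), lintegral_lintegral_mul_sub (ha k l)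
        (f := fun y => G k y ^ (n + 1)) ((hGm k).pow_const _)]
      calc _ ≤ (w k : ℝ≥0∞)⁻¹ ^ n * ((∫⁻ x, a k l x) * (M * w k ^ (n + 1))) := by
            gcongr; exact ih k
        _ = M * ((∫⁻ x, a k l x) * w k) * ((w k : ℝ≥0∞)⁻¹ * w k) ^ n := by ring
        _ = _ := by rw [ENNReal.inv_mul_cancel (hw0 k) (by finiteness)]; simp
    have hz0 : ∫⁻ y, z none y ≤ M * (d * w l) := by
      simp only [hz, Option.elim]
      rw [lintegral_const_mul _ ((hh l).pow_const _)]
      calc _ ≤ (d : ℝ≥0∞)⁻¹ ^ n * ∑ l, ∫⁻ y, h l y ^ (n + 1) := by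
            refine mul_le_mul' (pow_le_pow_left₀ zero_le ?_ _)
              (Finset.single_le_sum (f := fun l => ∫⁻ y, h l y ^ (n + 1)) (fun _ _ => zero_le)
                (Finset.mem_univ l))
            rw [ENNReal.inv_le_inv]
            exact le_mul_of_one_le_right zero_le (by exact_mod_cast hw l)
        _ = M * d := by
            rw [hM, pow_succ]
            calc _ = (d : ℝ≥0∞)⁻¹ ^ n * (∑ l, ∫⁻ y, h l y ^ (n + 1)) * ((d : ℝ≥0∞)⁻¹ * d) := by
                  rw [ENNReal.inv_mul_cancel hd0 (by finiteness), mul_one]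
              _ = _ := by ring
        _ ≤ _ := by
            gcongr
            exact le_mul_of_one_le_right zero_le (by exact_mod_cast hw l)
    calc _ ≤ ∫⁻ y, (w l : ℝ≥0∞) ^ n * ∑ o, z o y := lintegral_mono hpt
      _ = (w l : ℝ≥0∞) ^ n * ((∫⁻ y, z none y) + ∑ k, ∫⁻ y, z (some k) y) := by
          have hm0 : Measurable (z none) := ((hh l).pow_const _).const_mul _
          have hm1 : ∀ k, Measurable (z (some k)) := fun k => (hzm k).const_mul _
          simp_rw [Fintype.sum_option]
          have hm2 : Measurable fun y => z none y + ∑ k, z (some k) y :=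
            hm0.add (Finset.measurable_fun_sum _ fun k _ => hm1 k)
          rw [lintegral_const_mul _ hm2, lintegral_add_left hm0,
            lintegral_finsetSum _ fun k _ => hm1 k]
      _ ≤ (w l : ℝ≥0∞) ^ n * (M * (d * w l) + ∑ k, M * ((∫⁻ x, a k l x) * w k)) := by
          gcongr with k
          exact hzint k
      _ ≤ (w l : ℝ≥0∞) ^ n * (M * (d * w l) + M * (r * w l)) := by
          rw [← Finset.mul_sum]
          gcongr
          exact hA l
      _ = M * w l ^ (n + 1) * (d + r : ℝ≥0) := by push_cast; ring
      _ = _ := by rw [hrd]; simp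

/-- The monotone limit of the Picard iterates belongs to every `L^q`. -/
theorem exists_supersolution (ha : ∀ k l, Measurable (a k l)) (hh : MemAllLp h)
    {w : κ → ℝ≥0} (hw : ∀ l, 1 ≤ w l) {r d : ℝ≥0} (hd : d ≠ 0)
    (hrd : d + r = 1) (hA : ∀ l, ∑ k, (∫⁻ x, a k l x) * w k ≤ r * w l) :
    ∃ G : κ → ℝ → ℝ≥0∞, MemAllLp G ∧
      ∀ l y, h l y + ∑ k, ∫⁻ x, a k l x * G k (y - x) ≤ G l y := by
  have hGm := resolventIter_meas ha hh.meas
  refine ⟨fun l y => ⨆ N, resolventIter a h N l y, ⟨fun l => .iSup fun N => hGm N l, fun l n => ?_⟩,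
    fun l y => ?_⟩
  · have h1 : ∀ y, (⨆ N, resolventIter a h N l y) ^ (n + 1) =
        ⨆ N, resolventIter a h N l y ^ (n + 1) := fun y =>
      Monotone.map_iSup_of_continuousAt (f := fun u : ℝ≥0∞ => u ^ (n + 1))
        (by fun_prop) (fun u v huv => pow_le_pow_left₀ zero_le huv _) (by simp)
    simp_rw [h1]
    rw [lintegral_iSup (fun N => (hGm N l).pow_const _)
      (fun N N' hN y => pow_le_pow_left₀ zero_le (resolventIter_mono l y hN) _)]
    refine (iSup_le fun N =>
      resolventIter_lintegral_pow_le ha hh.meas hw hd hrd hA n N l).trans_lt ?_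
    have : ∑ l, ∫⁻ y, h l y ^ (n + 1) < ∞ :=
      ENNReal.sum_lt_top.2 fun l _ => hh.lintegral_pow_lt_top l n
    have hd0 : (d : ℝ≥0∞)⁻¹ < ∞ := by simpa [pos_iff_ne_zero] using hd
    exact ENNReal.mul_lt_top (ENNReal.mul_lt_top (ENNReal.pow_lt_top hd0) this) (by finiteness)
  · have h1 : ∀ k, ∫⁻ x, a k l x * (⨆ N, resolventIter a h N k (y - x)) =
        ⨆ N, ∫⁻ x, a k l x * resolventIter a h N k (y - x) := by
      intro k
      simp_rw [ENNReal.mul_iSup]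
      refine lintegral_iSup (fun N => ?_) fun N N' hN x =>
        mul_le_mul_right (resolventIter_mono k (y - x) hN) _
      exact (ha k l).mul ((hGm N k).comp (by fun_prop))
    simp_rw [h1]
    rw [ENNReal.finsetSum_iSup_of_monotone
      (f := fun k N => ∫⁻ x, a k l x * resolventIter a h N k (y - x)) fun k N N' hN =>
        lintegral_mono fun x => mul_le_mul_right (resolventIter_mono k (y - x) hN) _,
      ENNReal.add_iSup]
    exact iSup_le fun N => le_iSup (fun N => resolventIter a h N l y) (N + 1)

end resolvent

/-! ### A strictly subinvariant weight for a matrix of spectral radius less than one -/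

section Perron
open Filter Topology
attribute [local instance] Matrix.linftyOpNormedRing Matrix.linftyOpNormedAlgebra

/-- Gelfand's formula gives the summability of the powers of the complex matrix in norm. -/
theorem summable_pow_of_spectralRadius_lt_one {κ : Type*} [Fintype κ] [DecidableEq κ]
    (A : Matrix κ κ ℝ≥0) (c : ℝ≥0)
    (h : (c : ℝ≥0∞) * spectralRadius ℂ (A.map fun x => ((x : ℝ) : ℂ)) < 1) (k l : κ) :
    Summable fun n => c ^ n * (A ^ n) k l := by
  set φ : ℝ≥0 →+* ℂ := Complex.ofRealHom.comp NNReal.toRealHom with hφ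
  set B : Matrix κ κ ℂ := A.map fun x => ((x : ℝ) : ℂ) with hB
  have hBA : B = φ.mapMatrix A := rfl
  -- the entries of the powers of `A`
  have hentry : ∀ n k l, (A ^ n) k l ≤ ‖B ^ n‖₊ := by
    intro n k l
    have h1 : (A ^ n) k l = ‖(B ^ n) k l‖₊ := by
      rw [hBA, ← map_pow]
      ext
      simp [hφ]
    rw [h1, Matrix.linfty_opNNNorm_def]
    exact (Finset.single_le_sum (f := fun j => ‖(B ^ n) k j‖₊) (fun _ _ => zero_le)
      (Finset.mem_univ l)).trans
      (Finset.le_sup (f := fun i => ∑ j, ‖(B ^ n) i j‖₊) (Finset.mem_univ k))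
  have hsumB : Summable fun n => c ^ n * ‖B ^ n‖₊ := by
    have hlim := (ENNReal.Tendsto.const_mul (a := (c : ℝ≥0∞))
      (spectrum.pow_nnnorm_pow_one_div_tendsto_nhds_spectralRadius B) (Or.inr (by finiteness)))
    obtain ⟨θ, hθ1, hθ2⟩ := ENNReal.lt_iff_exists_nnreal_btwn.1 h
    have hθ : θ < 1 := by exact_mod_cast hθ2
    have hev := (hlim.eventually (gt_mem_nhds hθ1)).and (eventually_gt_atTop 0)
    rw [← NNReal.summable_coe]
    refine summable_of_isBigO_nat (g := fun n => (θ : ℝ) ^ n)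
      (summable_geometric_of_lt_one θ.2 (by exact_mod_cast hθ)) ?_
    refine Asymptotics.IsBigO.of_bound 1 ?_
    filter_upwards [hev] with n hn
    have hn0 : (n : ℝ) ≠ 0 := by exact_mod_cast hn.2.ne'
    have h2 := pow_le_pow_left₀ zero_le hn.1.le n
    rw [mul_pow, ← ENNReal.rpow_natCast (_ ^ (1 / (n : ℝ))), ← ENNReal.rpow_mul,
      one_div_mul_cancel hn0, ENNReal.rpow_one] at h2
    have h3 : c ^ n * ‖B ^ n‖₊ ≤ θ ^ n := by exact_mod_cast h2
    rw [one_mul, Real.norm_of_nonneg (NNReal.coe_nonneg _), Real.norm_of_nonneg (by positivity)]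
    exact_mod_cast h3
  exact NNReal.summable_of_le (fun n => mul_le_mul_right (hentry n k l) _) hsumB

end Perron

/-- The weight is the row vector `w = ∑ₙ (1, …, 1) (c A)ⁿ`, which satisfies `w = (1, …, 1) + w c A`;
hence `w c A ≤ r w` with `1 - r` the inverse of an upper bound of `w`. -/
theorem exists_weight_of_spectralRadius_lt_one {κ : Type*} [Fintype κ] [DecidableEq κ]
    (A : Matrix κ κ ℝ≥0) (c : ℝ≥0)
    (h : (c : ℝ≥0∞) * spectralRadius ℂ (A.map fun x => ((x : ℝ) : ℂ)) < 1) :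
    ∃ w : κ → ℝ≥0, (∀ l, 1 ≤ w l) ∧ ∃ r d : ℝ≥0, d ≠ 0 ∧ d + r = 1 ∧
      ∀ l, ∑ k, c * A k l * w k ≤ r * w l := by
  have hsum : ∀ l, Summable fun n => c ^ n * ∑ j, (A ^ n) j l := by
    intro l
    simp_rw [Finset.mul_sum]
    exact summable_sum fun j _ => summable_pow_of_spectralRadius_lt_one A c h j l
  set w : κ → ℝ≥0 := fun l => ∑' n, c ^ n * ∑ j, (A ^ n) j l with hw
  have hrec : ∀ l, w l = 1 + ∑ k, c * A k l * w k := by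
    intro l
    have h1 : ∑ k, c * A k l * w k = ∑' n, c ^ (n + 1) * ∑ j, (A ^ (n + 1)) j l := by
      simp only [hw]
      simp_rw [← NNReal.tsum_mul_left]
      rw [← Summable.tsum_finsetSum fun k _ => (hsum k).mul_left _]
      congr 1
      ext n
      congr 1
      calc ∑ k, c * A k l * (c ^ n * ∑ j, (A ^ n) j k)
          = ∑ k, ∑ j, c ^ (n + 1) * ((A ^ n) j k * A k l) := by
            refine Finset.sum_congr rfl fun k _ => ?_
            rw [Finset.mul_sum, Finset.mul_sum]
            exact Finset.sum_congr rfl fun j _ => by ring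
        _ = ∑ j, c ^ (n + 1) * (A ^ (n + 1)) j l := by
            rw [Finset.sum_comm]
            refine Finset.sum_congr rfl fun j _ => ?_
            rw [pow_succ A, Matrix.mul_apply, Finset.mul_sum]
        _ = _ := by rw [Finset.mul_sum]
    rw [h1]
    simp only [hw]
    rw [tsum_eq_zero_add' ((NNReal.summable_nat_add_iff 1).2 (hsum l))]
    congr 1
    simp [Matrix.one_apply]
  have hw1 : ∀ l, 1 ≤ w l := fun l => by rw [hrec l]; exact le_self_add
  set W : ℝ≥0 := 1 + ∑ l, w l with hW
  have hW1 : 1 ≤ W := le_self_add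
  have hwW : ∀ l, w l ≤ W := fun l =>
    (Finset.single_le_sum (fun _ _ => zero_le) (Finset.mem_univ l)).trans le_add_self
  have hWinv : W⁻¹ ≤ 1 := inv_le_one_of_one_le₀ hW1
  refine ⟨w, hw1, 1 - W⁻¹, W⁻¹, inv_ne_zero (zero_lt_one.trans_le hW1).ne',
    add_tsub_cancel_of_le hWinv, fun l => ?_⟩
  have h1 : W⁻¹ * w l ≤ 1 := by
    rw [inv_mul_le_iff₀ (zero_lt_one.trans_le hW1), mul_one]; exact hwW l
  rw [tsub_mul, one_mul]
  refine le_tsub_of_add_le_right ?_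
  calc _ ≤ ∑ k, c * A k l * w k + 1 := add_le_add le_rfl h1
    _ = w l := by rw [hrec l, add_comm]

/-! ### Measurability of sums over the points of a process -/

section counting
variable {α : Type*} [MeasurableSpace α] {N : α → Finset ℝ≥0}

theorem sum_dirac_apply {β : Type*} [MeasurableSpace β] (s : Finset ℝ≥0) (f : ℝ≥0 → β) {A : Set β}
    (hA : MeasurableSet A) :
    (∑ x ∈ s, Measure.dirac (f x)) A = ∑ x ∈ s, A.indicator 1 (f x) := by
  rw [Measure.finsetSum_apply]
  exact Finset.sum_congr rfl fun x _ => Measure.dirac_apply' _ hA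

theorem measurable_sum_dirac
    (hN : ∀ a, Measurable fun z => (((N z).filter (· ≤ a)).card : ℝ≥0∞)) :
    Measurable fun z => ∑ s ∈ N z, Measure.dirac s := by
  classical
  have hIic : ∀ (a : ℝ≥0) z, (∑ s ∈ N z, Measure.dirac s) (Iic a) =
      (((N z).filter (· ≤ a)).card : ℝ≥0∞) := by
    intro a z
    rw [sum_dirac_apply (N z) (fun s => s) measurableSet_Iic, Finset.card_filter]
    push_cast
    exact Finset.sum_congr rfl fun s _ => by by_cases h : s ≤ a <;> simp [h]
  have : ∀ z, IsFiniteMeasure (∑ s ∈ N z, Measure.dirac s) := fun z => inferInstance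
  refine Measurable.measure_of_isPiSystem (S := range Iic)
    ((BorelSpace.measurable_eq).trans (borel_eq_generateFrom_Iic ℝ≥0)) isPiSystem_Iic ?_ ?_
  · rintro _ ⟨a, rfl⟩
    simp_rw [hIic]
    exact hN a
  · have h1 : ∀ z, (∑ s ∈ N z, Measure.dirac s) univ =
        ⨆ n : ℕ, (((N z).filter (· ≤ (n : ℝ≥0))).card : ℝ≥0∞) := by
      intro z
      simp_rw [← hIic]
      have hU : ⋃ n : ℕ, Iic (n : ℝ≥0) = univ := by
        ext x
        simpa using exists_nat_ge x
      rw [← hU, Monotone.measure_iUnion]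
      exact fun m n hmn => Iic_subset_Iic.2 (by exact_mod_cast hmn)
    simp_rw [h1]
    exact .iSup fun n => hN n

/-- The points of `N z`, marked by `V z`, form a finite measure that depends measurably on `z`. -/
theorem measurable_sum_points
    (hN : ∀ a, Measurable fun z => (((N z).filter (· ≤ a)).card : ℝ≥0∞))
    {β : Type*} [MeasurableSpace β] {V : α → β} (hV : Measurable V) {F : β × ℝ≥0 → ℝ≥0∞}
    (hF : Measurable F) : Measurable fun z => ∑ s ∈ N z, F (V z, s) := by
  have hfin : ∀ z, IsFiniteMeasure (∑ s ∈ N z, Measure.dirac (V z, s)) := fun z => inferInstance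
  have hrect : ∀ A C, MeasurableSet A → MeasurableSet C → ∀ z,
      (∑ s ∈ N z, Measure.dirac (V z, s)) (A ×ˢ C) =
        A.indicator 1 (V z) * (∑ s ∈ N z, Measure.dirac s) C := by
    intro A C hA hC z
    rw [sum_dirac_apply (N z) _ (hA.prod hC), sum_dirac_apply (N z) (fun s => s) hC, Finset.mul_sum]
    refine Finset.sum_congr rfl fun s _ => ?_
    by_cases h1 : V z ∈ A <;> by_cases h2 : s ∈ C <;> simp [h1, h2]
  have hm : ∀ A C, MeasurableSet A → MeasurableSet C →
      Measurable fun z => (∑ s ∈ N z, Measure.dirac (V z, s)) (A ×ˢ C) := by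
    intro A C hA hC
    simp_rw [hrect A C hA hC]
    refine Measurable.mul ((measurable_one.indicator hA).comp hV) ?_
    exact (Measure.measurable_coe hC).comp (measurable_sum_dirac hN)
  have key : Measurable fun z => ∑ s ∈ N z, Measure.dirac (V z, s) := by
    refine Measurable.measure_of_isPiSystem generateFrom_prod.symm isPiSystem_prod ?_ ?_
    · rintro _ ⟨A, hA, C, hC, rfl⟩
      exact hm A C hA hC
    · rw [← univ_prod_univ]
      exact hm univ univ .univ .univ
  have h2 : ∀ z, ∑ s ∈ N z, F (V z, s) = ∫⁻ x, F x ∂(∑ s ∈ N z, Measure.dirac (V z, s)) := by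
    intro z
    rw [lintegral_finsetSum_measure]
    exact Finset.sum_congr rfl fun s _ => (lintegral_dirac' _ hF).symm
  simp_rw [h2]
  exact (Measure.measurable_lintegral hF).comp key

end counting

section predictable
variable {Ω : Type*} {m : MeasurableSpace Ω} {ℱ : Filtration ℝ≥0 m}

theorem predictable_le_prod : ℱ.predictable ≤ (inferInstance : MeasurableSpace (ℝ≥0 × Ω)) :=
  measurableSpace_le_predictable_of_measurableSet
    (fun _ hA => (measurableSet_singleton _).prod (ℱ.le _ _ hA))
    (fun _ _ hA => measurableSet_Ioi.prod (ℱ.le _ _ hA))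

theorem predictable_fst : Measurable[ℱ.predictable] (Prod.fst : ℝ≥0 × Ω → ℝ≥0) := by
  refine @measurable_of_Ioi _ _ _ _ _ ℱ.predictable _ _ _ _ fun a => ?_
  have : (Prod.fst ⁻¹' Ioi a : Set (ℝ≥0 × Ω)) = Ioi a ×ˢ univ := by ext; simp
  rw [this]
  exact measurableSet_predictable_Ioi_prod (@MeasurableSet.univ _ (ℱ a))

theorem predictable_indicator_Ioi {q : ℝ≥0} {f : Ω → ℝ≥0∞} (hf : Measurable[ℱ q] f) :
    Measurable[ℱ.predictable] fun z : ℝ≥0 × Ω => (Ioi q).indicator (fun _ => f z.2) z.1 := by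
  intro E hE
  have hq : MeasurableSet[ℱ.predictable] (Ioi q ×ˢ (univ : Set Ω)) :=
    measurableSet_predictable_Ioi_prod (@MeasurableSet.univ _ (ℱ q))
  have h1 : MeasurableSet[ℱ.predictable] (Ioi q ×ˢ (f ⁻¹' E)) :=
    measurableSet_predictable_Ioi_prod (hf hE)
  by_cases h0 : (0 : ℝ≥0∞) ∈ E
  · have : (fun z : ℝ≥0 × Ω => (Ioi q).indicator (fun _ => f z.2) z.1) ⁻¹' E =
        (Ioi q ×ˢ (f ⁻¹' E)) ∪ (Ioi q ×ˢ (univ : Set Ω))ᶜ := by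
      ext ⟨v, ω⟩
      by_cases hv : q < v <;> simp [hv, h0]
    rw [this]
    exact MeasurableSet.union h1 (MeasurableSet.compl hq)
  · have : (fun z : ℝ≥0 × Ω => (Ioi q).indicator (fun _ => f z.2) z.1) ⁻¹' E =
        (Ioi q ×ˢ (f ⁻¹' E)) := by
      ext ⟨v, ω⟩
      by_cases hv : q < v <;> simp [hv, h0]
    rw [this]
    exact h1

variable {S : Ω → Finset ℝ≥0}

/-- The number of points in `[0, a]` before the current time is a left-continuous adapted process.
-/
theorem predictable_card (hS : ∀ t, Measurable[ℱ t] fun ω => ((S ω).filter (· ≤ t)).card)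
    (a : ℝ≥0) : Measurable[ℱ.predictable] fun z : ℝ≥0 × Ω =>
      ((((S z.2).filter (· < z.1)).filter (· ≤ a)).card : ℝ≥0∞) := by
  obtain ⟨D, hDc, hD⟩ := TopologicalSpace.exists_countable_dense ℝ≥0
  have h1 : (fun z : ℝ≥0 × Ω => ((((S z.2).filter (· < z.1)).filter (· ≤ a)).card : ℝ≥0∞)) =
      fun z => ⨆ q ∈ D, (Ioi q).indicator
        (fun _ => (((S z.2).filter (· ≤ min q a)).card : ℝ≥0∞)) z.1 := by
    ext ⟨v, ω⟩
    apply le_antisymm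
    · simp only
      rcases (((S ω).filter (· < v)).filter (· ≤ a)).eq_empty_or_nonempty with he | hne
      · rw [he]; simp
      · obtain ⟨s, hs, hmax⟩ := Finset.exists_max_image _ id hne
        simp only [Finset.mem_filter, id] at hs hmax
        obtain ⟨q, hqD, hsq, hqv⟩ := hD.exists_between hs.1.2
        refine le_trans ?_ (le_iSup₂ (f := fun q (_ : q ∈ D) => (Ioi q).indicator
          (fun _ => (((S ω).filter (· ≤ min q a)).card : ℝ≥0∞)) v) q hqD)
        rw [indicator_of_mem (mem_Ioi.2 hqv)]
        norm_cast
        refine Finset.card_le_card fun u hu => ?_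
        simp only [Finset.mem_filter] at hu ⊢
        exact ⟨hu.1.1, le_min ((hmax u hu).trans hsq.le) hu.2⟩
    · refine iSup₂_le fun q _ => ?_
      by_cases hqv : q < v
      · rw [indicator_of_mem (mem_Ioi.2 hqv)]
        norm_cast
        refine Finset.card_le_card fun u hu => ?_
        simp only [Finset.mem_filter, le_min_iff] at hu ⊢
        exact ⟨⟨hu.1, hu.2.1.trans_lt hqv⟩, hu.2.2⟩
      · simp [hqv]
  rw [h1]
  refine @Measurable.biSup _ _ _ _ _ ℱ.predictable _ _ _ _ D _ hDc fun q _ => ?_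
  refine predictable_indicator_Ioi
    (f := fun ω => (((S ω).filter (· ≤ min q a)).card : ℝ≥0∞)) ?_
  have h2 : Measurable[ℱ q] fun ω => ((S ω).filter (· ≤ min q a)).card :=
    (hS (min q a)).mono (ℱ.mono (min_le_left q a)) le_rfl
  exact (measurable_of_countable (fun n : ℕ => (n : ℝ≥0∞))).comp h2

theorem predictable_sum_points
    (hS : ∀ t, Measurable[ℱ t] fun ω => ((S ω).filter (· ≤ t)).card)
    {F : ℝ≥0 × ℝ≥0 → ℝ≥0∞} (hF : Measurable F) :
    Measurable[ℱ.predictable] fun z : ℝ≥0 × Ω => ∑ s ∈ S z.2 with s < z.1, F (z.1, s) :=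
  @measurable_sum_points _ ℱ.predictable (fun z : ℝ≥0 × Ω => (S z.2).filter (· < z.1))
    (predictable_card hS) _ _ Prod.fst predictable_fst F hF

theorem measurable_sum_points_lt
    (hS : ∀ t, Measurable[ℱ t] fun ω => ((S ω).filter (· ≤ t)).card)
    {F : ℝ≥0 × ℝ≥0 → ℝ≥0∞} (hF : Measurable F) (t : ℝ≥0) :
    Measurable fun ω => ∑ s ∈ S ω with s < t, F (t, s) :=
  ((predictable_sum_points hS hF).mono predictable_le_prod le_rfl).comp measurable_prodMk_left

end predictable

/-! ### Localisation by the accumulated jumps -/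

namespace ShotNoise
variable {ι : Type*} (N : ShotNoise ι)

/-- The sum of the bounds `J p` of the jumps before time `v`. It controls `Y` pathwise. -/
noncomputable def jumpSum (R : Finset ι) (v : ℝ) : ℝ≥0∞ := ∑ p ∈ R with N.τ p < v, N.J p

theorem jumpSum_mono (R : Finset ι) : Monotone (N.jumpSum R) := fun _ _ huv =>
  Finset.sum_le_sum_of_subset fun p hp => by
    rw [Finset.mem_filter] at hp ⊢; exact ⟨hp.1, hp.2.trans_le huv⟩

/-- The last time `r' ≤ r` up to which the accumulated jumps do not exceed `n`. It is attained, as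
`jumpSum` is left-continuous. -/
theorem exists_exit_time (R : Finset ι) {a r : ℝ} (hpos : ∀ p ∈ R, a ≤ N.τ p) (har : a ≤ r)
    (n : ℝ≥0∞) : ∃ r' ∈ Icc a r, N.jumpSum R r' ≤ n ∧ (N.jumpSum R r ≤ n → r' = r) ∧
      ∀ v ≤ r, N.jumpSum R v ≤ n → v ≤ r' := by
  classical
  by_cases hr : N.jumpSum R r ≤ n
  · exact ⟨r, ⟨har, le_rfl⟩, hr, fun _ => rfl, fun v hv _ => hv⟩
  set F := R.filter (fun p => N.τ p < r ∧ N.jumpSum R (N.τ p) ≤ n) with hF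
  have key : ∀ v ≤ r, N.jumpSum R v ≤ n → ∃ p ∈ F, v ≤ N.τ p := by
    intro v hvr hv
    rcases (R.filter (fun p => v ≤ N.τ p ∧ N.τ p < r)).eq_empty_or_nonempty with he | hne
    · refine absurd (le_trans (Finset.sum_le_sum_of_subset fun p hp => ?_) hv) hr
      rw [Finset.mem_filter] at hp ⊢
      refine ⟨hp.1, not_le.1 fun h => ?_⟩
      have : p ∈ R.filter (fun p => v ≤ N.τ p ∧ N.τ p < r) :=
        Finset.mem_filter.2 ⟨hp.1, h, hp.2⟩
      rw [he] at this
      exact absurd this (Finset.notMem_empty _)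
    · obtain ⟨p, hp, hmin⟩ := Finset.exists_min_image _ N.τ hne
      rw [Finset.mem_filter] at hp
      refine ⟨p, Finset.mem_filter.2 ⟨hp.1, hp.2.2, le_trans
        (Finset.sum_le_sum_of_subset fun u hu => ?_) hv⟩, hp.2.1⟩
      rw [Finset.mem_filter] at hu ⊢
      refine ⟨hu.1, not_le.1 fun h => ?_⟩
      exact absurd (hmin u (Finset.mem_filter.2 ⟨hu.1, h, hu.2.trans hp.2.2⟩)) (not_le.2 hu.2)
  have hFne : F.Nonempty := by
    obtain ⟨p, hp, -⟩ := key a har (by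
      rw [jumpSum, Finset.filter_false_of_mem fun p hp => not_lt.2 (hpos p hp)]
      simp)
    exact ⟨p, hp⟩
  obtain ⟨p, hp, hmax⟩ := Finset.exists_max_image F N.τ hFne
  have hp' := Finset.mem_filter.1 hp
  refine ⟨N.τ p, ⟨hpos p hp'.1, hp'.2.1.le⟩, hp'.2.2, fun h => absurd h hr, fun v hvr hv => ?_⟩
  obtain ⟨u, hu, hvu⟩ := key v hvr hv
  exact hvu.trans (hmax u hu)

/-- The inequality `Y_pow_le` stopped when the accumulated jumps exceed `n`. -/
theorem localized_Y_pow_le (R : Finset ι) (hinj : Set.InjOn N.τ R) (q : ℕ) {a r : ℝ}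
    (hpos : ∀ p ∈ R, a ≤ N.τ p) (har : a ≤ r) (hrt : r ≤ N.t) (n : ℝ≥0∞) :
    {v | N.jumpSum R v ≤ n}.indicator 1 r * N.Y R r ^ (q + 1) +
        (q + 1) * ∫⁻ v in Ioc a r,
          {v | N.jumpSum R v ≤ n}.indicator 1 v * (N.Y R v ^ q * N.drift R v v) ≤
      (∫⁻ v in Ioc a N.t, N.d v) ^ (q + 1) + ∑ p ∈ R with N.τ p < r,
        {v | N.jumpSum R v ≤ n}.indicator 1 (N.τ p) * ∑ j ∈ Finset.range (q + 1),
        (q + 1).choose j * (N.Y R (N.τ p) ^ j * N.J p ^ (q + 1 - j)) := by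
  classical
  obtain ⟨r', ⟨har', hr'r⟩, hr'n, hr'eq, hmax⟩ := N.exists_exit_time R hpos har n
  have h1 : {v | N.jumpSum R v ≤ n}.indicator 1 r * N.Y R r ^ (q + 1) ≤ N.Y R r' ^ (q + 1) := by
    by_cases h : N.jumpSum R r ≤ n
    · rw [hr'eq h]; simp [h]
    · simp [h]
  have h2 : ∫⁻ v in Ioc a r,
      {v | N.jumpSum R v ≤ n}.indicator 1 v * (N.Y R v ^ q * N.drift R v v) ≤
      ∫⁻ v in Ioc a r', N.Y R v ^ q * N.drift R v v := by
    rw [← lintegral_indicator measurableSet_Ioc, ← lintegral_indicator measurableSet_Ioc]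
    refine lintegral_mono fun v => ?_
    by_cases hv : v ∈ Ioc a r
    · by_cases hn : N.jumpSum R v ≤ n
      · have : v ∈ Ioc a r' := ⟨hv.1, hmax v hv.2 hn⟩
        simp [hv, this, hn]
      · simp [hv, hn]
    · simp [hv]
  refine le_trans (add_le_add h1 (mul_le_mul_right h2 _))
    ((N.Y_pow_le R hinj q hpos r' har' (hr'r.trans hrt)).trans (add_le_add le_rfl ?_))
  calc _ ≤ ∑ p ∈ R with N.τ p < r', {v | N.jumpSum R v ≤ n}.indicator 1 (N.τ p) *
        ∑ j ∈ Finset.range (q + 1), (q + 1).choose j *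
          (N.Y R (N.τ p) ^ j * N.J p ^ (q + 1 - j)) := by
        refine Finset.sum_le_sum fun p hp => ?_
        have : N.jumpSum R (N.τ p) ≤ n :=
          (N.jumpSum_mono R (Finset.mem_filter.1 hp).2.le).trans hr'n
        simp [this]
    _ ≤ _ := Finset.sum_le_sum_of_subset fun p hp => by
        rw [Finset.mem_filter] at hp ⊢; exact ⟨hp.1, hp.2.trans_le hr'r⟩

theorem Y_le (R : Finset ι) (hinj : Set.InjOn N.τ R) {a r : ℝ}
    (hpos : ∀ p ∈ R, a ≤ N.τ p) (har : a ≤ r) (hrt : r ≤ N.t) :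
    N.Y R r ≤ (∫⁻ v in Ioc a N.t, N.d v) + N.jumpSum R r :=
  le_self_add.trans (N.Y_add_lintegral_le R hinj hpos har hrt)

theorem measurable_drift_diag (R : Finset ι) : Measurable fun v => N.drift R v v := by
  simp only [drift, Finset.sum_filter]
  exact N.d_meas.add (Finset.measurable_fun_sum _ fun p _ =>
    Measurable.ite measurableSet_Ioi (N.b_meas p) measurable_const)

/-- The stopped drift term is bounded pathwise, so that its expectation is finite and may be
subtracted. -/
theorem localized_lintegral_le (R : Finset ι) (hinj : Set.InjOn N.τ R) (q : ℕ) {a r : ℝ}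
    (hpos : ∀ p ∈ R, a ≤ N.τ p) (har : a ≤ r) (hrt : r ≤ N.t) (n : ℝ≥0∞) :
    ∫⁻ v in Ioc a r,
      {v | N.jumpSum R v ≤ n}.indicator 1 v * (N.Y R v ^ q * N.drift R v v) ≤
      ((∫⁻ v in Ioc a N.t, N.d v) + n) ^ (q + 1) := by
  obtain ⟨r', ⟨har', hr'r⟩, hr'n, hr'eq, hmax⟩ := N.exists_exit_time R hpos har n
  set y := ∫⁻ v in Ioc a N.t, N.d v
  calc _ ≤ ∫⁻ v in Ioc a r', (y + n) ^ q * N.drift R v v := by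
        rw [← lintegral_indicator measurableSet_Ioc, ← lintegral_indicator measurableSet_Ioc]
        refine lintegral_mono fun v => ?_
        by_cases hv : v ∈ Ioc a r
        · by_cases hn : N.jumpSum R v ≤ n
          · have h3 : v ∈ Ioc a r' := ⟨hv.1, hmax v hv.2 hn⟩
            simp only [hv, indicator_of_mem, mem_ofPred_eq, hn, Pi.one_apply, one_mul, h3]
            gcongr
            exact (N.Y_le R hinj hpos hv.1.le (hv.2.trans hrt)).trans (by gcongr)
          · simp [hv, hn]
        · simp [hv]
    _ ≤ (y + n) ^ q * ∫⁻ v in Ioc a r', N.drift R v v := by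
        rw [lintegral_const_mul _ (N.measurable_drift_diag R)]
    _ ≤ (y + n) ^ q * (y + n) := by
        gcongr
        exact (le_add_self.trans (N.Y_add_lintegral_le R hinj hpos har' (hr'r.trans hrt))).trans
          (by gcongr; exact hr'n)
    _ = _ := by rw [pow_succ]

end ShotNoise

/-! ### Point processes dominated by a linear Hawkes process -/

/-- The Lebesgue measure of `(0, T]`, as a measure on `ℝ≥0`. -/
noncomputable def timeMeasure (T : ℝ≥0) : Measure ℝ≥0 :=
  (volume.restrict (Ioc (0 : ℝ) T)).map Real.toNNReal

instance (T : ℝ≥0) : IsFiniteMeasure (timeMeasure T) := by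
  unfold timeMeasure; infer_instance

theorem lintegral_timeMeasure (T : ℝ≥0) {f : ℝ≥0 → ℝ≥0∞} (hf : Measurable f) :
    ∫⁻ v, f v ∂timeMeasure T = ∫⁻ v in Ioc (0 : ℝ) T, f v.toNNReal :=
  lintegral_map hf measurable_real_toNNReal

/-- The intensity at time `v` of the `k`-th component of a linear Hawkes process with constant
baseline `c` and kernels `a`, computed from the realisation `S`. -/
noncomputable def rate {K : ℕ} (c : ℝ≥0∞) (a : Fin K → Fin K → ℝ → ℝ≥0∞)
    (S : Fin K → Finset ℝ≥0) (k : Fin K) (v : ℝ) : ℝ≥0∞ :=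
  c + ∑ l, ∑ s ∈ (S l).filter fun s : ℝ≥0 => (s : ℝ) < v, a k l (v - s)

/-- The point process `S` has a compensator dominated by the rate of a linear Hawkes process. -/
structure IsDominated {Ω : Type*} [MeasurableSpace Ω] {K : ℕ} (P : Measure Ω)
    (ℱ : Filtration ℝ≥0 (inferInstance : MeasurableSpace Ω)) (T : ℝ≥0)
    (S : Fin K → Ω → Finset ℝ≥0) (c : ℝ≥0∞) (a : Fin K → Fin K → ℝ → ℝ≥0∞) : Prop where
  isPointProcess : IsPointProcess P ℱ T S
  lintegral_le : ∀ k, ∀ H : ℝ≥0 × Ω → ℝ≥0∞, Measurable[ℱ.predictable] H →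
    ∫⁻ ω, ∑ s ∈ S k ω, H (s, ω) ∂P ≤
      ∫⁻ ω, ∫⁻ v, H (v, ω) * rate c a (fun l => S l ω) k v ∂timeMeasure T ∂P

/-- The data of the moment estimate: the baseline `c` and the kernels `a` of the dominating linear
Hawkes process, the kernels `h` of the shot noise to be estimated, and a supersolution `G` of the
renewal equation `G_l = h_l + ∑_k a_{kl} * G_k`. -/
structure HawkesKernel (K : ℕ) where
  c : ℝ≥0
  a : Fin K → Fin K → ℝ → ℝ≥0∞
  h : Fin K → ℝ → ℝ≥0∞
  G : Fin K → ℝ → ℝ≥0∞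
  a_mem : ∀ k, MemAllLp (a k)
  h_mem : MemAllLp h
  G_mem : MemAllLp G
  le_G : ∀ l y, h l y + ∑ k, ∫⁻ x, a k l x * G k (y - x) ≤ G l y

namespace HawkesKernel
variable {K : ℕ} (X : HawkesKernel K)

/-- The prediction of the shot noise at time `t` when each point of the component `k` at time `v` is
charged with its total effect `G_k (t - v)`. A point is a pair of a component and a time. -/
noncomputable def noise (t : ℝ) : ShotNoise ((_ : Fin K) × ℝ≥0) where
  τ p := p.2
  h p := X.h p.1 (t - p.2)
  b p v := ∑ k, X.a k p.1 (v - p.2) * X.G k (t - v)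
  J p := X.G p.1 (t - p.2)
  d v := ∑ k, X.G k (t - v) * X.c
  t := t
  b_meas p := Finset.measurable_fun_sum _ fun k _ =>
    (((X.a_mem k).meas p.1).comp (by fun_prop)).mul ((X.G_mem.meas k).comp (by fun_prop))
  d_meas := Finset.measurable_fun_sum _ fun k _ =>
    ((X.G_mem.meas k).comp (by fun_prop)).mul_const _
  le_J p := by
    refine le_trans (add_le_add le_rfl ?_) (X.le_G p.1 (t - p.2))
    refine (setLIntegral_le_lintegral _ _).trans ?_
    have hm : ∀ k ∈ Finset.univ, Measurable fun v : ℝ => X.a k p.1 (v - p.2) * X.G k (t - v) :=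
      fun k _ => (((X.a_mem k).meas p.1).comp (by fun_prop)).mul
        ((X.G_mem.meas k).comp (by fun_prop))
    rw [lintegral_finsetSum _ hm]
    refine Finset.sum_le_sum fun k _ => le_of_eq ?_
    rw [← lintegral_sub_right_eq_self (fun x => X.a k p.1 x * X.G k (t - p.2 - x)) (p.2 : ℝ)]
    refine lintegral_congr fun v => ?_
    congr 2
    ring

/-- The points of all the components of a realisation. -/
def points (S : Fin K → Finset ℝ≥0) : Finset ((_ : Fin K) × ℝ≥0) := Finset.univ.sigma S

theorem sum_points (S : Fin K → Finset ℝ≥0) (v : ℝ) (f : (_ : Fin K) × ℝ≥0 → ℝ≥0∞) :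
    ∑ p ∈ points S with (p.2 : ℝ) < v, f p =
      ∑ l, ∑ s ∈ (S l).filter fun s : ℝ≥0 => (s : ℝ) < v, f ⟨l, s⟩ := by
  simp only [Finset.sum_filter]
  rw [points, Finset.sum_sigma]

theorem drift_eq (t : ℝ) (S : Fin K → Finset ℝ≥0) (v : ℝ) :
    (X.noise t).drift (points S) v v = ∑ k, X.G k (t - v) * rate X.c X.a S k v := by
  rw [ShotNoise.drift]
  change ∑ k, X.G k (t - v) * X.c + ∑ p ∈ points S with (p.2 : ℝ) < v,
    ∑ k, X.a k p.1 (v - p.2) * X.G k (t - v) = _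
  rw [sum_points]
  simp only [rate, mul_add, Finset.sum_add_distrib]
  congr 1
  simp_rw [Finset.mul_sum]
  rw [Finset.sum_comm]
  refine Finset.sum_congr rfl fun l _ => ?_
  rw [Finset.sum_comm]
  refine Finset.sum_congr rfl fun k _ => Finset.sum_congr rfl fun s _ => mul_comm _ _

theorem jumpSum_eq (t : ℝ) (S : Fin K → Finset ℝ≥0) (v : ℝ) :
    (X.noise t).jumpSum (points S) v =
      ∑ l, ∑ s ∈ (S l).filter fun s : ℝ≥0 => (s : ℝ) < v, X.G l (t - s) :=
  sum_points S v fun p => X.G p.1 (t - p.2)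

theorem Y_eq (t : ℝ) (S : Fin K → Finset ℝ≥0) (v : ℝ) :
    (X.noise t).Y (points S) v =
      ∑ l, ∑ s ∈ (S l).filter fun s : ℝ≥0 => (s : ℝ) < v, (X.h l (t - s) +
      ∫⁻ u in Ioc v t, ∑ k, X.a k l (u - s) * X.G k (t - u)) +
      ∫⁻ u in Ioc v t, ∑ k, X.G k (t - u) * X.c := by
  have h1 : ∫⁻ u in Ioc v t, (X.noise t).drift (points S) v u =
      (∫⁻ u in Ioc v t, ∑ k, X.G k (t - u) * X.c) +
        ∑ p ∈ points S with (p.2 : ℝ) < v, ∫⁻ u in Ioc v t, (X.noise t).b p u := by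
    rw [← lintegral_finsetSum _ fun p _ => (X.noise t).b_meas p]
    exact lintegral_add_left (X.noise t).d_meas _
  rw [ShotNoise.Y]
  change _ + ∫⁻ u in Ioc v t, (X.noise t).drift (points S) v u = _
  rw [h1]
  have h2 := sum_points S v (X.noise t).h
  have h3 := sum_points S v fun p => ∫⁻ u in Ioc v t, (X.noise t).b p u
  change ∑ p ∈ points S with (p.2 : ℝ) < v, (X.noise t).h p + (_ + _) = _
  rw [h2, h3]
  simp only [Finset.sum_add_distrib]
  rw [add_assoc, add_comm (lintegral _ _)]
  rfl

theorem sum_le_Y (t : ℝ) (S : Fin K → Finset ℝ≥0) (v : ℝ) :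
    ∑ l, ∑ s ∈ (S l).filter fun s : ℝ≥0 => (s : ℝ) < v, X.h l (t - s) ≤
      (X.noise t).Y (points S) v := by
  rw [Y_eq]
  refine le_trans ?_ le_self_add
  exact Finset.sum_le_sum fun l _ => Finset.sum_le_sum fun s _ => le_self_add

/-- A bound, uniform in time, for the contribution of the baseline to the prediction. -/
noncomputable def base : ℝ≥0∞ := ∑ k, (∫⁻ v, X.G k v) * X.c

theorem base_lt_top : X.base < ∞ :=
  ENNReal.sum_lt_top.2 fun k _ => ENNReal.mul_lt_top (X.G_mem.lintegral_lt_top k) (by finiteness)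

theorem lintegral_d_le (t : ℝ) : ∫⁻ v in Ioc 0 t, (X.noise t).d v ≤ X.base := by
  refine (setLIntegral_le_lintegral _ _).trans ?_
  change ∫⁻ v, ∑ k, X.G k (t - v) * X.c ≤ _
  have hm : ∀ k, Measurable fun v => X.G k (t - v) :=
    fun k => (X.G_mem.meas k).comp (by fun_prop)
  rw [lintegral_finsetSum _ fun k _ => (hm k).mul_const _]
  refine Finset.sum_le_sum fun k _ => ?_
  rw [lintegral_mul_const _ (hm k), lintegral_sub_left_eq_self (X.G k) t]

section pointProcess
variable {Ω : Type*} {mΩ : MeasurableSpace Ω} {P : Measure Ω} {ℱ : Filtration ℝ≥0 mΩ} {T : ℝ≥0}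
  {S : Fin K → Ω → Finset ℝ≥0}

theorem predictable_sum (hS : IsPointProcess P ℱ T S) {F : Fin K → ℝ≥0 × ℝ≥0 → ℝ≥0∞}
    (hF : ∀ l, Measurable (F l)) : Measurable[ℱ.predictable] fun z : ℝ≥0 × Ω =>
      ∑ l, ∑ s ∈ (S l z.2).filter fun s : ℝ≥0 => (s : ℝ) < z.1, F l (z.1, s) := by
  refine Finset.measurable_fun_sum _ fun l _ => ?_
  simpa only [NNReal.coe_lt_coe] using predictable_sum_points (hS.adapted l) (hF l)

theorem predictable_comp_time {f : ℝ≥0 → ℝ≥0∞} (hf : Measurable f) :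
    Measurable[ℱ.predictable] fun z : ℝ≥0 × Ω => f z.1 := hf.comp predictable_fst

theorem predictable_rate (hS : IsPointProcess P ℱ T S) (k : Fin K) :
    Measurable[ℱ.predictable] fun z : ℝ≥0 × Ω => rate X.c X.a (fun l => S l z.2) k z.1 := by
  refine Measurable.const_add (predictable_sum hS
    (F := fun l w => X.a k l ((w.1 : ℝ) - w.2)) fun l => ?_) _
  exact ((X.a_mem k).meas l).comp (by fun_prop)

theorem predictable_jumpSum (hS : IsPointProcess P ℱ T S) (t : ℝ) :
    Measurable[ℱ.predictable] fun z : ℝ≥0 × Ω =>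
      (X.noise t).jumpSum (points fun l => S l z.2) z.1 := by
  simp_rw [jumpSum_eq]
  refine predictable_sum hS (F := fun l w => X.G l (t - w.2)) fun l => ?_
  exact (X.G_mem.meas l).comp (by fun_prop)

theorem predictable_Y (hS : IsPointProcess P ℱ T S) (t : ℝ) :
    Measurable[ℱ.predictable] fun z : ℝ≥0 × Ω => (X.noise t).Y (points fun l => S l z.2) z.1 := by
  simp_rw [Y_eq]
  refine Measurable.add (predictable_sum hS (F := fun l w => X.h l (t - w.2) +
      ∫⁻ u in Ioc (w.1 : ℝ) t, ∑ k, X.a k l (u - w.2) * X.G k (t - u)) fun l => ?_)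
    (predictable_comp_time (f := fun v => ∫⁻ u in Ioc (v : ℝ) t, ∑ k, X.G k (t - u) * X.c) ?_)
  · refine ((X.h_mem.meas l).comp (by fun_prop)).add ?_
    simp_rw [← lintegral_indicator measurableSet_Ioc]
    refine Measurable.lintegral_prod_right' (f := fun z : (ℝ≥0 × ℝ≥0) × ℝ =>
      (Ioc (z.1.1 : ℝ) t).indicator
        (fun u => ∑ k, X.a k l (u - z.1.2) * X.G k (t - u)) z.2) ?_
    have : (fun z : (ℝ≥0 × ℝ≥0) × ℝ => (Ioc (z.1.1 : ℝ) t).indicator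
        (fun u => ∑ k, X.a k l (u - z.1.2) * X.G k (t - u)) z.2) =
        {z : (ℝ≥0 × ℝ≥0) × ℝ | (z.1.1 : ℝ) < z.2 ∧ z.2 ≤ t}.indicator
          (fun z => ∑ k, X.a k l (z.2 - z.1.2) * X.G k (t - z.2)) := by
      ext z; simp [indicator]
    rw [this]
    refine Measurable.indicator (Finset.measurable_fun_sum _ fun k _ => ?_) ?_
    · exact (((X.a_mem k).meas l).comp (by fun_prop)).mul ((X.G_mem.meas k).comp (by fun_prop))
    · have h1 : MeasurableSet {z : (ℝ≥0 × ℝ≥0) × ℝ | (z.1.1 : ℝ) < z.2} :=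
        measurableSet_lt (by fun_prop) (by fun_prop)
      have h2 : MeasurableSet {z : (ℝ≥0 × ℝ≥0) × ℝ | z.2 ≤ t} :=
        measurableSet_le (by fun_prop) (by fun_prop)
      exact h1.inter h2
  · apply Antitone.measurable
    intro v w hvw
    exact lintegral_mono_set (Ioc_subset_Ioc_left (by exact_mod_cast hvw))

end pointProcess
end HawkesKernel

/-! ### The localised moment inequality -/

namespace HawkesKernel
variable {K : ℕ} (X : HawkesKernel K)
variable {Ω : Type*} {mΩ : MeasurableSpace Ω} {P : Measure Ω} {ℱ : Filtration ℝ≥0 mΩ} {T : ℝ≥0}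
  {S : Fin K → Ω → Finset ℝ≥0}

/-- As there are almost surely no common jumps, distinct points have distinct times. -/
theorem ae_injOn (hS : IsPointProcess P ℱ T S) :
    ∀ᵐ ω ∂P, Set.InjOn (fun p : (_ : Fin K) × ℝ≥0 => (p.2 : ℝ)) (points fun l => S l ω) := by
  have h : ∀ᵐ ω ∂P, ∀ k l, k ≠ l → Disjoint (S k ω) (S l ω) := by
    simp only [ae_all_iff]
    exact hS.disjoint
  filter_upwards [h] with ω hω
  rintro ⟨k, s⟩ hk ⟨l, u⟩ hl hsu
  simp only [points, Finset.coe_sigma, Set.mem_sigma_iff, Finset.mem_coe] at hk hl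
  have hsu' : s = u := by simpa using hsu
  subst hsu'
  by_cases hkl : k = l
  · subst hkl; rfl
  · exact absurd hl.2 (Finset.disjoint_left.1 (hω k l hkl) hk.2)

/-- The indicator of the times up to `r` at which the accumulated jumps do not exceed `n`. -/
noncomputable def cutoff (t : ℝ) (S : Fin K → Ω → Finset ℝ≥0) (r : ℝ≥0) (n : ℕ) :
    ℝ≥0 × Ω → ℝ≥0∞ :=
  {z | z.1 ≤ r ∧ (X.noise t).jumpSum (points fun l => S l z.2) z.1 ≤ n}.indicator 1

theorem cutoff_of_le {t : ℝ} {r s : ℝ≥0} (h : s ≤ r) (n : ℕ) (ω : Ω) :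
    X.cutoff t S r n (s, ω) =
      {v | (X.noise t).jumpSum (points fun l => S l ω) v ≤ n}.indicator 1 (s : ℝ) := by
  by_cases h' : (X.noise t).jumpSum (points fun l => S l ω) s ≤ n <;> simp [cutoff, h, h']

theorem predictable_cutoff (hS : IsPointProcess P ℱ T S) (t : ℝ) (r : ℝ≥0) (n : ℕ) :
    Measurable[ℱ.predictable] (X.cutoff t S r n) := by
  refine Measurable.indicator (f := fun _ => (1 : ℝ≥0∞)) measurable_const ?_
  refine MeasurableSet.inter ?_ ?_
  · exact predictable_fst (ℱ := ℱ) measurableSet_Iic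
  · exact (X.predictable_jumpSum hS t) (measurableSet_Iic (a := (n : ℝ≥0∞)))

/-- The `j`-th term of the binomial expansion of the jump of `Y ^ (q + 1)` caused by a point of the
component `l`. -/
noncomputable def jumpTerm (t : ℝ) (S : Fin K → Ω → Finset ℝ≥0) (q : ℕ) (l : Fin K) (j : ℕ)
    (z : ℝ≥0 × Ω) : ℝ≥0∞ :=
  (q + 1).choose j * ((X.noise t).Y (points fun l => S l z.2) z.1 ^ j *
    X.G l (t - z.1) ^ (q + 1 - j))

theorem predictable_jumpTerm (hS : IsPointProcess P ℱ T S) (t : ℝ) (q : ℕ) (l : Fin K) (j : ℕ) :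
    Measurable[ℱ.predictable] (X.jumpTerm t S q l j) := by
  refine Measurable.const_mul (Measurable.mul ((X.predictable_Y hS t).pow_const _) ?_) _
  exact predictable_comp_time (f := fun v : ℝ≥0 => X.G l (t - v) ^ (q + 1 - j))
    (((X.G_mem.meas l).comp (by fun_prop)).pow_const _)

theorem predictable_drift (hS : IsPointProcess P ℱ T S) (t : ℝ) :
    Measurable[ℱ.predictable] fun z : ℝ≥0 × Ω =>
      ∑ k, X.G k (t - z.1) * rate X.c X.a (fun l => S l z.2) k z.1 := by
  refine Finset.measurable_fun_sum _ fun k _ => Measurable.mul ?_ (X.predictable_rate hS k)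
  exact predictable_comp_time (f := fun v : ℝ≥0 => X.G k (t - v))
    ((X.G_mem.meas k).comp (by fun_prop))

theorem lintegral_cutoff (hS : IsPointProcess P ℱ T S) {r : ℝ≥0} (hrT : r ≤ T) (t : ℝ) (q n : ℕ)
    (ω : Ω) :
    ∫⁻ v in Ioc (0 : ℝ) r, {v | (X.noise t).jumpSum (points fun l => S l ω) v ≤ n}.indicator 1 v *
        ((X.noise t).Y (points fun l => S l ω) v ^ q *
          (X.noise t).drift (points fun l => S l ω) v v) =
      ∫⁻ v, X.cutoff t S r n (v, ω) * ((X.noise t).Y (points fun l => S l ω) v ^ q *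
        ∑ k, X.G k (t - v) * rate X.c X.a (fun l => S l ω) k v) ∂timeMeasure T := by
  rw [lintegral_timeMeasure]
  · rw [← lintegral_indicator measurableSet_Ioc, ← lintegral_indicator measurableSet_Ioc]
    refine lintegral_congr fun v => ?_
    by_cases hv : v ∈ Ioc (0 : ℝ) T
    · have hv' : (v.toNNReal : ℝ) = v := Real.coe_toNNReal _ hv.1.le
      rw [indicator_of_mem hv]
      by_cases hr : v ≤ r
      · have h1 : v ∈ Ioc (0 : ℝ) r := ⟨hv.1, hr⟩
        have h2 : v.toNNReal ≤ r := Real.toNNReal_le_iff_le_coe.2 hr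
        rw [indicator_of_mem h1, drift_eq, X.cutoff_of_le h2, hv']
      · have h1 : v ∉ Ioc (0 : ℝ) r := fun h => hr h.2
        have h2 : ¬ v.toNNReal ≤ r := fun h => hr (Real.toNNReal_le_iff_le_coe.1 h)
        simp [cutoff, h1, h2]
    · have h1 : v ∉ Ioc (0 : ℝ) r := fun h => hv ⟨h.1, h.2.trans (by exact_mod_cast hrT)⟩
      simp [hv, h1]
  · have hm : Measurable fun z : ℝ≥0 × Ω => X.cutoff t S r n z *
        ((X.noise t).Y (points fun l => S l z.2) z.1 ^ q *
          ∑ k, X.G k (t - z.1) * rate X.c X.a (fun l => S l z.2) k z.1) :=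
      ((X.predictable_cutoff hS t r n).mul (((X.predictable_Y hS t).pow_const q).mul
        (X.predictable_drift hS t))).mono predictable_le_prod le_rfl
    exact hm.comp (measurable_prodMk_right (y := ω))

theorem pathwise_bound (hS : IsPointProcess P ℱ T S) {r : ℝ≥0} (hrT : r ≤ T) {t : ℝ}
    (hrt : (r : ℝ) ≤ t) (q n : ℕ) {ω : Ω}
    (hω : Set.InjOn (fun p : (_ : Fin K) × ℝ≥0 => (p.2 : ℝ)) (points fun l => S l ω)) :
    X.cutoff t S r n (r, ω) * (X.noise t).Y (points fun l => S l ω) r ^ (q + 1) +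
      (q + 1) * ∫⁻ v, X.cutoff t S r n (v, ω) * ((X.noise t).Y (points fun l => S l ω) v ^ q *
        ∑ k, X.G k (t - v) * rate X.c X.a (fun l => S l ω) k v) ∂timeMeasure T ≤
    X.base ^ (q + 1) + ∑ l, ∑ s ∈ S l ω, X.cutoff t S r n (s, ω) *
      ∑ j ∈ Finset.range (q + 1), X.jumpTerm t S q l j (s, ω) := by
  have h := (X.noise t).localized_Y_pow_le (points fun l => S l ω) hω q (a := 0) (r := r)
    (fun p _ => NNReal.coe_nonneg _) r.2 hrt n
  rw [X.lintegral_cutoff hS hrT t q n ω] at h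
  rw [X.cutoff_of_le le_rfl]
  refine h.trans (add_le_add (pow_le_pow_left₀ zero_le (X.lintegral_d_le t) _) ?_)
  have h2 := sum_points (fun l => S l ω) r fun p =>
    {v | (X.noise t).jumpSum (points fun l => S l ω) v ≤ n}.indicator 1 (p.2 : ℝ) *
      ∑ j ∈ Finset.range (q + 1), X.jumpTerm t S q p.1 j (p.2, ω)
  refine le_trans (le_of_eq h2) (Finset.sum_le_sum fun l _ => ?_)
  refine (Finset.sum_le_sum fun s hs => ?_).trans
    (Finset.sum_le_sum_of_subset (Finset.filter_subset _ _))
  have hsr : s ≤ r := by exact_mod_cast (Finset.mem_filter.1 hs).2.le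
  rw [X.cutoff_of_le hsr]

theorem lintegral_cutoff_lt_top [IsProbabilityMeasure P] (hS : IsPointProcess P ℱ T S) {r : ℝ≥0}
    (hrT : r ≤ T) {t : ℝ} (hrt : (r : ℝ) ≤ t) (q n : ℕ) :
    ∫⁻ ω, ∫⁻ v, X.cutoff t S r n (v, ω) * ((X.noise t).Y (points fun l => S l ω) v ^ q *
        ∑ k, X.G k (t - v) * rate X.c X.a (fun l => S l ω) k v) ∂timeMeasure T ∂P < ∞ := by
  have h1 : ∀ᵐ ω ∂P, ∫⁻ v, X.cutoff t S r n (v, ω) * ((X.noise t).Y (points fun l => S l ω) v ^ q *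
        ∑ k, X.G k (t - v) * rate X.c X.a (fun l => S l ω) k v) ∂timeMeasure T ≤
        (X.base + n) ^ (q + 1) := by
    filter_upwards [ae_injOn hS] with ω hω
    rw [← X.lintegral_cutoff hS hrT t q n ω]
    refine ((X.noise t).localized_lintegral_le _ hω q (fun p _ => NNReal.coe_nonneg _) r.2 hrt
      n).trans ?_
    gcongr
    exact X.lintegral_d_le t
  refine (lintegral_mono_ae h1).trans_lt ?_
  rw [lintegral_const, measure_univ, mul_one]
  exact ENNReal.pow_lt_top (ENNReal.add_lt_top.2 ⟨X.base_lt_top, by finiteness⟩)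

theorem measurable_sum_jumps (hS : IsPointProcess P ℱ T S) (l : Fin K) {H : ℝ≥0 × Ω → ℝ≥0∞}
    (hH : Measurable H) : Measurable fun ω => ∑ s ∈ S l ω, H (s, ω) := by
  refine measurable_sum_points (N := S l) (fun a => ?_) measurable_id
    (F := fun w : Ω × ℝ≥0 => H (w.2, w.1)) (hH.comp measurable_swap)
  have h2 := (hS.adapted l a).mono (ℱ.le a) le_rfl
  exact (measurable_of_countable (fun n : ℕ => (n : ℝ≥0∞))).comp h2

/-- The expectation of the stopped power `q + 1` of `Y`. The terms of order `j = q` of the jumps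
have the same expectation as the drift and cancel, which leaves the terms `j < q`. -/
theorem localized_moment_le [IsProbabilityMeasure P]
    (hD : IsDominated P ℱ T S X.c X.a) {r : ℝ≥0} (hrT : r ≤ T) {t : ℝ} (hrt : (r : ℝ) ≤ t)
    (q n : ℕ) :
    ∫⁻ ω, X.cutoff t S r n (r, ω) * (X.noise t).Y (points fun l => S l ω) r ^ (q + 1) ∂P ≤
      X.base ^ (q + 1) + ∑ l, ∑ j ∈ Finset.range q, ∫⁻ ω, ∫⁻ v, X.cutoff t S r n (v, ω) *
        (X.jumpTerm t S q l j (v, ω) * rate X.c X.a (fun l => S l ω) l v) ∂timeMeasure T ∂P := by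
  have hS := hD.isPointProcess
  set ν := P.prod (timeMeasure T) with hν
  have hle : ∀ {f : ℝ≥0 × Ω → ℝ≥0∞}, Measurable[ℱ.predictable] f → Measurable f := fun hf =>
    hf.mono predictable_le_prod le_rfl
  -- iterated integrals as integrals over the product space
  have hint : ∀ {f : ℝ≥0 × Ω → ℝ≥0∞}, Measurable[ℱ.predictable] f →
      ∫⁻ ω, ∫⁻ v, f (v, ω) ∂timeMeasure T ∂P = ∫⁻ z, f z.swap ∂ν := fun {f} hf =>
    (lintegral_prod (fun z : Ω × ℝ≥0 => f z.swap)
      ((hle hf).comp measurable_swap).aemeasurable).symm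
  have mχ := X.predictable_cutoff hS t r n
  have mR := fun l => X.predictable_rate hS l
  have mJ := fun l j => X.predictable_jumpTerm hS t q l j
  have mD : Measurable[ℱ.predictable] fun z : ℝ≥0 × Ω => X.cutoff t S r n z *
      ((X.noise t).Y (points fun l => S l z.2) z.1 ^ q *
        ∑ k, X.G k (t - z.1) * rate X.c X.a (fun l => S l z.2) k z.1) :=
    mχ.mul (((X.predictable_Y hS t).pow_const q).mul (X.predictable_drift hS t))
  have mT : ∀ l j, Measurable[ℱ.predictable] fun z => X.cutoff t S r n z *
      (X.jumpTerm t S q l j z * rate X.c X.a (fun l => S l z.2) l z.1) := fun l j =>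
    mχ.mul ((mJ l j).mul (mR l))
  have mT' : ∀ l j, Measurable fun z : Ω × ℝ≥0 => X.cutoff t S r n z.swap *
      (X.jumpTerm t S q l j z.swap * rate X.c X.a (fun l => S l z.swap.2) l z.swap.1) :=
    fun l j => (hle (mT l j)).comp measurable_swap
  have mD' : Measurable fun z : Ω × ℝ≥0 => X.cutoff t S r n z.swap *
      ((X.noise t).Y (points fun l => S l z.swap.2) z.swap.1 ^ q *
        ∑ k, X.G k (t - z.swap.1) * rate X.c X.a (fun l => S l z.swap.2) k z.swap.1) :=
    (hle mD).comp measurable_swap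
  have mH : ∀ l, Measurable[ℱ.predictable] fun z => X.cutoff t S r n z *
      ∑ j ∈ Finset.range (q + 1), X.jumpTerm t S q l j z := fun l =>
    mχ.mul (Finset.measurable_fun_sum _ fun j _ => mJ l j)
  have mHR : ∀ l, Measurable[ℱ.predictable] fun z => (X.cutoff t S r n z *
      ∑ j ∈ Finset.range (q + 1), X.jumpTerm t S q l j z) *
        rate X.c X.a (fun l => S l z.2) l z.1 := fun l => (mH l).mul (mR l)
  set A := ∫⁻ ω, ∫⁻ v, X.cutoff t S r n (v, ω) * ((X.noise t).Y (points fun l => S l ω) v ^ q *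
        ∑ k, X.G k (t - v) * rate X.c X.a (fun l => S l ω) k v) ∂timeMeasure T ∂P with hA
  have hAfin : (q + 1) * A ≠ ∞ :=
    ENNReal.mul_ne_top (by finiteness) (X.lintegral_cutoff_lt_top hS hrT hrt q n).ne
  have mL : Measurable fun ω => X.cutoff t S r n (r, ω) *
      (X.noise t).Y (points fun l => S l ω) r ^ (q + 1) :=
    (hle (mχ.mul ((X.predictable_Y hS t).pow_const (q + 1)))).comp measurable_prodMk_left
  have mA : Measurable fun ω => ∫⁻ v, X.cutoff t S r n (v, ω) *
      ((X.noise t).Y (points fun l => S l ω) v ^ q *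
        ∑ k, X.G k (t - v) * rate X.c X.a (fun l => S l ω) k v) ∂timeMeasure T :=
    ((hle mD).comp measurable_swap).lintegral_prod_right'
  have h1 : ∫⁻ ω, X.cutoff t S r n (r, ω) * (X.noise t).Y (points fun l => S l ω) r ^ (q + 1) ∂P +
      (q + 1) * A ≤ X.base ^ (q + 1) + ∑ l, ∫⁻ ω, ∫⁻ v, X.cutoff t S r n (v, ω) *
      (∑ j ∈ Finset.range (q + 1), X.jumpTerm t S q l j (v, ω)) *
        rate X.c X.a (fun l => S l ω) l v ∂timeMeasure T ∂P := by
    calc _ = ∫⁻ ω, (X.cutoff t S r n (r, ω) *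
          (X.noise t).Y (points fun l => S l ω) r ^ (q + 1) +
        (q + 1) * ∫⁻ v, X.cutoff t S r n (v, ω) * ((X.noise t).Y (points fun l => S l ω) v ^ q *
        ∑ k, X.G k (t - v) * rate X.c X.a (fun l => S l ω) k v) ∂timeMeasure T) ∂P := by
          rw [lintegral_add_left mL, lintegral_const_mul _ mA]
      _ ≤ ∫⁻ ω, (X.base ^ (q + 1) + ∑ l, ∑ s ∈ S l ω, X.cutoff t S r n (s, ω) *
          ∑ j ∈ Finset.range (q + 1), X.jumpTerm t S q l j (s, ω)) ∂P := by
          refine lintegral_mono_ae ?_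
          filter_upwards [ae_injOn hS] with ω hω
          exact X.pathwise_bound hS hrT hrt q n hω
      _ = X.base ^ (q + 1) + ∑ l, ∫⁻ ω, ∑ s ∈ S l ω, X.cutoff t S r n (s, ω) *
          ∑ j ∈ Finset.range (q + 1), X.jumpTerm t S q l j (s, ω) ∂P := by
          rw [lintegral_add_left measurable_const, lintegral_const, measure_univ, mul_one,
            lintegral_finsetSum _ fun l _ => measurable_sum_jumps hS l (hle (mH l))]
      _ ≤ _ := by
          exact add_le_add le_rfl (Finset.sum_le_sum fun l _ => hD.lintegral_le l _ (mH l))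
  -- the terms with `j = q` add up to the compensator `(q + 1) * A`
  have h2 : ∑ l, ∫⁻ ω, ∫⁻ v, X.cutoff t S r n (v, ω) *
      (∑ j ∈ Finset.range (q + 1), X.jumpTerm t S q l j (v, ω)) *
        rate X.c X.a (fun l => S l ω) l v ∂timeMeasure T ∂P =
      (∑ l, ∑ j ∈ Finset.range q, ∫⁻ ω, ∫⁻ v, X.cutoff t S r n (v, ω) *
        (X.jumpTerm t S q l j (v, ω) * rate X.c X.a (fun l => S l ω) l v) ∂timeMeasure T ∂P) +
      (q + 1) * A := by
    have e1 : ∀ l, ∫⁻ ω, ∫⁻ v, X.cutoff t S r n (v, ω) *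
      (∑ j ∈ Finset.range (q + 1), X.jumpTerm t S q l j (v, ω)) *
        rate X.c X.a (fun l => S l ω) l v ∂timeMeasure T ∂P =
        ∑ j ∈ Finset.range (q + 1), ∫⁻ ω, ∫⁻ v, X.cutoff t S r n (v, ω) *
        (X.jumpTerm t S q l j (v, ω) * rate X.c X.a (fun l => S l ω) l v) ∂timeMeasure T ∂P := by
      intro l
      rw [hint (mHR l)]
      simp_rw [fun j => hint (mT l j)]
      rw [← lintegral_finsetSum _ fun j _ => mT' l j]
      refine lintegral_congr fun z => ?_
      simp only [Finset.mul_sum, Finset.sum_mul]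
      exact Finset.sum_congr rfl fun j _ => by simp; ring
    simp_rw [e1, Finset.sum_range_succ, Finset.sum_add_distrib]
    congr 1
    rw [hA, hint mD]
    simp_rw [fun l => hint (mT l q)]
    rw [← lintegral_finsetSum _ fun l _ => mT' l q, ← lintegral_const_mul _ mD']
    refine lintegral_congr fun z => ?_
    simp only [jumpTerm, Finset.mul_sum]
    refine Finset.sum_congr rfl fun l _ => ?_
    simp
    ring
  rw [h2, ← add_assoc] at h1
  exact (ENNReal.add_le_add_iff_right hAfin).1 h1

end HawkesKernel

/-! ### Uniform bounds for the moments of shot noise -/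

theorem ENNReal.add_pow_le_two_pow_mul (x y : ℝ≥0∞) (n : ℕ) :
    (x + y) ^ n ≤ 2 ^ n * (x ^ n + y ^ n) := by
  rcases le_total x y with h | h
  · calc (x + y) ^ n ≤ (2 * y) ^ n := by rw [two_mul]; gcongr
      _ ≤ _ := by rw [mul_pow]; gcongr; exact le_add_self
  · calc (x + y) ^ n ≤ (2 * x) ^ n := by rw [two_mul]; gcongr
      _ ≤ _ := by rw [mul_pow]; gcongr; exact le_self_add

theorem ENNReal.pow_mul_le_add_pow (x y : ℝ≥0∞) (n : ℕ) :
    x ^ n * y ≤ x ^ (n + 1) + y ^ (n + 1) := by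
  rcases le_total x y with h | h
  · calc x ^ n * y ≤ y ^ n * y := by gcongr
      _ = y ^ (n + 1) := (pow_succ _ _).symm
      _ ≤ _ := le_add_self
  · calc x ^ n * y ≤ x ^ n * x := by gcongr
      _ = x ^ (n + 1) := (pow_succ _ _).symm
      _ ≤ _ := le_self_add

/-- The shot noise `∑_l ∑_{s < r} h_l(t - s)` at time `t` of the points before time `r`. -/
noncomputable def shot {K : ℕ} (h : Fin K → ℝ → ℝ≥0∞) (S : Fin K → Finset ℝ≥0) (t r : ℝ) : ℝ≥0∞ :=
  ∑ l, ∑ s ∈ (S l).filter fun s : ℝ≥0 => (s : ℝ) < r, h l (t - s)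

universe u in
/-- The moments of order `q` of the shot noise with kernels `h` are at most `C`, for all the
processes, on all the probability spaces and all the time intervals, that are dominated by the
linear Hawkes process with baseline `c` and kernels `a`. -/
def HasMomentBound {K : ℕ} (c : ℝ≥0) (a : Fin K → Fin K → ℝ → ℝ≥0∞) (h : Fin K → ℝ → ℝ≥0∞)
    (q : ℕ) (C : ℝ≥0) : Prop :=
  ∀ (Ω : Type u) [MeasurableSpace Ω] (P : Measure Ω) [IsProbabilityMeasure P]
    (ℱ : Filtration ℝ≥0 (inferInstance : MeasurableSpace Ω)) (T : ℝ≥0)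
    (S : Fin K → Ω → Finset ℝ≥0), IsDominated P ℱ T S c a →
    ∀ r ≤ T, ∀ t : ℝ, (r : ℝ) ≤ t → ∫⁻ ω, shot h (fun l => S l ω) t r ^ q ∂P ≤ C

namespace HawkesKernel
variable {K : ℕ} (X : HawkesKernel K)
variable {Ω : Type*} {mΩ : MeasurableSpace Ω} {P : Measure Ω} {ℱ : Filtration ℝ≥0 mΩ} {T : ℝ≥0}
  {S : Fin K → Ω → Finset ℝ≥0}

theorem measurable_shot (hS : IsPointProcess P ℱ T S) {h : Fin K → ℝ → ℝ≥0∞}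
    (hh : ∀ l, Measurable (h l)) (t : ℝ) (r : ℝ≥0) :
    Measurable fun ω => shot h (fun l => S l ω) t r := by
  have hp : Measurable[ℱ.predictable] fun z : ℝ≥0 × Ω => shot h (fun l => S l z.2) t z.1 :=
    predictable_sum hS (F := fun l w => h l (t - (w.2 : ℝ))) fun l => by
      have h1 : Measurable fun w : ℝ≥0 × ℝ≥0 => t - (w.2 : ℝ) := by fun_prop
      exact (hh l).comp h1
  have hm : Measurable fun z : ℝ≥0 × Ω => shot h (fun l => S l z.2) t z.1 :=
    hp.mono predictable_le_prod le_rfl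
  have hr : Measurable fun ω : Ω => (r, ω) := measurable_prodMk_left
  have hc := hm.comp hr
  exact hc

/-- Almost surely, no point of the process hits the null set where `G` is infinite. Hence the
localisation exhausts the probability space. -/
theorem ae_jumpSum_lt_top (hD : IsDominated P ℱ T S X.c X.a) [IsProbabilityMeasure P] (t r : ℝ) :
    ∀ᵐ ω ∂P, (X.noise t).jumpSum (points fun l => S l ω) r < ∞ := by
  have hS := hD.isPointProcess
  have key : ∀ l, ∀ᵐ ω ∂P, ∀ s ∈ S l ω, X.G l (t - s) < ∞ := by
    intro l
    have hGm : Measurable fun v : ℝ≥0 => X.G l (t - v) := (X.G_mem.meas l).comp (by fun_prop)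
    set H : ℝ≥0 × Ω → ℝ≥0∞ := fun z => {v : ℝ≥0 | X.G l (t - v) = ∞}.indicator 1 z.1 with hH
    have hset : MeasurableSet {v : ℝ≥0 | X.G l (t - v) = ∞} := hGm (measurableSet_singleton _)
    have hHm : Measurable[ℱ.predictable] H := predictable_comp_time (measurable_one.indicator hset)
    have hnull : ∀ᵐ v : ℝ≥0 ∂timeMeasure T, X.G l (t - v) ≠ ∞ := by
      rw [timeMeasure, ae_map_iff (p := fun v : ℝ≥0 => X.G l (t - v) ≠ ∞)
        measurable_real_toNNReal.aemeasurable hset.compl]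
      have h1 : ∀ᵐ y, X.G l y ≠ ∞ := by
        filter_upwards [ae_lt_top (X.G_mem.meas l) (X.G_mem.lintegral_lt_top l).ne] with y hy
        exact hy.ne
      have h2 : ∀ᵐ v : ℝ, X.G l (t - v) ≠ ∞ :=
        (volume.measurePreserving_sub_left t).quasiMeasurePreserving.ae h1
      filter_upwards [ae_restrict_of_ae h2, ae_restrict_mem measurableSet_Ioc] with v hv hv'
      rwa [Real.coe_toNNReal _ hv'.1.le]
    have h0 : ∫⁻ ω, ∑ s ∈ S l ω, H (s, ω) ∂P = 0 := by
      refine le_antisymm ((hD.lintegral_le l H hHm).trans_eq ?_) zero_le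
      rw [lintegral_eq_zero_of_ae_eq_zero]
      refine .of_forall fun ω => ?_
      refine lintegral_eq_zero_of_ae_eq_zero ?_
      filter_upwards [hnull] with v hv
      simp [hH, hv]
    rw [lintegral_eq_zero_iff (measurable_sum_jumps hS l (hHm.mono predictable_le_prod le_rfl))]
      at h0
    filter_upwards [h0] with ω hω s hs
    have := (Finset.sum_eq_zero_iff.1 hω) s hs
    rw [lt_top_iff_ne_top]
    intro hG
    simp [hH, hG] at this
  filter_upwards [ae_all_iff.2 key] with ω hω
  rw [jumpSum_eq]
  exact ENNReal.sum_lt_top.2 fun l _ => ENNReal.sum_lt_top.2 fun s hs =>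
    hω l s (Finset.mem_filter.1 hs).1

/-- Monotone convergence removes the localisation. -/
theorem lintegral_shot_pow_le (hD : IsDominated P ℱ T S X.c X.a) [IsProbabilityMeasure P]
    {r : ℝ≥0} (t : ℝ) (q : ℕ) (C : ℝ≥0∞)
    (hC : ∀ n : ℕ, ∫⁻ ω, X.cutoff t S r n (r, ω) *
      (X.noise t).Y (points fun l => S l ω) r ^ (q + 1) ∂P ≤ C) :
    ∫⁻ ω, shot X.h (fun l => S l ω) t r ^ (q + 1) ∂P ≤ C := by
  have hS := hD.isPointProcess
  have hm : ∀ n, Measurable fun ω => X.cutoff t S r n (r, ω) *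
      shot X.h (fun l => S l ω) t r ^ (q + 1) := fun n =>
    (((X.predictable_cutoff hS t r n).mono predictable_le_prod le_rfl).comp
      measurable_prodMk_left).mul ((measurable_shot hS X.h_mem.meas t r).pow_const _)
  have h1 : ∫⁻ ω, shot X.h (fun l => S l ω) t r ^ (q + 1) ∂P =
      ∫⁻ ω, ⨆ n, X.cutoff t S r n (r, ω) * shot X.h (fun l => S l ω) t r ^ (q + 1) ∂P := by
    refine lintegral_congr_ae ?_
    filter_upwards [X.ae_jumpSum_lt_top hD t r] with ω hω
    apply le_antisymm
    · obtain ⟨n, hn⟩ := ENNReal.exists_nat_gt hω.ne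
      refine le_trans (le_of_eq ?_) (le_iSup _ n)
      simp [X.cutoff_of_le le_rfl, hn.le]
    · refine iSup_le fun n => ?_
      rw [X.cutoff_of_le le_rfl]
      refine mul_le_of_le_one_left zero_le ?_
      exact indicator_le_self' (fun _ _ => zero_le) _
  rw [h1, lintegral_iSup hm]
  · refine iSup_le fun n => le_trans (lintegral_mono fun ω => ?_) (hC n)
    gcongr
    exact X.sum_le_Y t _ r
  · intro m n hmn ω
    refine mul_le_mul_left ?_ _
    rw [X.cutoff_of_le le_rfl, X.cutoff_of_le le_rfl]
    refine indicator_le_indicator_of_subset (fun v hv => ?_) (fun _ => zero_le) _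
    exact le_trans (show _ ≤ (m : ℝ≥0∞) from hv) (by exact_mod_cast hmn)

theorem lintegral_jumpTerm_le (hS : IsPointProcess P ℱ T S) [IsProbabilityMeasure P]
    {r : ℝ≥0} {t : ℝ} {q n : ℕ} {l : Fin K} {j : ℕ} {M : ℝ≥0∞}
    (hM : ∀ v ≤ r, ∫⁻ ω, (X.noise t).Y (points fun l => S l ω) v ^ j *
      rate X.c X.a (fun l => S l ω) l v ∂P ≤ M) :
    ∫⁻ ω, ∫⁻ v, X.cutoff t S r n (v, ω) *
        (X.jumpTerm t S q l j (v, ω) * rate X.c X.a (fun l => S l ω) l v) ∂timeMeasure T ∂P ≤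
      (q + 1).choose j * M * ∫⁻ y, X.G l y ^ (q + 1 - j) := by
  have hle : ∀ {f : ℝ≥0 × Ω → ℝ≥0∞}, Measurable[ℱ.predictable] f → Measurable f := fun hf =>
    hf.mono predictable_le_prod le_rfl
  have hm : Measurable fun z : ℝ≥0 × Ω => X.cutoff t S r n z *
      (X.jumpTerm t S q l j z * rate X.c X.a (fun l => S l z.2) l z.1) :=
    hle ((X.predictable_cutoff hS t r n).mul ((X.predictable_jumpTerm hS t q l j).mul
      (X.predictable_rate hS l)))
  have hYR : ∀ v : ℝ≥0, Measurable fun ω => (X.noise t).Y (points fun l => S l ω) v ^ j *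
      rate X.c X.a (fun l => S l ω) l v := by
    intro v
    have h1 : Measurable fun z : ℝ≥0 × Ω => (X.noise t).Y (points fun l => S l z.2) z.1 ^ j *
        rate X.c X.a (fun l => S l z.2) l z.1 :=
      hle (((X.predictable_Y hS t).pow_const j).mul (X.predictable_rate hS l))
    have hv : Measurable fun ω : Ω => (v, ω) := measurable_prodMk_left
    have hc := h1.comp hv
    exact hc
  have hGm : Measurable fun v : ℝ => X.G l (t - v) ^ (q + 1 - j) :=
    ((X.G_mem.meas l).comp (by fun_prop)).pow_const _
  rw [lintegral_lintegral_swap (f := fun ω v => X.cutoff t S r n (v, ω) *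
        (X.jumpTerm t S q l j (v, ω) * rate X.c X.a (fun l => S l ω) l v))
    (hm.comp measurable_swap).aemeasurable]
  calc _ ≤ ∫⁻ v, (q + 1).choose j * M * X.G l (t - (v : ℝ≥0)) ^ (q + 1 - j) ∂timeMeasure T := by
        refine lintegral_mono fun v => ?_
        by_cases hv : v ≤ r
        · calc _ ≤ ∫⁻ ω, (q + 1).choose j * X.G l (t - v) ^ (q + 1 - j) *
                ((X.noise t).Y (points fun l => S l ω) v ^ j *
                  rate X.c X.a (fun l => S l ω) l v) ∂P := by
                refine lintegral_mono fun ω => ?_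
                refine (mul_le_of_le_one_left zero_le
                  (indicator_le_self' (fun _ _ => zero_le (a := (1 : ℝ≥0∞))) _)).trans_eq ?_
                simp only [jumpTerm]
                ring
            _ = (q + 1).choose j * X.G l (t - v) ^ (q + 1 - j) *
                ∫⁻ ω, ((X.noise t).Y (points fun l => S l ω) v ^ j *
                  rate X.c X.a (fun l => S l ω) l v) ∂P := lintegral_const_mul _ (hYR v)
            _ ≤ (q + 1).choose j * X.G l (t - v) ^ (q + 1 - j) * M := by
                gcongr
                exact hM v hv
            _ = _ := by ring
        · simp [cutoff, hv]
    _ = ∫⁻ v in Ioc (0 : ℝ) T, (q + 1).choose j * M * X.G l (t - v) ^ (q + 1 - j) := by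
        have hGm' : Measurable fun v : ℝ≥0 => X.G l (t - v) ^ (q + 1 - j) :=
          hGm.comp measurable_coe_nnreal_real
        rw [lintegral_timeMeasure _ (hGm'.const_mul _)]
        refine setLIntegral_congr_fun measurableSet_Ioc fun v hv => ?_
        simp only [Real.coe_toNNReal _ hv.1.le]
    _ ≤ ∫⁻ v, (q + 1).choose j * M * X.G l (t - v) ^ (q + 1 - j) := setLIntegral_le_lintegral _ _
    _ = _ := by
        rw [lintegral_const_mul _ hGm,
          lintegral_sub_left_eq_self (fun y => X.G l y ^ (q + 1 - j)) t]

end HawkesKernel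

universe u in
/-- Induction on the order. After localisation and compensation the moment of order `q + 1` is
bounded by expectations of `Y ^ j` times the rate with `j < q`, hence by moments of orders `j + 1 ≤
q` of the shot noises with the kernels `G` and `a`; so `h` has to vary in the induction. -/
theorem exists_momentBound {K : ℕ} (c : ℝ≥0) (a : Fin K → Fin K → ℝ → ℝ≥0∞)
    (ha : ∀ k, MemAllLp (a k))
    (hsup : ∀ h : Fin K → ℝ → ℝ≥0∞, MemAllLp h → ∃ G : Fin K → ℝ → ℝ≥0∞, MemAllLp G ∧
      ∀ l y, h l y + ∑ k, ∫⁻ x, a k l x * G k (y - x) ≤ G l y) (q : ℕ) :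
    ∀ h : Fin K → ℝ → ℝ≥0∞, MemAllLp h → ∃ C : ℝ≥0, HasMomentBound.{u} c a h q C := by
  induction q using Nat.strong_induction_on with
  | _ q ih =>
  intro h hh
  rcases q with _ | q
  · exact ⟨1, fun Ω _ P _ ℱ T S _ r _ t _ => by simp⟩
  obtain ⟨G, hG, hGsup⟩ := hsup h hh
  choose! CG hCG using fun m (hm : m < q + 1) => ih m hm G hG
  choose! Ca hCa using fun m (hm : m < q + 1) (k : Fin K) => ih m hm (a k) (ha k)
  let X : HawkesKernel K := ⟨c, a, h, G, ha, hh, hG, hGsup⟩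
  set M : ℕ → Fin K → ℝ≥0∞ := fun j l => 2 ^ (j + 1) * (X.base ^ (j + 1) + CG (j + 1)) +
    2 ^ (j + 1) * ((c : ℝ≥0∞) ^ (j + 1) + Ca (j + 1) l) with hMdef
  set C : ℝ≥0∞ := X.base ^ (q + 1) + ∑ l, ∑ j ∈ Finset.range q,
    (q + 1).choose j * M j l * ∫⁻ y, G l y ^ (q + 1 - j) with hCdef
  have hbase : X.base ≠ ∞ := X.base_lt_top.ne
  have hC : C ≠ ∞ := by
    refine ENNReal.add_ne_top.2 ⟨ENNReal.pow_ne_top hbase, ?_⟩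
    refine (ENNReal.sum_lt_top.2 fun l _ => ENNReal.sum_lt_top.2 fun j hj => ?_).ne
    have h1 : ∫⁻ y, G l y ^ (q + 1 - j) < ∞ := by
      have := hG.lintegral_pow_lt_top l (q - j)
      rwa [show q - j + 1 = q + 1 - j by have := Finset.mem_range.1 hj; omega] at this
    refine ENNReal.mul_lt_top (ENNReal.mul_lt_top (by finiteness) ?_) h1
    simp only [hMdef]
    finiteness
  refine ⟨C.toNNReal, fun Ω _ P _ ℱ T S hD r hrT t hrt => ?_⟩
  rw [ENNReal.coe_toNNReal hC]
  have hS := hD.isPointProcess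
  refine X.lintegral_shot_pow_le (hD := hD) t q C fun n =>
    (X.localized_moment_le hD hrT hrt q n).trans (add_le_add le_rfl ?_)
  refine Finset.sum_le_sum fun l _ => Finset.sum_le_sum fun j hj => ?_
  have hj' := Finset.mem_range.1 hj
  refine X.lintegral_jumpTerm_le hS fun v hv => ?_
  have hvt : (v : ℝ) ≤ t := le_trans (by exact_mod_cast hv) hrt
  have hshotG := HawkesKernel.measurable_shot hS hG.meas t v
  have hshota := HawkesKernel.measurable_shot hS (ha l).meas v v
  have hY : ∀ᵐ ω ∂P, (X.noise t).Y (HawkesKernel.points fun l => S l ω) v ^ j *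
      rate X.c X.a (fun l => S l ω) l v ≤
      2 ^ (j + 1) * (X.base ^ (j + 1) + shot G (fun l => S l ω) t v ^ (j + 1)) +
        2 ^ (j + 1) * ((c : ℝ≥0∞) ^ (j + 1) + shot (a l) (fun l => S l ω) v v ^ (j + 1)) := by
    filter_upwards [HawkesKernel.ae_injOn hS] with ω hω
    refine (ENNReal.pow_mul_le_add_pow _ _ _).trans (add_le_add ?_ ?_)
    · refine le_trans (pow_le_pow_left₀ zero_le ?_ _) (ENNReal.add_pow_le_two_pow_mul _ _ _)
      refine ((X.noise t).Y_le _ hω (a := 0) (fun p _ => NNReal.coe_nonneg _) v.2 hvt).trans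
        (add_le_add (X.lintegral_d_le t) ?_)
      rw [X.jumpSum_eq]
      rfl
    · exact ENNReal.add_pow_le_two_pow_mul _ _ _
  refine (lintegral_mono_ae hY).trans ?_
  have hm1 := (hshotG.pow_const (j + 1)).const_add (X.base ^ (j + 1))
  have hm2 := (hshota.pow_const (j + 1)).const_add ((c : ℝ≥0∞) ^ (j + 1))
  rw [lintegral_add_left (hm1.const_mul _), lintegral_const_mul _ hm1, lintegral_const_mul _ hm2,
    lintegral_add_left measurable_const, lintegral_add_left measurable_const]
  simp only [lintegral_const, measure_univ, mul_one, hMdef]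
  gcongr
  · exact hCG (j + 1) (by omega) Ω P ℱ T S hD v (hv.trans hrT) t hvt
  · exact hCa (j + 1) (by omega) l Ω P ℱ T S hD v (hv.trans hrT) v le_rfl

/-! ### Measurability of derivatives and of suprema -/

section measurable_deriv
variable {α E : Type*} [MeasurableSpace α] [NormedAddCommGroup E] [NormedSpace ℝ E] {s : Set E}
  {n : ℕ}

/-- Along the directions of the tangent cone the derivatives are limits of difference quotients in
`s`; these directions span a dense subspace. -/
theorem measurable_iteratedFDerivWithin_apply (hs : UniqueDiffOn ℝ s) {u : α → E → ℝ}
    (hm : ∀ x ∈ s, Measurable fun ω => u ω x) :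
    ∀ n : ℕ, (∀ ω, ContDiffOn ℝ n (u ω) s) → ∀ x ∈ s, ∀ v : Fin n → E,
      Measurable fun ω => iteratedFDerivWithin ℝ n (u ω) s x v := by
  intro n
  induction n with
  | zero =>
    intro _ x hx v
    simpa using hm x hx
  | succ n ih =>
    intro hu x hx v
    have hu' : ∀ ω, ContDiffOn ℝ n (u ω) s := fun ω => (hu ω).of_le (by exact_mod_cast n.le_succ)
    have hd : ∀ ω, HasFDerivWithinAt (iteratedFDerivWithin ℝ n (u ω) s)
        (fderivWithin ℝ (iteratedFDerivWithin ℝ n (u ω) s) s x) s x := fun ω =>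
      ((hu ω).differentiableOn_iteratedFDerivWithin (by exact_mod_cast n.lt_succ_self) hs x
        hx).hasFDerivWithinAt
    have key : ∀ y : E, ∀ w : Fin n → E, Measurable fun ω =>
        fderivWithin ℝ (iteratedFDerivWithin ℝ n (u ω) s) s x y w := by
      intro y w
      have heval : ∀ ω, Continuous fun y =>
          fderivWithin ℝ (iteratedFDerivWithin ℝ n (u ω) s) s x y w := fun ω =>
        (continuous_eval_const w).comp (ContinuousLinearMap.continuous _)
      have hspan : ∀ y ∈ Submodule.span ℝ (tangentConeAt ℝ s x), Measurable fun ω =>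
          fderivWithin ℝ (iteratedFDerivWithin ℝ n (u ω) s) s x y w := by
        intro y hy
        induction hy using Submodule.span_induction with
        | mem y hy =>
          obtain ⟨c, d, hd0, hds, hcd⟩ := mem_tangentConeAt_iff_exists_seq.1 hy
          obtain ⟨N, hN⟩ := Filter.eventually_atTop.1 hds
          refine measurable_of_tendsto_metrizable (f := fun j ω => c (j + N) *
            (iteratedFDerivWithin ℝ n (u ω) s (x + d (j + N)) w -
              iteratedFDerivWithin ℝ n (u ω) s x w)) (fun j => ?_) ?_
          · exact ((ih hu' _ (hN _ (Nat.le_add_left _ _)) w).sub (ih hu' x hx w)).const_mul _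
          · refine tendsto_pi_nhds.2 fun ω => ?_
            have h1 := (hd ω).lim hd0 hds hcd
            have h2 := ((continuous_eval_const w).tendsto _).comp h1
            exact h2.comp (Filter.tendsto_add_atTop_nat N)
        | zero => simp
        | add y z _ _ hy hz =>
          simp only [map_add, add_apply]
          exact hy.add hz
        | smul a y _ hy => simpa using hy.const_mul a
      have hy : y ∈ closure (Submodule.span ℝ (tangentConeAt ℝ s x) : Set E) :=
        (hs x hx).dense_tangentConeAt y
      obtain ⟨z, hz, hzy⟩ := mem_closure_iff_seq_limit.1 hy
      exact measurable_of_tendsto_metrizable (fun j => hspan (z j) (hz j))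
        (tendsto_pi_nhds.2 fun ω => ((heval ω).tendsto y).comp hzy)
    simpa only [iteratedFDerivWithin_succ_apply_left] using key (v 0) (Fin.tail v)

end measurable_deriv

theorem exists_countable_iSup_eq {E : Type*} [TopologicalSpace E] (s : Set E)
    [TopologicalSpace.SeparableSpace s] :
    ∃ D ⊆ s, D.Countable ∧ ∀ f : E → ℝ≥0∞, ContinuousOn f s → ⨆ x ∈ s, f x = ⨆ x ∈ D, f x := by
  obtain ⟨D, hDc, hD⟩ := TopologicalSpace.exists_countable_dense s
  refine ⟨Subtype.val '' D, by rintro _ ⟨x, -, rfl⟩; exact x.2, hDc.image _, fun f hf => ?_⟩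
  refine le_antisymm (iSup₂_le fun x hx => ?_) (biSup_mono ?_)
  · have hc : IsClosed {y : s | f y ≤ ⨆ x ∈ Subtype.val '' D, f x} :=
      isClosed_le (continuousOn_iff_continuous_domRestrict.1 hf) continuous_const
    have hsub : D ⊆ {y : s | f y ≤ ⨆ x ∈ Subtype.val '' D, f x} := fun y hy =>
      le_iSup₂ (f := fun x (_ : x ∈ Subtype.val '' D) => f x) (y : E) (mem_image_of_mem _ hy)
    exact hc.closure_subset_iff.2 hsub (hD ⟨x, hx⟩)
  · rintro _ ⟨x, -, rfl⟩; exact x.2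

theorem measurable_indicator_Ioi_of_continuousOn {F : Type*} [TopologicalSpace F]
    {f : ℝ → F} {D : Set ℝ} (hD : D.Finite) (hf : ContinuousOn f (Ici 0 \ D)) {g : F → ℝ≥0∞}
    (hg : Continuous g) : Measurable ((Ioi (0 : ℝ)).indicator fun t => g (f t)) := by
  classical
  have hm : MeasurableSet (Ioi (0 : ℝ) \ D) := measurableSet_Ioi.diff hD.measurableSet
  have h1 : Measurable ((Ioi (0 : ℝ) \ D).piecewise (fun t => g (f t)) fun _ => 0) :=
    (hg.comp_continuousOn
      (hf.mono (sdiff_subset_sdiff_left Ioi_subset_Ici_self))).measurable_piecewise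
        continuousOn_const hm
  refine h1.measurable_of_countable_ne (hD.countable.mono fun t ht => ?_)
  by_contra htD
  refine ht ?_
  by_cases h0 : 0 < t <;> simp [piecewise, h0, htD]

/-! ### Bounds for iterated derivatives -/

section derivative_bounds
variable {E F : Type*} [NormedAddCommGroup E] [NormedSpace ℝ E] [NormedAddCommGroup F]
  [NormedSpace ℝ F] {s : Set E} {t : Set F}

theorem norm_iteratedFDerivWithin_comp_fst_le (hs : UniqueDiffOn ℝ s) (ht : UniqueDiffOn ℝ t)
    {f : E → ℝ} {n : ℕ} (hf : ContDiffOn ℝ n f s) {x : E × F} (hx : x ∈ s ×ˢ t) :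
    ‖iteratedFDerivWithin ℝ n (fun z : E × F => f z.1) (s ×ˢ t) x‖ ≤
      ‖iteratedFDerivWithin ℝ n f s x.1‖ := by
  have hu : UniqueDiffOn ℝ (ContinuousLinearMap.fst ℝ E F ⁻¹' s) := by
    have := hs.prod (uniqueDiffOn_univ (𝕜 := ℝ) (E := F))
    rwa [prod_univ] at this
  have hc : ContDiffOn ℝ n (f ∘ ContinuousLinearMap.fst ℝ E F)
      (ContinuousLinearMap.fst ℝ E F ⁻¹' s) := hf.comp_continuousLinearMap _
  have hsub : s ×ˢ t ⊆ ContinuousLinearMap.fst ℝ E F ⁻¹' s := fun z hz => hz.1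
  have h1 : iteratedFDerivWithin ℝ n (f ∘ ContinuousLinearMap.fst ℝ E F) (s ×ˢ t) x = _ :=
    iteratedFDerivWithin_subset hsub (hs.prod ht) hu hc hx
  change ‖iteratedFDerivWithin ℝ n (f ∘ ContinuousLinearMap.fst ℝ E F) (s ×ˢ t) x‖ ≤ _
  rw [h1, ContinuousLinearMap.iteratedFDerivWithin_comp_right _ hf hs hu hx.1 le_rfl]
  refine (ContinuousMultilinearMap.norm_compContinuousLinearMap_le _ _).trans ?_
  refine mul_le_of_le_one_right (norm_nonneg _) (Finset.prod_le_one (fun _ _ => norm_nonneg _) ?_)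
  exact fun _ _ => ContinuousLinearMap.norm_fst_le ℝ E F

theorem norm_iteratedFDerivWithin_comp_snd_le (hs : UniqueDiffOn ℝ s) (ht : UniqueDiffOn ℝ t)
    {f : F → ℝ} {n : ℕ} (hf : ContDiffOn ℝ n f t) {x : E × F} (hx : x ∈ s ×ˢ t) :
    ‖iteratedFDerivWithin ℝ n (fun z : E × F => f z.2) (s ×ˢ t) x‖ ≤
      ‖iteratedFDerivWithin ℝ n f t x.2‖ := by
  have hu : UniqueDiffOn ℝ (ContinuousLinearMap.snd ℝ E F ⁻¹' t) := by
    have := (uniqueDiffOn_univ (𝕜 := ℝ) (E := E)).prod ht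
    rwa [univ_prod] at this
  have hc : ContDiffOn ℝ n (f ∘ ContinuousLinearMap.snd ℝ E F)
      (ContinuousLinearMap.snd ℝ E F ⁻¹' t) := hf.comp_continuousLinearMap _
  have hsub : s ×ˢ t ⊆ ContinuousLinearMap.snd ℝ E F ⁻¹' t := fun z hz => hz.2
  have h1 : iteratedFDerivWithin ℝ n (f ∘ ContinuousLinearMap.snd ℝ E F) (s ×ˢ t) x = _ :=
    iteratedFDerivWithin_subset hsub (hs.prod ht) hu hc hx
  change ‖iteratedFDerivWithin ℝ n (f ∘ ContinuousLinearMap.snd ℝ E F) (s ×ˢ t) x‖ ≤ _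
  rw [h1, ContinuousLinearMap.iteratedFDerivWithin_comp_right _ hf ht hu hx.2 le_rfl]
  refine (ContinuousMultilinearMap.norm_compContinuousLinearMap_le _ _).trans ?_
  refine mul_le_of_le_one_right (norm_nonneg _) (Finset.prod_le_one (fun _ _ => norm_nonneg _) ?_)
  exact fun _ _ => ContinuousLinearMap.norm_snd_le ℝ E F

theorem norm_iteratedFDerivWithin_mul_le_of_bound (hs : UniqueDiffOn ℝ s) {f g : E → ℝ} {N : ℕ}
    (hf : ContDiffOn ℝ N f s) (hg : ContDiffOn ℝ N g s) {x : E} (hx : x ∈ s) {B : ℝ}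
    (hB : ∀ j ≤ N, ‖iteratedFDerivWithin ℝ j f s x‖ ≤ B) {n : ℕ} (hn : n ≤ N) :
    ‖iteratedFDerivWithin ℝ n (fun y => f y * g y) s x‖ ≤
      2 ^ N * B * ∑ j ∈ Finset.range (N + 1), ‖iteratedFDerivWithin ℝ j g s x‖ := by
  have hB0 : 0 ≤ B := (norm_nonneg _).trans (hB 0 (Nat.zero_le _))
  refine (norm_iteratedFDerivWithin_mul_le hf hg hs hx (n := n) (by exact_mod_cast hn)).trans ?_
  have h1 : ∀ j ∈ Finset.range (n + 1), (n.choose j : ℝ) * ‖iteratedFDerivWithin ℝ j f s x‖ *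
      ‖iteratedFDerivWithin ℝ (n - j) g s x‖ ≤
        2 ^ N * B * ‖iteratedFDerivWithin ℝ (n - j) g s x‖ := by
    intro j hj
    have hj' : j ≤ n := Nat.lt_succ_iff.1 (Finset.mem_range.1 hj)
    gcongr
    · exact_mod_cast (Nat.choose_le_two_pow n j).trans (Nat.pow_le_pow_right two_pos hn)
    · exact hB j (hj'.trans hn)
  refine (Finset.sum_le_sum h1).trans ?_
  rw [← Finset.mul_sum]
  have h2 : ∑ j ∈ Finset.range (n + 1), ‖iteratedFDerivWithin ℝ (n - j) g s x‖ =
      ∑ j ∈ Finset.range (n + 1), ‖iteratedFDerivWithin ℝ j g s x‖ :=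
    Finset.sum_range_reflect (fun j => ‖iteratedFDerivWithin ℝ j g s x‖) (n + 1)
  rw [h2]
  gcongr

theorem abs_derivWithin_Ici_le_one {Φ : ℝ → ℝ} (hlip : ∀ x y, |Φ x - Φ y| ≤ |x - y|) {a y : ℝ}
    (hd : DifferentiableOn ℝ Φ (Ici a)) (hy : a ≤ y) : |derivWithin Φ (Ici a) y| ≤ 1 := by
  have h1 : HasDerivWithinAt Φ (derivWithin Φ (Ici a) y) (Ioi y) y :=
    (hd y hy).hasDerivWithinAt.mono fun z hz => hy.trans (le_of_lt hz)
  rw [hasDerivWithinAt_iff_tendsto_slope' (by simp)] at h1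
  refine le_of_tendsto h1.abs (Filter.Eventually.of_forall fun z => ?_)
  rw [slope_def_field, abs_div]
  exact div_le_one_of_le₀ (hlip z y) (abs_nonneg _)

theorem norm_iteratedFDerivWithin_comp_le_of_lipschitz (hs : UniqueDiffOn ℝ s) {Φ : ℝ → ℝ}
    (hlip : ∀ x y, |Φ x - Φ y| ≤ |x - y|) {f : E → ℝ} {n : ℕ} (hΦ : ContDiffOn ℝ n Φ (Ici 0))
    {B : ℝ} (hB : ∀ j, 2 ≤ j → j ≤ n → ∀ y, 0 ≤ y → |iteratedDerivWithin j Φ (Ici 0) y| ≤ B)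
    (hB0 : 0 ≤ B) (hf : ContDiffOn ℝ n f s) (h0 : ∀ x ∈ s, 0 ≤ f x) {x : E} (hx : x ∈ s) {R : ℝ}
    (hR : ∀ j ≤ n, ‖iteratedFDerivWithin ℝ j f s x‖ ≤ R) :
    ‖iteratedFDerivWithin ℝ n (fun y => Φ (f y)) s x‖ ≤
      n.factorial * (|Φ 0| + 1 + B + R) * (1 + R) ^ n := by
  have hR0 : 0 ≤ R := (norm_nonneg _).trans (hR 0 (Nat.zero_le _))
  have hfR : |f x| ≤ R := by simpa using hR 0 (Nat.zero_le _)
  refine norm_iteratedFDerivWithin_comp_le hΦ hf le_rfl (uniqueDiffOn_Ici 0) hs h0 hx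
    (fun j hj => ?_) fun j hj1 hj => ?_
  · rw [norm_iteratedFDerivWithin_eq_norm_iteratedDerivWithin, Real.norm_eq_abs]
    match j, hj with
    | 0, _ =>
      rw [iteratedDerivWithin_zero]
      have h1 : |Φ (f x)| ≤ |Φ (f x) - Φ 0| + |Φ 0| := by
        simpa using abs_add_le (Φ (f x) - Φ 0) (Φ 0)
      have h2 := hlip (f x) 0
      rw [sub_zero] at h2
      linarith
    | 1, _ =>
      rw [iteratedDerivWithin_one]
      have h1 := abs_derivWithin_Ici_le_one hlip (hΦ.differentiableOn (by simp; omega)) (h0 x hx)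
      have := abs_nonneg (Φ 0)
      linarith
    | j + 2, hj =>
      have := hB (j + 2) (by omega) hj (f x) (h0 x hx)
      have := abs_nonneg (Φ 0)
      linarith
  · refine (hR j hj).trans ((le_add_of_nonneg_left zero_le_one).trans ?_)
    exact le_self_pow₀ (by linarith) (by omega)

end derivative_bounds

/-! ### The kernels of the model -/

theorem exists_bound_of_equicontinuousOn {ι E V : Type*} [TopologicalSpace E]
    [SeminormedAddCommGroup V] {F : ι → E → V} {s : Set E} (hs : IsCompact s)
    (hF : EquicontinuousOn F s) (hb : ∀ y ∈ s, ∃ B : ℝ, ∀ x, ‖F x y‖ ≤ B) :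
    ∃ B : ℝ, ∀ x, ∀ y ∈ s, ‖F x y‖ ≤ B := by
  refine hs.induction_on (p := fun u => ∃ B : ℝ, ∀ x, ∀ y ∈ u, ‖F x y‖ ≤ B) ⟨0, by simp⟩
    (fun u v huv ⟨B, hB⟩ => ⟨B, fun x y hy => hB x y (huv hy)⟩) ?_ fun y hy => ?_
  · rintro u v ⟨B, hB⟩ ⟨B', hB'⟩
    refine ⟨max B B', fun x y hy => ?_⟩
    rcases hy with hy | hy
    · exact (hB x y hy).trans (le_max_left _ _)
    · exact (hB' x y hy).trans (le_max_right _ _)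
  · obtain ⟨B, hB⟩ := hb y hy
    refine ⟨_, hF y hy _ (Metric.dist_mem_uniformity one_pos), B + 1, fun x z hz => ?_⟩
    have h1 : dist (F x y) (F x z) < 1 := hz x
    have h2 := norm_le_norm_add_norm_sub' (F x z) (F x y)
    rw [dist_eq_norm, norm_sub_rev] at h1
    linarith [hB x]

namespace HawkesModel
variable {K p m : ℕ} {M : HawkesModel K p m}

theorem RegularReproduction.exists_bound (hg : M.RegularReproduction) (hΞ : IsCompact M.Ξ) :
    ∃ B : ℝ, ∀ j ≤ 3, ∀ x ∈ Icc (0 : ℝ) 1, ∀ ϖ ∈ M.Ξ,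
      ‖iteratedFDerivWithin ℝ j (M.g x) M.Ξ ϖ‖ ≤ B := by
  have h1 : ∀ j, ∃ B : ℝ, j ≤ 3 → ∀ x : Icc (0 : ℝ) 1, ∀ ϖ ∈ M.Ξ,
      ‖iteratedFDerivWithin ℝ j (M.g x) M.Ξ ϖ‖ ≤ B := by
    intro j
    by_cases hj : j ≤ 3
    · obtain ⟨B, hB⟩ := exists_bound_of_equicontinuousOn hΞ
        (hg.equicontinuousOn j hj).equicontinuousOn fun ϖ hϖ => by
          obtain ⟨B, hB⟩ := isCompact_Icc.exists_bound_of_continuousOn (hg.continuousOn j hj ϖ hϖ)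
          exact ⟨B, fun x => hB x x.2⟩
      exact ⟨B, fun _ => hB⟩
    · exact ⟨0, fun h => absurd h hj⟩
  choose B hB using h1
  refine ⟨∑ j ∈ Finset.range 4, |B j|, fun j hj x hx ϖ hϖ => ?_⟩
  refine ((hB j hj ⟨x, hx⟩ ϖ hϖ).trans (le_abs_self _)).trans ?_
  exact Finset.single_le_sum (f := fun j => |B j|) (fun _ _ => abs_nonneg _)
    (Finset.mem_range.2 (by omega))

theorem exists_isMaxOn_g (hg : M.RegularReproduction) {ϖ : Fin m → ℝ} (hϖ : ϖ ∈ M.Ξ) :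
    ∃ x₀ ∈ Icc (0 : ℝ) 1, ∀ x ∈ Icc (0 : ℝ) 1, M.g x ϖ ≤ M.g x₀ ϖ := by
  have h1 : ContinuousOn (fun x => M.g x ϖ) (Icc (0 : ℝ) 1) := by
    have := (continuous_eval_const (F := ContinuousMultilinearMap ℝ
      (fun _ : Fin 0 => Fin m → ℝ) ℝ) (fun _ : Fin 0 => (0 : Fin m → ℝ))).comp_continuousOn
        (hg.continuousOn 0 (by norm_num) ϖ hϖ)
    simpa [Function.comp_def] using this
  exact isCompact_Icc.exists_isMaxOn ⟨0, by simp⟩ h1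

/-- The supremum over the shape parameters of the norm of the derivative of order `j` of the kernel
`φ k l`, as a function of time, cut off to `(0, ∞)`. -/
noncomputable def kernelSup (M : HawkesModel K p m) (j : ℕ) (k l : Fin K) (u : ℝ) : ℝ≥0∞ :=
  (Ioi (0 : ℝ)).indicator
    (fun u => ⨆ η ∈ M.Γ, ‖iteratedFDerivWithin ℝ j (M.φ k l u) M.Γ η‖ₑ) u

theorem enorm_le_kernelSup (M : HawkesModel K p m) (j : ℕ) (k l : Fin K) {u : ℝ} (hu : 0 < u)
    {η : Fin p → ℝ} (hη : η ∈ M.Γ) :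
    ‖iteratedFDerivWithin ℝ j (M.φ k l u) M.Γ η‖ₑ ≤ M.kernelSup j k l u := by
  rw [kernelSup, indicator_of_mem (mem_Ioi.2 hu)]
  exact le_iSup₂ (f := fun η (_ : η ∈ M.Γ) => ‖iteratedFDerivWithin ℝ j (M.φ k l u) M.Γ η‖ₑ) η hη

theorem memAllLp_kernelSup (hsets : M.ParameterSets) (hdiff : M.Differentiable)
    (htime : M.ContinuousInTime) (hint : M.IntegrableKernels) {j : ℕ} (hj : j ≤ 3) (k : Fin K) :
    MemAllLp (M.kernelSup j k) where
  meas l := by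
    obtain ⟨D, hDs, hDc, hD⟩ := exists_countable_iSup_eq M.Γ
    have h1 : M.kernelSup j k l = fun u => ⨆ η ∈ D, (Ioi (0 : ℝ)).indicator
        (fun u => ‖iteratedFDerivWithin ℝ j (M.φ k l u) M.Γ η‖ₑ) u := by
      ext u
      by_cases hu : 0 < u
      · simp only [kernelSup, indicator_of_mem (mem_Ioi.2 hu)]
        exact hD _ ((hdiff.φ_contDiffOn k l u hu.le).continuousOn_iteratedFDerivWithin
          (by exact_mod_cast hj) hsets.uniqueDiff_Γ).enorm
      · simp [kernelSup, hu]
    rw [h1]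
    refine Measurable.biSup D hDc fun η hη => ?_
    obtain ⟨E, hE, hc⟩ := htime j hj k l η (hDs hη)
    exact measurable_indicator_Ioi_of_continuousOn hE hc continuous_enorm
  lintegral_pow_lt_top l n := by
    have h1 : (fun u => M.kernelSup j k l u ^ (n + 1)) = (Ioi (0 : ℝ)).indicator
        fun u => (⨆ η ∈ M.Γ, ‖iteratedFDerivWithin ℝ j (M.φ k l u) M.Γ η‖ₑ) ^ (n + 1) := by
      ext u
      by_cases hu : 0 < u <;> simp [kernelSup, hu]
    rw [h1, lintegral_indicator measurableSet_Ioi]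
    exact hint j hj k l (n + 1) (Nat.le_add_left _ _)

/-- The envelope of the kernels and of their derivatives of orders up to `3`: the sum of all the
`kernelSup j k l` over `j ≤ 3` and `k`. -/
noncomputable def envelope (M : HawkesModel K p m) (l : Fin K) (u : ℝ) : ℝ≥0∞ :=
  ∑ z ∈ Finset.univ ×ˢ Finset.range 4, M.kernelSup z.2 z.1 l u

theorem memAllLp_envelope (hsets : M.ParameterSets) (hdiff : M.Differentiable)
    (htime : M.ContinuousInTime) (hint : M.IntegrableKernels) : MemAllLp M.envelope := by
  have hz : ∀ z ∈ (Finset.univ : Finset (Fin K)) ×ˢ Finset.range 4,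
      MemAllLp (M.kernelSup z.2 z.1) := fun z hz =>
    memAllLp_kernelSup hsets hdiff htime hint
      (Nat.lt_succ_iff.1 (Finset.mem_range.1 (Finset.mem_product.1 hz).2)) z.1
  refine ⟨fun l => Finset.measurable_fun_sum _ fun z h => (hz z h).meas l, fun l n => ?_⟩
  refine (lintegral_mono fun u => sum_pow_le_of_pow_le (Finset.univ ×ˢ Finset.range 4)
    (fun z => M.kernelSup z.2 z.1 l u) (fun _ => 1) (fun z => M.kernelSup z.2 z.1 l u ^ (n + 1)) n
    fun z _ => by simp).trans_lt ?_
  have hm : ∀ z ∈ (Finset.univ : Finset (Fin K)) ×ˢ Finset.range 4,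
      Measurable fun u => M.kernelSup z.2 z.1 l u ^ (n + 1) := fun z h =>
        ((hz z h).meas l).pow_const _
  rw [lintegral_const_mul _ (Finset.measurable_fun_sum _ hm), lintegral_finsetSum _ hm]
  refine ENNReal.mul_lt_top ?_ (ENNReal.sum_lt_top.2 fun z h => (hz z h).lintegral_pow_lt_top l n)
  exact ENNReal.pow_lt_top (ENNReal.sum_lt_top.2 fun _ _ => ENNReal.one_lt_top)

theorem sum_enorm_le_envelope (M : HawkesModel K p m) (k l : Fin K) {u : ℝ} (hu : 0 < u)
    {η : Fin p → ℝ} (hη : η ∈ M.Γ) :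
    ∑ j ∈ Finset.range 4, ‖iteratedFDerivWithin ℝ j (M.φ k l u) M.Γ η‖ₑ ≤ M.envelope l u := by
  rw [envelope, Finset.sum_product]
  refine (Finset.sum_le_sum fun j _ => M.enorm_le_kernelSup j k l hu hη).trans ?_
  exact Finset.single_le_sum (f := fun k => ∑ j ∈ Finset.range 4, M.kernelSup j k l u)
    (fun _ _ => zero_le) (Finset.mem_univ k)

/-- The kernels at the shape parameter `η`, multiplied by `c` and cut off to `(0, ∞)`. -/
noncomputable def scaledKernel (M : HawkesModel K p m) (c : ℝ≥0) (η : Fin p → ℝ) (k l : Fin K)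
    (u : ℝ) : ℝ≥0∞ :=
  c * (Ioi (0 : ℝ)).indicator (fun u => ‖M.φ k l u η‖ₑ) u

theorem measurable_indicator_enorm_φ (htime : M.ContinuousInTime) {η : Fin p → ℝ} (hη : η ∈ M.Γ)
    (k l : Fin K) : Measurable ((Ioi (0 : ℝ)).indicator fun u => ‖M.φ k l u η‖ₑ) := by
  obtain ⟨E, hE, hc⟩ := htime 0 (by norm_num) k l η hη
  have h1 := measurable_indicator_Ioi_of_continuousOn hE hc continuous_enorm
  have h2 : ∀ u, ‖iteratedFDerivWithin ℝ 0 (M.φ k l u) M.Γ η‖ₑ = ‖M.φ k l u η‖ₑ := fun u => by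
    rw [← ofReal_norm, norm_iteratedFDerivWithin_zero, ofReal_norm]
  simpa only [h2] using h1

theorem indicator_enorm_φ_le (M : HawkesModel K p m) {η : Fin p → ℝ} (hη : η ∈ M.Γ)
    (k l : Fin K) (u : ℝ) :
    (Ioi (0 : ℝ)).indicator (fun u => ‖M.φ k l u η‖ₑ) u ≤ M.kernelSup 0 k l u := by
  by_cases hu : 0 < u
  · rw [indicator_of_mem (mem_Ioi.2 hu)]
    refine le_trans (le_of_eq ?_) (M.enorm_le_kernelSup 0 k l hu hη)
    rw [← ofReal_norm, ← ofReal_norm, norm_iteratedFDerivWithin_zero]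
  · rw [indicator_of_notMem (by simpa using hu)]
    exact zero_le

theorem memAllLp_scaledKernel (hsets : M.ParameterSets) (hdiff : M.Differentiable)
    (htime : M.ContinuousInTime) (hint : M.IntegrableKernels) {η : Fin p → ℝ} (hη : η ∈ M.Γ)
    (c : ℝ≥0) (k : Fin K) : MemAllLp (M.scaledKernel c η k) where
  meas l := (measurable_indicator_enorm_φ htime hη k l).const_mul _
  lintegral_pow_lt_top l n := by
    have h := memAllLp_kernelSup hsets hdiff htime hint (j := 0) (by norm_num) k
    have h1 : ∀ u, M.scaledKernel c η k l u ^ (n + 1) ≤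
        (c : ℝ≥0∞) ^ (n + 1) * M.kernelSup 0 k l u ^ (n + 1) := fun u => by
      rw [scaledKernel, mul_pow]
      gcongr
      exact M.indicator_enorm_φ_le hη k l u
    refine (lintegral_mono h1).trans_lt ?_
    rw [lintegral_const_mul _ ((h.meas l).pow_const _)]
    exact ENNReal.mul_lt_top (by finiteness) (h.lintegral_pow_lt_top l n)

/-- The matrix of the integrals of the kernels, with non-negative entries. -/
noncomputable def massMatrix (M : HawkesModel K p m) (η : Fin p → ℝ) :
    Matrix (Fin K) (Fin K) ℝ≥0 :=
  Matrix.of fun k l => (∫⁻ u, (Ioi (0 : ℝ)).indicator (fun u => ‖M.φ k l u η‖ₑ) u).toNNReal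

theorem lintegral_scaledKernel (hsets : M.ParameterSets) (hdiff : M.Differentiable)
    (htime : M.ContinuousInTime) (hint : M.IntegrableKernels) {η : Fin p → ℝ} (hη : η ∈ M.Γ)
    (c : ℝ≥0) (k l : Fin K) :
    ∫⁻ u, M.scaledKernel c η k l u = (c * M.massMatrix η k l : ℝ≥0) := by
  have h := memAllLp_scaledKernel hsets hdiff htime hint hη 1 k
  have h1 : ∫⁻ u, (Ioi (0 : ℝ)).indicator (fun u => ‖M.φ k l u η‖ₑ) u ≠ ∞ := by
    have := (h.lintegral_lt_top l).ne
    simpa [scaledKernel] using this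
  simp only [scaledKernel]
  rw [lintegral_const_mul _ (measurable_indicator_enorm_φ htime hη k l), ENNReal.coe_mul,
    massMatrix, Matrix.of_apply, ENNReal.coe_toNNReal h1]

theorem map_massMatrix (hnonneg : M.Nonneg) (hsets : M.ParameterSets) (hdiff : M.Differentiable)
    (htime : M.ContinuousInTime) (hint : M.IntegrableKernels) {η : Fin p → ℝ} (hη : η ∈ M.Γ) :
    (M.massMatrix η).map (fun x => ((x : ℝ) : ℂ)) = M.kernelMatrix η := by
  ext k l
  have h := (memAllLp_scaledKernel hsets hdiff htime hint hη 1 k).lintegral_lt_top l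
  have hm := measurable_indicator_enorm_φ htime hη k l
  rw [kernelMatrix, massMatrix, Matrix.map_apply, Matrix.of_apply, Matrix.of_apply]
  congr 1
  have h1 : ∫ s in Ioi (0 : ℝ), M.φ k l s η =
      ∫ s in Ioi (0 : ℝ), ((Ioi (0 : ℝ)).indicator (fun u => ‖M.φ k l u η‖ₑ) s).toReal := by
    refine setIntegral_congr_fun measurableSet_Ioi fun s hs => ?_
    have h0 : 0 ≤ M.φ k l s η := hnonneg.φ_nonneg k l s (le_of_lt hs) η hη
    simp only [indicator_of_mem hs, toReal_enorm, Real.norm_of_nonneg h0]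
  rw [h1, integral_toReal hm.aemeasurable]
  · rw [← lintegral_indicator measurableSet_Ioi, indicator_indicator, inter_self]
    rfl
  · refine Filter.Eventually.of_forall fun s => ?_
    by_cases hs : 0 < s <;> simp [hs]

/-- The constant `c` is the maximum of the reproduction rate at the given parameter. -/
theorem exists_supersolution_of_stable (hnonneg : M.Nonneg) (hsets : M.ParameterSets)
    (hdiff : M.Differentiable) (htime : M.ContinuousInTime) (hint : M.IntegrableKernels)
    (hg : M.RegularReproduction) {ϑ : (Fin p → ℝ) × (Fin m → ℝ)} (hϑ : ϑ ∈ M.Θ)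
    (hstable : M.Stable ϑ) :
    ∃ c : ℝ≥0, (∀ x ∈ Icc (0 : ℝ) 1, M.g x ϑ.2 ≤ c) ∧ ∀ h, MemAllLp h → ∃ G, MemAllLp G ∧
      ∀ l y, h l y + ∑ k, ∫⁻ x, M.scaledKernel c ϑ.1 k l x * G k (y - x) ≤ G l y := by
  obtain ⟨x₀, hx₀, hmax⟩ := exists_isMaxOn_g hg hϑ.2
  refine ⟨(M.g x₀ ϑ.2).toNNReal, fun x hx => (hmax x hx).trans (Real.le_coe_toNNReal _),
    fun h hh => ?_⟩
  have hρ : ((M.g x₀ ϑ.2).toNNReal : ℝ≥0∞) *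
      spectralRadius ℂ ((M.massMatrix ϑ.1).map fun x => ((x : ℝ) : ℂ)) < 1 := by
    rw [map_massMatrix hnonneg hsets hdiff htime hint hϑ.1]
    exact (le_iSup₂ (f := fun x (_ : x ∈ Icc (0 : ℝ) 1) => ENNReal.ofReal (M.g x ϑ.2) *
      spectralRadius ℂ (M.kernelMatrix ϑ.1)) x₀ hx₀).trans_lt hstable
  obtain ⟨w, hw, r, d, hd, hdr, hA⟩ := exists_weight_of_spectralRadius_lt_one _ _ hρ
  refine exists_supersolution
    (fun k l => (memAllLp_scaledKernel hsets hdiff htime hint hϑ.1 _ k).meas l) hh hw hd hdr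
    fun l => ?_
  simp_rw [lintegral_scaledKernel hsets hdiff htime hint hϑ.1]
  exact_mod_cast hA l

end HawkesModel

/-! ### Derivatives of the intensity -/

namespace HawkesModel
variable {K p m : ℕ} {M : HawkesModel K p m}

/-- The argument of the activation function `Φ k` in the intensity. -/
noncomputable def potential (M : HawkesModel K p m) (T : ℝ≥0) (S : Fin K → Finset ℝ≥0)
    (k : Fin K) (t : ℝ≥0) (ϑ : (Fin p → ℝ) × (Fin m → ℝ)) : ℝ :=
  M.μ k (t / T) ϑ.1 +
    ∑ l, ∑ s ∈ (S l).filter (· < t), M.g (t / T) ϑ.2 * M.φ k l (t - s) ϑ.1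

theorem ParameterSets.uniqueDiff_Θ (hsets : M.ParameterSets) : UniqueDiffOn ℝ M.Θ :=
  hsets.uniqueDiff_Γ.prod hsets.uniqueDiff_Ξ

theorem div_mem_Icc {t T : ℝ≥0} (ht : t ≤ T) : (t / T : ℝ) ∈ Icc (0 : ℝ) 1 :=
  ⟨by positivity, div_le_one_of_le₀ (by exact_mod_cast ht) T.2⟩

theorem sub_pos_of_mem_filter {S : Finset ℝ≥0} {t s : ℝ≥0} (hs : s ∈ S.filter (· < t)) :
    (0 : ℝ) < t - s :=
  sub_pos.2 (by exact_mod_cast (Finset.mem_filter.1 hs).2)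

theorem potential_nonneg (hnonneg : M.Nonneg) {T t : ℝ≥0} (ht : t ≤ T) (S : Fin K → Finset ℝ≥0)
    (k : Fin K) {ϑ : (Fin p → ℝ) × (Fin m → ℝ)} (hϑ : ϑ ∈ M.Θ) : 0 ≤ M.potential T S k t ϑ :=
  add_nonneg (hnonneg.μ_nonneg k _ (div_mem_Icc ht) _ hϑ.1) <|
    Finset.sum_nonneg fun l _ => Finset.sum_nonneg fun _ hs =>
      mul_nonneg (hnonneg.g_nonneg _ (div_mem_Icc ht) _ hϑ.2)
        (hnonneg.φ_nonneg k l _ (sub_pos_of_mem_filter hs).le _ hϑ.1)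

theorem contDiffOn_μ {n : ℕ} (hn : n ≤ 3) (hdiff : M.Differentiable) {T t : ℝ≥0} (ht : t ≤ T)
    (k : Fin K) :
    ContDiffOn ℝ n (fun ϑ : (Fin p → ℝ) × (Fin m → ℝ) => M.μ k (t / T) ϑ.1) M.Θ :=
  ((hdiff.μ_contDiffOn k _ (div_mem_Icc ht)).of_le (by exact_mod_cast hn)).comp contDiffOn_fst
    fun _ h => h.1

theorem contDiffOn_g {n : ℕ} (hn : n ≤ 3) (hg : M.RegularReproduction) {T t : ℝ≥0} (ht : t ≤ T) :
    ContDiffOn ℝ n (fun ϑ : (Fin p → ℝ) × (Fin m → ℝ) => M.g (t / T) ϑ.2) M.Θ :=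
  ((hg.contDiffOn _ (div_mem_Icc ht)).of_le (by exact_mod_cast hn)).comp contDiffOn_snd
    fun _ h => h.2

theorem contDiffOn_φ {n : ℕ} (hn : n ≤ 3) (hdiff : M.Differentiable) (k l : Fin K)
    {u : ℝ} (hu : 0 ≤ u) :
    ContDiffOn ℝ n (fun ϑ : (Fin p → ℝ) × (Fin m → ℝ) => M.φ k l u ϑ.1) M.Θ :=
  ((hdiff.φ_contDiffOn k l _ hu).of_le (by exact_mod_cast hn)).comp contDiffOn_fst fun _ h => h.1

theorem contDiffOn_potential {n : ℕ} (hn : n ≤ 3) (hdiff : M.Differentiable)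
    (hg : M.RegularReproduction) {T t : ℝ≥0} (ht : t ≤ T) (S : Fin K → Finset ℝ≥0) (k : Fin K) :
    ContDiffOn ℝ n (M.potential T S k t) M.Θ :=
  (contDiffOn_μ hn hdiff ht k).add <| ContDiffOn.sum fun l _ => ContDiffOn.sum fun _ hs =>
    (contDiffOn_g hn hg ht).mul (contDiffOn_φ hn hdiff k l (sub_pos_of_mem_filter hs).le)

theorem contDiffOn_intensity {n : ℕ} (hn : n ≤ 3) (hnonneg : M.Nonneg) (hdiff : M.Differentiable)
    (hg : M.RegularReproduction) (hsmooth : M.SmoothActivation n) {T t : ℝ≥0} (ht : t ≤ T)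
    (S : Fin K → Finset ℝ≥0) (k : Fin K) : ContDiffOn ℝ n (M.intensity T S k t) M.Θ :=
  (hsmooth k).1.comp (contDiffOn_potential hn hdiff hg ht S k)
    fun _ hϑ => potential_nonneg hnonneg ht S k hϑ

theorem norm_iteratedFDerivWithin_potential_le {n : ℕ} (hn : n ≤ 3)
    (hsets : M.ParameterSets) (hdiff : M.Differentiable) (hg : M.RegularReproduction) {Bμ Bg : ℝ}
    (hBμ : ∀ i ≤ 3, ∀ k, ∀ x ∈ Icc (0 : ℝ) 1, ∀ η ∈ M.Γ,
      ‖iteratedFDerivWithin ℝ i (M.μ k x) M.Γ η‖ ≤ Bμ)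
    (hBg : ∀ j ≤ 3, ∀ x ∈ Icc (0 : ℝ) 1, ∀ ϖ ∈ M.Ξ,
      ‖iteratedFDerivWithin ℝ j (M.g x) M.Ξ ϖ‖ ≤ Bg) {T t : ℝ≥0}
    (ht : t ≤ T) (S : Fin K → Finset ℝ≥0) (k : Fin K) {ϑ : (Fin p → ℝ) × (Fin m → ℝ)}
    (hϑ : ϑ ∈ M.Θ) : ‖iteratedFDerivWithin ℝ n (M.potential T S k t) M.Θ ϑ‖ ≤
      Bμ + 8 * Bg * ∑ l, ∑ s ∈ (S l).filter (· < t), ∑ j ∈ Finset.range 4,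
        ‖iteratedFDerivWithin ℝ j (M.φ k l (t - s)) M.Γ ϑ.1‖ := by
  have hΘ := hsets.uniqueDiff_Θ
  have hx := div_mem_Icc ht
  have hprod : ∀ l, ∀ s ∈ (S l).filter (· < t), ContDiffOn ℝ n
      (fun ϑ : (Fin p → ℝ) × (Fin m → ℝ) => M.g (t / T) ϑ.2 * M.φ k l (t - s) ϑ.1) M.Θ :=
    fun l s hs => (contDiffOn_g hn hg ht).mul
      (contDiffOn_φ hn hdiff k l (sub_pos_of_mem_filter hs).le)
  have hterm : ∀ l, ∀ s ∈ (S l).filter (· < t), ‖iteratedFDerivWithin ℝ n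
      (fun ϑ : (Fin p → ℝ) × (Fin m → ℝ) => M.g (t / T) ϑ.2 * M.φ k l (t - s) ϑ.1) M.Θ ϑ‖ ≤
      8 * Bg * ∑ j ∈ Finset.range 4, ‖iteratedFDerivWithin ℝ j (M.φ k l (t - s)) M.Γ ϑ.1‖ := by
    intro l s hs
    have hs0 := (sub_pos_of_mem_filter hs).le
    have hBg0 : 0 ≤ Bg := (norm_nonneg _).trans (hBg 0 (by norm_num) _ hx _ hϑ.2)
    refine (norm_iteratedFDerivWithin_mul_le_of_bound hΘ (contDiffOn_g le_rfl hg ht)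
      (contDiffOn_φ le_rfl hdiff k l hs0) hϑ (B := Bg) (fun j hj => ?_) hn).trans ?_
    · exact (norm_iteratedFDerivWithin_comp_snd_le hsets.uniqueDiff_Γ hsets.uniqueDiff_Ξ
        ((hg.contDiffOn _ hx).of_le (by exact_mod_cast hj)) hϑ).trans (hBg j hj _ hx _ hϑ.2)
    · norm_num only
      gcongr with j hj
      exact norm_iteratedFDerivWithin_comp_fst_le hsets.uniqueDiff_Γ hsets.uniqueDiff_Ξ
        ((hdiff.φ_contDiffOn k l _ hs0).of_le
          (by exact_mod_cast Nat.lt_succ_iff.1 (Finset.mem_range.1 hj))) hϑ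
  have hsum : ∀ l, ContDiffOn ℝ n (fun ϑ : (Fin p → ℝ) × (Fin m → ℝ) =>
      ∑ s ∈ (S l).filter (· < t), M.g (t / T) ϑ.2 * M.φ k l (t - s) ϑ.1) M.Θ :=
    fun l => ContDiffOn.sum (hprod l)
  have heq : iteratedFDerivWithin ℝ n (M.potential T S k t) M.Θ ϑ =
      iteratedFDerivWithin ℝ n (fun ϑ : (Fin p → ℝ) × (Fin m → ℝ) => M.μ k (t / T) ϑ.1) M.Θ ϑ +
      ∑ l, ∑ s ∈ (S l).filter (· < t), iteratedFDerivWithin ℝ n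
        (fun ϑ : (Fin p → ℝ) × (Fin m → ℝ) => M.g (t / T) ϑ.2 * M.φ k l (t - s) ϑ.1) M.Θ ϑ := by
    have h1 := fun_iteratedFDerivWithin_add_apply (i := n) (contDiffOn_μ hn hdiff ht k ϑ hϑ)
      (ContDiffOn.sum (fun l (_ : l ∈ Finset.univ) => hsum l) ϑ hϑ) hΘ hϑ
    have h2 := iteratedFDerivWithin_fun_sum_apply (i := n) hΘ hϑ
      fun l (_ : l ∈ Finset.univ) => hsum l ϑ hϑ
    have h3 : ∀ l, _ := fun l => iteratedFDerivWithin_fun_sum_apply (i := n) hΘ hϑ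
      fun s hs => hprod l s hs ϑ hϑ
    simp_rw [h3] at h2
    rw [h2] at h1
    exact h1
  rw [heq]
  refine (norm_add_le _ _).trans (add_le_add ?_ ?_)
  · exact (norm_iteratedFDerivWithin_comp_fst_le hsets.uniqueDiff_Γ hsets.uniqueDiff_Ξ
      ((hdiff.μ_contDiffOn k _ hx).of_le (by exact_mod_cast hn)) hϑ).trans
        (hBμ n hn k _ hx _ hϑ.1)
  · rw [Finset.mul_sum]
    refine (norm_sum_le _ _).trans (Finset.sum_le_sum fun l _ => ?_)
    rw [Finset.mul_sum]
    exact (norm_sum_le _ _).trans (Finset.sum_le_sum fun s hs => hterm l s hs)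

theorem SmoothActivation.exists_bound {i : ℕ} (h : M.SmoothActivation i) :
    ∃ B : ℝ, 0 ≤ B ∧ ∀ k j, 2 ≤ j → j ≤ i → ∀ y, 0 ≤ y →
      |iteratedDerivWithin j (M.Φ k) (Ici 0) y| ≤ B := by
  have h1 : ∀ k j, ∃ B : ℝ, 2 ≤ j → j ≤ i → ∀ y, 0 ≤ y →
      |iteratedDerivWithin j (M.Φ k) (Ici 0) y| ≤ B := by
    intro k j
    by_cases hj : 2 ≤ j ∧ j ≤ i
    · obtain ⟨B, hB⟩ := (h k).2 j hj.1 hj.2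
      exact ⟨B, fun _ _ => hB⟩
    · exact ⟨0, fun h2 hi => absurd ⟨h2, hi⟩ hj⟩
  choose B hB using h1
  refine ⟨∑ k, ∑ j ∈ Finset.range (i + 1), |B k j|, by positivity, fun k j h2 hj y hy => ?_⟩
  refine ((hB k j h2 hj y hy).trans (le_abs_self _)).trans ?_
  refine (Finset.single_le_sum (f := fun j => |B k j|) (fun _ _ => abs_nonneg _)
    (Finset.mem_range.2 (Nat.lt_succ_iff.2 hj))).trans ?_
  exact Finset.single_le_sum (f := fun k => ∑ j ∈ Finset.range (i + 1), |B k j|)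
    (fun _ _ => Finset.sum_nonneg fun _ _ => abs_nonneg _) (Finset.mem_univ k)

theorem ofReal_sum_le_shot (M : HawkesModel K p m) (S : Fin K → Finset ℝ≥0) (k : Fin K) (t : ℝ≥0)
    {η : Fin p → ℝ} (hη : η ∈ M.Γ) :
    ENNReal.ofReal (∑ l, ∑ s ∈ (S l).filter (· < t), ∑ j ∈ Finset.range 4,
      ‖iteratedFDerivWithin ℝ j (M.φ k l (t - s)) M.Γ η‖) ≤ shot M.envelope S t t := by
  rw [ENNReal.ofReal_sum_of_nonneg fun _ _ => by positivity, shot]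
  refine Finset.sum_le_sum fun l _ => ?_
  rw [ENNReal.ofReal_sum_of_nonneg fun _ _ => by positivity]
  simp only [NNReal.coe_lt_coe]
  refine Finset.sum_le_sum fun s hs => ?_
  rw [ENNReal.ofReal_sum_of_nonneg fun _ _ => by positivity]
  simp_rw [ofReal_norm]
  exact M.sum_enorm_le_envelope k l (sub_pos_of_mem_filter hs) hη

/-- By the chain rule the derivatives of the intensity of order `i ≤ 3` are dominated by a
polynomial of degree `i + 1 ≤ 4` in the shot noise of the envelope, uniformly in the parameter. -/
theorem exists_enorm_deriv_intensity_le (hsets : M.ParameterSets) (hnonneg : M.Nonneg)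
    (hlip : M.LipschitzActivation) (hdiff : M.Differentiable) (hbase : M.BoundedBaselines)
    (hg : M.RegularReproduction) {i : ℕ} (hi : i ≤ 3) (hsmooth : M.SmoothActivation i) :
    ∃ C : ℝ≥0, ∀ T t : ℝ≥0, t ≤ T → ∀ (S : Fin K → Finset ℝ≥0) (k : Fin K), ∀ ϑ ∈ M.Θ,
      ‖iteratedFDerivWithin ℝ i (M.intensity T S k t) M.Θ ϑ‖ₑ ≤
        C * (1 + shot M.envelope S t t) ^ 4 := by
  obtain ⟨Bμ, hBμ⟩ := hbase
  obtain ⟨Bg, hBg⟩ := hg.exists_bound hsets.compact_Ξ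
  obtain ⟨B, hB0, hB⟩ := hsmooth.exists_bound
  -- `b * (1 + σ)` dominates every factor of the chain rule bound, with `σ` as below
  set b : ℝ := ∑ k, |M.Φ k 0| + 1 + B + |Bμ| + 8 * |Bg| with hb
  have hΦ0 : 0 ≤ ∑ k, |M.Φ k 0| := by positivity
  have hb1 : 1 ≤ b := by have := abs_nonneg Bμ; have := abs_nonneg Bg; linarith
  refine ⟨(i.factorial * b ^ 4).toNNReal, fun T t ht S k ϑ hϑ => ?_⟩
  set σ : ℝ := ∑ l, ∑ s ∈ (S l).filter (· < t), ∑ j ∈ Finset.range 4,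
    ‖iteratedFDerivWithin ℝ j (M.φ k l (t - s)) M.Γ ϑ.1‖ with hσ
  have hσ0 : 0 ≤ σ := by positivity
  set R := |Bμ| + 8 * |Bg| * σ with hR
  have hR0 : 0 ≤ R := by positivity
  have h1 : ‖iteratedFDerivWithin ℝ i (M.intensity T S k t) M.Θ ϑ‖ ≤
      i.factorial * (|M.Φ k 0| + 1 + B + R) * (1 + R) ^ i := by
    refine norm_iteratedFDerivWithin_comp_le_of_lipschitz hsets.uniqueDiff_Θ (hlip k) (hsmooth k).1
      (hB k) hB0 (contDiffOn_potential hi hdiff hg ht S k)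
      (fun _ h => potential_nonneg hnonneg ht S k h) hϑ fun j hj => ?_
    refine (norm_iteratedFDerivWithin_potential_le (hj.trans hi) hsets hdiff hg hBμ hBg ht S k
      hϑ).trans ?_
    change Bμ + 8 * Bg * σ ≤ |Bμ| + 8 * |Bg| * σ
    gcongr <;> exact le_abs_self _
  have hk : |M.Φ k 0| ≤ ∑ k, |M.Φ k 0| :=
    Finset.single_le_sum (f := fun k => |M.Φ k 0|) (fun _ _ => abs_nonneg _) (Finset.mem_univ k)
  have h2 : |M.Φ k 0| + 1 + B + R ≤ b * (1 + σ) := by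
    have h : 0 ≤ (∑ k, |M.Φ k 0| + 1 + B + |Bμ|) * σ := by positivity
    have h' := abs_nonneg Bg
    rw [hR, hb]
    nlinarith
  have h3 : 1 + R ≤ b * (1 + σ) := by linarith [abs_nonneg (M.Φ k 0)]
  have h4 : 1 ≤ b * (1 + σ) := by linarith
  have h5 : ‖iteratedFDerivWithin ℝ i (M.intensity T S k t) M.Θ ϑ‖ ≤
      i.factorial * b ^ 4 * (1 + σ) ^ 4 := by
    refine h1.trans ?_
    calc (i.factorial : ℝ) * (|M.Φ k 0| + 1 + B + R) * (1 + R) ^ i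
        ≤ i.factorial * (b * (1 + σ)) * (b * (1 + σ)) ^ i := by gcongr
      _ ≤ i.factorial * (b * (1 + σ)) * (b * (1 + σ)) ^ 3 := by gcongr
      _ = _ := by ring
  rw [← ofReal_norm]
  refine (ENNReal.ofReal_le_ofReal h5).trans ?_
  rw [ENNReal.ofReal_mul (by positivity), ENNReal.ofReal_pow (by positivity),
    ENNReal.ofReal_add zero_le_one hσ0, ENNReal.ofReal_one]
  refine mul_le_mul' le_rfl ?_
  gcongr
  exact M.ofReal_sum_le_shot S k t hϑ.1

theorem norm_direction_le (a : Fin p ⊕ Fin m) :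
    ‖(direction a : (Fin p → ℝ) × (Fin m → ℝ))‖ ≤ 1 := by
  rcases a with a | b
  · simp [direction, Prod.norm_def, Pi.norm_single]
  · simp [direction, Prod.norm_def, Pi.norm_single]

theorem derivNormPow_le {i : ℕ} (q : ℕ) {T : ℝ≥0} {S : Fin K → Finset ℝ≥0} {t : ℝ≥0}
    {ϑ : (Fin p → ℝ) × (Fin m → ℝ)} {B : ℝ≥0∞}
    (hB : ∀ k, ‖iteratedFDerivWithin ℝ i (M.intensity T S k t) M.Θ ϑ‖ₑ ≤ B) :
    M.derivNormPow i q T S t ϑ ≤ (K * (p + m) ^ i : ℕ) * B ^ q := by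
  have h1 : ∀ k, ∀ J : Fin i → Fin p ⊕ Fin m, ‖iteratedFDerivWithin ℝ i (M.intensity T S k t) M.Θ ϑ
      (fun a => direction (J a))‖ₑ ^ q ≤ B ^ q := by
    intro k J
    gcongr
    refine le_trans ?_ (hB k)
    rw [← ofReal_norm, ← ofReal_norm]
    refine ENNReal.ofReal_le_ofReal ((ContinuousMultilinearMap.le_opNorm _ _).trans ?_)
    exact mul_le_of_le_one_right (norm_nonneg _) (Finset.prod_le_one (fun _ _ => norm_nonneg _)
      fun a _ => norm_direction_le _)
  refine (Finset.sum_le_sum fun k _ => Finset.sum_le_sum fun J _ => h1 k J).trans (le_of_eq ?_)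
  simp [mul_assoc]

theorem continuousOn_derivNormPow (hsets : M.ParameterSets) {i : ℕ} (q : ℕ) {T : ℝ≥0}
    {S : Fin K → Finset ℝ≥0} {t : ℝ≥0} (h : ∀ k, ContDiffOn ℝ i (M.intensity T S k t) M.Θ) :
    ContinuousOn (M.derivNormPow i q T S t) M.Θ := by
  refine continuousOn_finsetSum _ fun k _ => continuousOn_finsetSum _ fun J _ => ?_
  have h1 := (continuous_eval_const (F := ContinuousMultilinearMap ℝ
    (fun _ : Fin i => (Fin p → ℝ) × (Fin m → ℝ)) ℝ) fun a => direction (J a)).comp_continuousOn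
      ((h k).continuousOn_iteratedFDerivWithin le_rfl hsets.uniqueDiff_Θ)
  exact (ENNReal.continuous_pow q).comp_continuousOn h1.enorm

end HawkesModel

/-! ### The intensity as a random function -/

namespace HawkesModel
variable {K p m : ℕ} {M : HawkesModel K p m}

/-- As the activation functions are Lipschitz, the intensity of the model is dominated by that of a
linear Hawkes process. -/
theorem ofReal_intensity_le_rate (hnonneg : M.Nonneg) (hlip : M.LipschitzActivation) {Bμ : ℝ≥0}
    (hBμ : ∀ k, ∀ x ∈ Icc (0 : ℝ) 1, ∀ η ∈ M.Γ, M.μ k x η ≤ Bμ)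
    {ϑ : (Fin p → ℝ) × (Fin m → ℝ)} (hϑ : ϑ ∈ M.Θ) {c : ℝ≥0}
    (hc : ∀ x ∈ Icc (0 : ℝ) 1, M.g x ϑ.2 ≤ c) {T t : ℝ≥0} (ht : t ≤ T) (S : Fin K → Finset ℝ≥0)
    (k : Fin K) : ENNReal.ofReal (M.intensity T S k t ϑ) ≤
      rate ((∑ k, ‖M.Φ k 0‖₊ + Bμ : ℝ≥0) : ℝ≥0∞) (M.scaledKernel c ϑ.1) S k t := by
  have hx := div_mem_Icc ht
  have h0 : ∀ l, ∀ s ∈ (S l).filter (· < t), 0 ≤ c * M.φ k l (t - s) ϑ.1 := fun l s hs =>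
    mul_nonneg c.2 (hnonneg.φ_nonneg k l _ (sub_pos_of_mem_filter hs).le _ hϑ.1)
  have h1 : M.intensity T S k t ϑ ≤
      ((∑ k, ‖M.Φ k 0‖₊ + Bμ : ℝ≥0) : ℝ) +
        ∑ l, ∑ s ∈ (S l).filter (· < t), c * M.φ k l (t - s) ϑ.1 := by
    have h2 : M.Φ k (M.potential T S k t ϑ) ≤ |M.Φ k 0| + M.potential T S k t ϑ := by
      have := hlip k (M.potential T S k t ϑ) 0
      rw [sub_zero, abs_of_nonneg (potential_nonneg hnonneg ht S k hϑ)] at this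
      linarith [le_abs_self (M.Φ k (M.potential T S k t ϑ) - M.Φ k 0), le_abs_self (M.Φ k 0)]
    have h3 : M.potential T S k t ϑ ≤
        Bμ + ∑ l, ∑ s ∈ (S l).filter (· < t), c * M.φ k l (t - s) ϑ.1 := by
      refine add_le_add (hBμ k _ hx _ hϑ.1) (Finset.sum_le_sum fun l _ => Finset.sum_le_sum
        fun s hs => mul_le_mul_of_nonneg_right (hc _ hx)
          (hnonneg.φ_nonneg k l _ (sub_pos_of_mem_filter hs).le _ hϑ.1))
    have h4 : |M.Φ k 0| ≤ ∑ k, |M.Φ k 0| := Finset.single_le_sum (f := fun k => |M.Φ k 0|)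
      (fun _ _ => abs_nonneg _) (Finset.mem_univ k)
    refine h2.trans ?_
    push_cast
    simp only [Real.norm_eq_abs]
    linarith
  refine (ENNReal.ofReal_le_ofReal h1).trans ?_
  rw [ENNReal.ofReal_add (NNReal.coe_nonneg _)
      (Finset.sum_nonneg fun l _ => Finset.sum_nonneg (h0 l)), ENNReal.ofReal_coe_nnreal, rate,
    ENNReal.ofReal_sum_of_nonneg fun l _ => Finset.sum_nonneg (h0 l)]
  simp only [NNReal.coe_lt_coe]
  refine add_le_add le_rfl (Finset.sum_le_sum fun l _ => ?_)
  rw [ENNReal.ofReal_sum_of_nonneg (h0 l)]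
  refine Finset.sum_le_sum fun s hs => ?_
  rw [scaledKernel, indicator_of_mem (mem_Ioi.2 (sub_pos_of_mem_filter hs)),
    ENNReal.ofReal_mul c.coe_nonneg, ENNReal.ofReal_coe_nnreal]
  exact mul_le_mul' le_rfl (Real.ofReal_le_enorm _)

section pointProcess
variable {Ω : Type*} [MeasurableSpace Ω] {P : Measure Ω}
  {ℱ : Filtration ℝ≥0 (inferInstance : MeasurableSpace Ω)} {T : ℝ≥0} {S : Fin K → Ω → Finset ℝ≥0}

theorem isDominated (hnonneg : M.Nonneg) (hlip : M.LipschitzActivation) {Bμ : ℝ≥0}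
    (hBμ : ∀ k, ∀ x ∈ Icc (0 : ℝ) 1, ∀ η ∈ M.Γ, M.μ k x η ≤ Bμ)
    {ϑ : (Fin p → ℝ) × (Fin m → ℝ)} (hϑ : ϑ ∈ M.Θ) {c : ℝ≥0}
    (hc : ∀ x ∈ Icc (0 : ℝ) 1, M.g x ϑ.2 ≤ c)
    (ha : ∀ k l, Measurable (M.scaledKernel c ϑ.1 k l)) (hS : IsHawkesProcess M ϑ P ℱ T S) :
    IsDominated P ℱ T S ((∑ k, ‖M.Φ k 0‖₊ + Bμ : ℝ≥0) : ℝ≥0∞) (M.scaledKernel c ϑ.1) where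
  isPointProcess := hS.isPointProcess
  lintegral_le k H hH := by
    rw [(hS.hasIntensity k).lintegral_eq H hH]
    refine lintegral_mono fun ω => ?_
    have hr : Measurable[ℱ.predictable] fun z : ℝ≥0 × Ω =>
        rate ((∑ k, ‖M.Φ k 0‖₊ + Bμ : ℝ≥0) : ℝ≥0∞) (M.scaledKernel c ϑ.1)
          (fun l => S l z.2) k z.1 :=
      Measurable.const_add (HawkesKernel.predictable_sum hS.isPointProcess
        (F := fun l w => M.scaledKernel c ϑ.1 k l ((w.1 : ℝ) - w.2))
          fun l => (ha k l).comp (by fun_prop)) _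
    have hsec : Measurable fun v : ℝ≥0 => (v, ω) := measurable_prodMk_right
    have hH' := (hH.mono predictable_le_prod le_rfl).comp hsec
    have hr' := (hr.mono predictable_le_prod le_rfl).comp hsec
    refine le_trans ?_ (lintegral_timeMeasure T (hH'.mul hr')).ge
    refine setLIntegral_mono' measurableSet_Ioc fun v hv => mul_le_mul' le_rfl ?_
    exact ofReal_intensity_le_rate hnonneg hlip hBμ hϑ hc (Real.toNNReal_le_iff_le_coe.2 hv.2) _ k

theorem measurable_intensity (hnonneg : M.Nonneg) (hlip : M.LipschitzActivation)
    (htime : M.ContinuousInTime) (hS : IsPointProcess P ℱ T S) {t : ℝ≥0} (k : Fin K)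
    {ϑ : (Fin p → ℝ) × (Fin m → ℝ)} (hϑ : ϑ ∈ M.Θ) :
    Measurable fun ω => M.intensity T (fun l => S l ω) k t ϑ := by
  have hΦ : Continuous (M.Φ k) := by
    have h : LipschitzWith 1 (M.Φ k) := LipschitzWith.of_dist_le_mul fun x y => by
      simpa [Real.dist_eq] using hlip k x y
    exact h.continuous
  refine hΦ.measurable.comp (Measurable.const_add (Finset.measurable_fun_sum _ fun l _ => ?_) _)
  have h1 : ∀ ω, ∑ s ∈ (S l ω).filter (· < t), M.g (t / T) ϑ.2 * M.φ k l (t - s) ϑ.1 =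
      M.g (t / T) ϑ.2 * (∑ s ∈ (S l ω).filter (· < t),
        (Ioi (0 : ℝ)).indicator (fun u => ‖M.φ k l u ϑ.1‖ₑ) (t - s)).toReal := by
    intro ω
    rw [← Finset.mul_sum, ENNReal.toReal_sum]
    · congr 1
      refine Finset.sum_congr rfl fun s hs => ?_
      have hpos := sub_pos_of_mem_filter hs
      rw [indicator_of_mem (mem_Ioi.2 hpos), toReal_enorm,
        Real.norm_of_nonneg (hnonneg.φ_nonneg k l _ hpos.le _ hϑ.1)]
    · intro s hs
      rw [indicator_of_mem (mem_Ioi.2 (sub_pos_of_mem_filter hs))]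
      exact enorm_ne_top
  simp_rw [h1]
  refine Measurable.const_mul (Measurable.ennreal_toReal ?_) _
  have hF : Measurable fun z : ℝ≥0 × ℝ≥0 =>
      (Ioi (0 : ℝ)).indicator (fun u => ‖M.φ k l u ϑ.1‖ₑ) ((z.1 : ℝ) - z.2) :=
    (measurable_indicator_enorm_φ htime hϑ.1 k l).comp (by fun_prop)
  exact measurable_sum_points_lt (hS.adapted l) hF t

theorem measurable_iSup_derivNormPow (hsets : M.ParameterSets) (hnonneg : M.Nonneg)
    (hlip : M.LipschitzActivation) (htime : M.ContinuousInTime) (hS : IsPointProcess P ℱ T S)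
    {t : ℝ≥0} {i : ℕ} (q : ℕ)
    (h : ∀ ω k, ContDiffOn ℝ i (M.intensity T (fun l => S l ω) k t) M.Θ) :
    Measurable fun ω => ⨆ ϑ ∈ M.Θ, M.derivNormPow i q T (fun l => S l ω) t ϑ := by
  obtain ⟨D, hDs, hDc, hD⟩ := exists_countable_iSup_eq M.Θ
  simp_rw [fun ω => hD _ (continuousOn_derivNormPow hsets q (h ω))]
  refine Measurable.biSup D hDc fun ϑ hϑ => ?_
  refine Finset.measurable_fun_sum _ fun k _ => Finset.measurable_fun_sum _ fun J _ => ?_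
  exact (measurable_iteratedFDerivWithin_apply hsets.uniqueDiff_Θ
    (fun _ => measurable_intensity hnonneg hlip htime hS k) i (fun ω => h ω k) ϑ (hDs hϑ)
      _).enorm.pow_const _

end pointProcess
end HawkesModel

theorem proposition5p1 {K p m : ℕ} (M : HawkesModel K p m)
    (ϑstar : (Fin p → ℝ) × (Fin m → ℝ)) (hϑstar : ϑstar ∈ M.Θ)
    (hsets : M.ParameterSets) (hnonneg : M.Nonneg)
    (hlip : M.LipschitzActivation) (hstable : M.Stable ϑstar)
    (hdiff : M.Differentiable) (htime : M.ContinuousInTime) (hint : M.IntegrableKernels)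
    (hbase : M.BoundedBaselines) (hg : M.RegularReproduction)
    (i : ℕ) (hi : i ≤ 3) (hsmooth : M.SmoothActivation i) (q : ℕ) :
    ∃ C : ℝ≥0, ∀ T : ℝ≥0, 0 < T →
      ∀ (Ω : Type*) [MeasurableSpace Ω] (P : Measure Ω) [IsProbabilityMeasure P]
        (ℱ : Filtration ℝ≥0 (inferInstance : MeasurableSpace Ω)) (S : Fin K → Ω → Finset ℝ≥0),
        IsHawkesProcess M ϑstar P ℱ T S → ∀ t ≤ T,
          (∀ ω k, ContDiffOn ℝ i (M.intensity T (fun l => S l ω) k t) M.Θ) ∧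
          AEMeasurable (fun ω => ⨆ ϑ ∈ M.Θ, M.derivNormPow i q T (fun l => S l ω) t ϑ) P ∧
          ∫⁻ ω, ⨆ ϑ ∈ M.Θ, M.derivNormPow i q T (fun l => S l ω) t ϑ ∂P ≤ C := by
  obtain ⟨c, hc, hsup⟩ := HawkesModel.exists_supersolution_of_stable hnonneg hsets hdiff htime hint
    hg hϑstar hstable
  have ha := HawkesModel.memAllLp_scaledKernel hsets hdiff htime hint hϑstar.1 c
  obtain ⟨B, hB⟩ := hbase
  have hBμ : ∀ k, ∀ x ∈ Icc (0 : ℝ) 1, ∀ η ∈ M.Γ, M.μ k x η ≤ B.toNNReal := fun k x hx η hη => by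
    have := hB 0 (by norm_num) k x hx η hη
    rw [norm_iteratedFDerivWithin_zero] at this
    exact ((le_abs_self _).trans this).trans (Real.le_coe_toNNReal B)
  have hH := HawkesModel.memAllLp_envelope hsets hdiff htime hint
  obtain ⟨C, hC⟩ := exists_momentBound (∑ k, ‖M.Φ k 0‖₊ + B.toNNReal) (M.scaledKernel c ϑstar.1)
    ha hsup (4 * q) _ hH
  obtain ⟨C', hC'⟩ := HawkesModel.exists_enorm_deriv_intensity_le hsets hnonneg hlip hdiff ⟨B, hB⟩
    hg hi hsmooth
  refine ⟨(K * (p + m) ^ i : ℕ) * C' ^ q * (2 ^ (4 * q) * (1 + C)), ?_⟩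
  intro T _ Ω _ P _ ℱ S hS t ht
  have hcont : ∀ ω k, ContDiffOn ℝ i (M.intensity T (fun l => S l ω) k t) M.Θ := fun ω k =>
    HawkesModel.contDiffOn_intensity hi hnonneg hdiff hg hsmooth ht _ k
  refine ⟨hcont, (HawkesModel.measurable_iSup_derivNormPow hsets hnonneg hlip htime
    hS.isPointProcess q hcont).aemeasurable, ?_⟩
  have hdom := HawkesModel.isDominated hnonneg hlip hBμ hϑstar hc (fun k => (ha k).meas) hS
  have hZ : ∫⁻ ω, shot M.envelope (fun l => S l ω) t t ^ (4 * q) ∂P ≤ C :=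
    hC Ω P ℱ T S hdom t ht t le_rfl
  have hZm : Measurable fun ω => shot M.envelope (fun l => S l ω) t t :=
    HawkesKernel.measurable_shot hS.isPointProcess hH.meas t t
  have hpt : ∀ ω, ⨆ ϑ ∈ M.Θ, M.derivNormPow i q T (fun l => S l ω) t ϑ ≤
      (K * (p + m) ^ i : ℕ) * (C' : ℝ≥0∞) ^ q *
        (2 ^ (4 * q) * (1 + shot M.envelope (fun l => S l ω) t t ^ (4 * q))) := by
    intro ω
    refine iSup₂_le fun ϑ hϑ => (HawkesModel.derivNormPow_le q fun k =>
      hC' T t ht (fun l => S l ω) k ϑ hϑ).trans ?_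
    rw [mul_pow, ← pow_mul, mul_assoc]
    gcongr
    simpa using ENNReal.add_pow_le_two_pow_mul 1 (shot M.envelope (fun l => S l ω) t t) (4 * q)
  refine (lintegral_mono hpt).trans ?_
  have hm1 : Measurable fun ω => shot M.envelope (fun l => S l ω) t t ^ (4 * q) :=
    hZm.pow_const _
  have hm2 : Measurable fun ω => 1 + shot M.envelope (fun l => S l ω) t t ^ (4 * q) :=
    hm1.const_add _
  rw [lintegral_const_mul _ (hm2.const_mul _), lintegral_const_mul _ hm2,
    lintegral_add_right _ hm1, lintegral_one, measure_univ]
  push_cast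
  gcongr
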